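/- Let $D\ge 3$ and consider the quartic tensor model with action $S(\mathbb T,\overline{\mathbb T})=\mathrm{Tr}_{\mathcal B_2}(\mathbb T,\overline{\mathbb T})-\sum_{c=1}^D\frac z2\,\mathrm{Tr}_{\mathcal B_{4,\{c\}}}(\mathbb T,\overline{\mathbb T})$ and weight $e^{-N^{D-1}S}$, for a complex tensor $\mathbb T$ with $D$ indices of size $N$. For $\mathcal C\subset\{1,\dots,D\}$, $\mathcal B_{4,\mathcal C}$ is the $D$-colored bipartite graph whose four vertices form two (white, black) pairs, the two vertices of a pair being joined by the edges with colors outside $\mathcal C$, while the edges with colors in $\mathcal C$ join the two pairs; thus $\mathcal B_{4,\mathcal C}=\mathcal B_{4,\mathcal C^c}$, and $\mathcal B_{4,\emptyset}$ has $\rho=2$ connected components, while $\rho=1$ for $1\le|\mathcal C|\le D/2$. All expectations are taken in the sense of perturbation theory, i.e. as formal power series in $z$ obtained by expanding the quartic part of the exponential and integrating term by term against the Gaussian measure. For $N\ge 2$ the 4-point cumulant has a unique expansion $$W^{(4)}_{\vec a^1\vec a^2,\vec b^1\vec b^2}=\sum_{\mathcal B_{4,\mathcal C}}\bar\delta^{\mathcal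 B_{4,\mathcal C}}_{\vec a^1\vec a^2,\vec b^1\vec b^2}\,W(\mathcal B_{4,\mathcal C};N,z)$$ over the bubbles $\mathcal B_{4,\mathcal C}$ (each counted once), where $\bar\delta^{\mathcal B}$ is the trace-invariant operator of $\mathcal B$ (the product of the Kronecker deltas of its edges) symmetrized over the two indices $\vec a^1,\vec a^2$. Put $K(\mathcal B_{4,\mathcal C};N,z)=W(\mathcal B_{4,\mathcal C};N,z)\,/\,N^{D-4(D-1)-\rho(\mathcal B_{4,\mathcal C})}$. Let $T(z)=\frac{1-\sqrt{1-4Dz}}{2Dz}=\sum_{n\ge0}\frac{1}{n+1}\binom{2n}{n}D^nz^n$, the power series solution of $1-T+DzT^2=0$. Below, $O(N^{-(D-2)})$ is meant as $N\to\infty$ for the coefficient of each power of $z$. For every $\mathcal C$, $$K(\mathcal B_{4,\mathcal C};N,z)=K(\mathcal B_{4,\mathcal C};z)+O(N^{-(D-2)}),$$ where the large-$N$ limit $K(\mathcal B_{4,\mathcal C};z)$ is the sum, with weight $z$ per edge, over the (unlabeled) plane trees with edges colored by $\{1,\dots,D\}$ and two distinguishable cilia on two different vertices, whose boundary graph is $\mathcal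 B_{4,\mathcal C}$. (The boundary graph has a white and a black vertex for each cilium and, for each color $c$ and each external face of color $c$, going from a source cilium to a target cilium, an edge of color $c$ from the white vertex of the source to the black vertex of the target.) Explicitly, for every color $c$, $$K(\mathcal B_{4,\{c\}};z)=\frac{z\,T(z)^4}{1-z\,T(z)^2},\qquad K(\mathcal B_{4,\emptyset};z)=\frac{D(D-1)\,z^2\,T(z)^6}{\bigl(1-Dz\,T(z)^2\bigr)\bigl(1-z\,T(z)^2\bigr)},$$ and for $2\le|\mathcal C|\le D/2$, $$K(\mathcal B_{4,\mathcal C};N,z)=O\bigl(N^{-(D-2)}\bigr).$$ -/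

import Mathlib

namespace QuarticTensor

/-! ## Tensors, trace-invariants and the quartic model -/

/-- A `D`-uple of indices, each taking `N` values. -/
abbrev Idx (D N : ℕ) : Type := Fin D → Fin N

/-- A complex tensor with `D` indices of size `N`. -/
abbrev Tensor (D N : ℕ) : Type := Idx D N → ℂ

/-- The (unsymmetrized) trace-invariant operator of the bubble `B_{4,C}`: the edges whose color is not
in `C` join `a₁` to `b₁` and `a₂` to `b₂`, those whose color is in `C` join `a₁` to `b₂` and
`a₂` to `b₁`. -/
noncomputable def traceOp {D N : ℕ} (C : Finset (Fin D)) (a₁ a₂ b₁ b₂ : Idx D N) : ℂ :=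
  open Classical in
  if ∀ c : Fin D, (c ∉ C → a₁ c = b₁ c ∧ a₂ c = b₂ c) ∧ (c ∈ C → a₁ c = b₂ c ∧ a₂ c = b₁ c)
  then 1 else 0

/-- The trace-invariant operator of `B_{4,C}`, symmetrized over its indices. -/
noncomputable def symTraceOp {D N : ℕ} (C : Finset (Fin D)) (a₁ a₂ b₁ b₂ : Idx D N) : ℂ :=
  traceOp C a₁ a₂ b₁ b₂ + traceOp C a₂ a₁ b₁ b₂

/-- The invariant polynomial `Tr_{B_{4,C}}`. -/
noncomputable def traceB4 {D N : ℕ} (C : Finset (Fin D)) (T : Tensor D N) : ℂ :=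
  ∑ a₁ : Idx D N, ∑ a₂ : Idx D N, ∑ b₁ : Idx D N, ∑ b₂ : Idx D N,
    traceOp C a₁ a₂ b₁ b₂ *
      (T a₁ * T a₂ * (starRingEnd ℂ) (T b₁) * (starRingEnd ℂ) (T b₂))

/-- The expectation of `f` for the quadratic part of the action: the integral of `f` against
`∏ₐ (N^{D-1} / π) exp (- N^{D-1} |Tₐ|²) d(Re Tₐ) d(Im Tₐ)`. -/
noncomputable def gaussianExpectation (D N : ℕ) (f : Tensor D N → ℂ) : ℂ :=
  ∫ T : Tensor D N,
    f T * ((∏ a : Idx D N,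
      ((N : ℝ) ^ (D - 1) / Real.pi * Real.exp (-((N : ℝ) ^ (D - 1) * ‖T a‖ ^ 2)) : ℝ)) : ℂ)

/-- The coefficient of the coupling `z` in `- N^{D-1} S`, where
`S = Tr_{B_2} - ∑_c (z / 2) Tr_{B_{4,{c}}}` is the action of the quartic model. -/
noncomputable def interaction (D N : ℕ) (T : Tensor D N) : ℂ :=
  (N : ℂ) ^ (D - 1) * ∑ c : Fin D, (1 / 2) * traceB4 {c} T

/-- The perturbative expansion in `z` of `∫ f e^{-N^{D-1} S}`: the exponential of the interaction is
expanded, and the Gaussian integrals are taken term by term. -/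
noncomputable def unnormalizedMoment (D N : ℕ) (f : Tensor D N → ℂ) : PowerSeries ℂ :=
  PowerSeries.mk fun n =>
    ((n.factorial : ℂ))⁻¹ * gaussianExpectation D N fun T => f T * interaction D N T ^ n

/-- The perturbative expectation `⟨f⟩`. The divisor (the partition function) has constant
coefficient `1` when `N ≥ 1`. -/
noncomputable def expectation (D N : ℕ) (f : Tensor D N → ℂ) : PowerSeries ℂ :=
  unnormalizedMoment D N f * (unnormalizedMoment D N fun _ => 1)⁻¹

/-- The 2-point cumulant. -/
noncomputable def cumulant2 (D N : ℕ) (a b : Idx D N) : PowerSeries ℂ :=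
  expectation D N fun T => T a * (starRingEnd ℂ) (T b)

/-- The 4-point cumulant, i.e. the connected part of `⟨T T T̄ T̄⟩`. The moments in which the numbers of
`T` and of `T̄` differ vanish, so only the partitions into balanced parts are subtracted. -/
noncomputable def cumulant4 (D N : ℕ) (a₁ a₂ b₁ b₂ : Idx D N) : PowerSeries ℂ :=
  (expectation D N fun T => T a₁ * T a₂ * (starRingEnd ℂ) (T b₁) * (starRingEnd ℂ) (T b₂))
    - cumulant2 D N a₁ b₁ * cumulant2 D N a₂ b₂
    - cumulant2 D N a₁ b₂ * cumulant2 D N a₂ b₁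

/-- `w` is the family of coefficients `W(B_{4,C}; N, z)` of the 4-point cumulant on the symmetrized
trace-invariant operators. The subsets `C` and `Cᶜ` describe the same bubble, so they have the same
coefficient, and the factor `1 / 2` makes each bubble count once in the sum over all subsets. -/
def IsBubbleExpansion (D N : ℕ) (w : Finset (Fin D) → PowerSeries ℂ) : Prop :=
  (∀ C, w Cᶜ = w C) ∧
    ∀ a₁ a₂ b₁ b₂ : Idx D N,
      cumulant4 D N a₁ a₂ b₁ b₂ =
        ∑ C : Finset (Fin D), ((1 / 2 : ℂ) * symTraceOp C a₁ a₂ b₁ b₂) • w C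

/-- The number of connected components of the bubble `B_{4,C}`. -/
def numComponents {D : ℕ} (C : Finset (Fin D)) : ℕ :=
  if C = ∅ ∨ C = Finset.univ then 2 else 1

/-- `K(B_{4,C}; N, z) = W / N ^ (D - 2 (D - 1) p - ρ)`, with `p = 2` and `ρ` the number of connected
components. -/
noncomputable def rescaled {D : ℕ} (N : ℕ) (C : Finset (Fin D)) (W : PowerSeries ℂ) :
    PowerSeries ℂ :=
  ((N : ℂ) ^ ((D : ℤ) - 2 * ((D : ℤ) - 1) * 2 - (numComponents C : ℤ)))⁻¹ • W

/-- `F = O(N^{-k})` as `N → ∞` in the sense of perturbation theory: at every order in `z`. -/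
def PerturbativeBigO (F : ℕ → PowerSeries ℂ) (k : ℕ) : Prop :=
  ∀ n : ℕ, Asymptotics.IsBigO Filter.atTop
    (fun N : ℕ => PowerSeries.coeff n (F N)) (fun N : ℕ => ((N : ℝ) ^ k)⁻¹)

/-! ## Edge-colored maps with two cilia -/

/-- The half-edges of a map with `n` edges and two cilia: `inl (e, s)` is a side of the edge `e`,
and `inr i` is the `i`-th cilium. -/
abbrev Dart (n : ℕ) : Type := (Fin n × Bool) ⊕ Fin 2

/-- The involution exchanging the two sides of every edge, and fixing the cilia. -/
def edgeFlip (n : ℕ) : Equiv.Perm (Dart n) :=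
  Equiv.sumCongr (Equiv.prodCongr (Equiv.refl (Fin n)) Equiv.boolNot) (Equiv.refl (Fin 2))

/-- A combinatorial map with `n` edges colored by `Fin D` and two (distinguishable) cilia. The vertices
are the cycles of `rot`, which sends each half-edge to the next one around its vertex; a vertex
carries at most one cilium. -/
structure CiliatedMap (D n : ℕ) where
  rot : Equiv.Perm (Dart n)
  color : Fin n → Fin D
  cilia_apart : ¬ rot.SameCycle (Sum.inr 0) (Sum.inr 1)

namespace CiliatedMap

variable {D n : ℕ}

/-- The color of the edge to which a half-edge belongs (`none` for a cilium). -/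
def dartColor (M : CiliatedMap D n) : Dart n → Option (Fin D)
  | Sum.inl (e, _) => some (M.color e)
  | Sum.inr _ => none

/-- The map is connected: one goes from any half-edge to any other by turning around vertices and
crossing edges. -/
def Connected (M : CiliatedMap D n) : Prop :=
  ∀ x y : Dart n, ∃ g ∈ Subgroup.closure {M.rot, edgeFlip n}, g x = y

/-- The number of vertices of a map without vertices of degree zero. -/
noncomputable def numVertices (M : CiliatedMap D n) : ℕ :=
  Nat.card (Quotient (Equiv.Perm.SameCycle.setoid M.rot))

/-- The map is a (plane) tree. -/
def IsTree (M : CiliatedMap D n) : Prop :=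
  M.Connected ∧ M.numVertices = n + 1

/-- One step along a face of color `c`, i.e. a face of the submap that keeps only the edges of color
`c`: follow the corner to the next half-edge, and cross the edge if it has color `c`. -/
def faceStep (M : CiliatedMap D n) (c : Fin D) (d : Dart n) : Dart n :=
  if M.dartColor (M.rot d) = some c then edgeFlip n (M.rot d) else M.rot d

/-- The external face of color `c` that starts at the cilium `i` ends at the cilium `j`: `j` is the first
cilium met along it. -/
def ExternalFace (M : CiliatedMap D n) (c : Fin D) (i j : Fin 2) : Prop :=
  ∃ k : ℕ, 0 < k ∧ (M.faceStep c)^[k] (Sum.inr i) = Sum.inr j ∧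
    ∀ m : ℕ, 0 < m → m < k → ∀ l : Fin 2, (M.faceStep c)^[m] (Sum.inr i) ≠ Sum.inr l

/-- The boundary graph of `M` is `B_{4,C}`. The boundary graph has a white and a black vertex for
each cilium, and an edge of color `c` from the white vertex of the source to the black vertex of the
target of each external face of color `c`. So it is the bubble labeled by the set of colors whose
external faces go from one cilium to the other, and this bubble is also labeled by the complement. -/
def HasBoundary (M : CiliatedMap D n) (C : Finset (Fin D)) : Prop :=
  (∀ c, c ∈ C ↔ M.ExternalFace c 0 1) ∨ (∀ c, c ∈ Cᶜ ↔ M.ExternalFace c 0 1)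

/-- Two maps are isomorphic if they differ by a relabeling of the edges and of their sides. -/
def Iso (M M' : CiliatedMap D n) : Prop :=
  ∃ g : Equiv.Perm (Dart n), (∀ i : Fin 2, g (Sum.inr i) = Sum.inr i) ∧
    (∀ d, g (edgeFlip n d) = edgeFlip n (g d)) ∧ (∀ d, g (M.rot d) = M'.rot (g d)) ∧
    ∀ d, M'.dartColor (g d) = M.dartColor d

/-- Isomorphism of ciliated maps; its classes are the maps with unlabeled vertices and edges. -/
def isoSetoid (D n : ℕ) : Setoid (CiliatedMap D n) where
  r := Iso
  iseqv :=
    { refl := fun M => ⟨1, fun _ => rfl, fun _ => rfl, fun _ => rfl, fun _ => rfl⟩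
      symm := by
        rintro M M' ⟨g, h1, h2, h3, h4⟩
        refine ⟨g.symm, fun i => ?_, fun d => ?_, fun d => ?_, fun d => ?_⟩
        · rw [Equiv.symm_apply_eq, h1]
        · rw [Equiv.symm_apply_eq, h2, Equiv.apply_symm_apply]
        · rw [Equiv.symm_apply_eq, h3, Equiv.apply_symm_apply]
        · rw [← h4, Equiv.apply_symm_apply]
      trans := by
        rintro M M' M'' ⟨g, h1, h2, h3, h4⟩ ⟨g', h1', h2', h3', h4'⟩
        refine ⟨g.trans g', fun i => ?_, fun d => ?_, fun d => ?_, fun d => ?_⟩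
        · simp [h1, h1']
        · simp [h2, h2']
        · simp [h3, h3']
        · simp [h4, h4'] }

/-- The number of plane trees with `n` colored edges, two cilia and boundary graph `B_{4,C}`, up to
isomorphism. -/
noncomputable def treeCount (C : Finset (Fin D)) (n : ℕ) : ℕ :=
  ((fun M : CiliatedMap D n => (Quotient.mk (isoSetoid D n) M)) ''
    {M | M.IsTree ∧ M.HasBoundary C}).ncard

end CiliatedMap

/-- The sum over the colored plane trees with two cilia and boundary graph `B_{4,C}`, with weight `z`
per edge. -/
noncomputable def treeSeries {D : ℕ} (C : Finset (Fin D)) : PowerSeries ℂ :=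
  PowerSeries.mk fun n => (CiliatedMap.treeCount C n : ℂ)

/-- The series `T(z) = (1 - √(1 - 4 D z)) / (2 D z)`, which counts rooted plane trees with weight `D z`
per edge. -/
noncomputable def melonicT (D : ℕ) : PowerSeries ℂ :=
  PowerSeries.mk fun n => ((catalan n * D ^ n : ℕ) : ℂ)

/-- `T(z)` is a power series solution of `1 - T + D z T ^ 2 = 0`. -/
theorem melonicT_eq (D : ℕ) : 1 - melonicT D + (D : PowerSeries ℂ) * PowerSeries.X * melonicT D ^ 2 = 0 := by
  have h : melonicT D = PowerSeries.rescale (D : ℂ)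
      (PowerSeries.map (Nat.castRingHom ℂ) PowerSeries.catalanSeries) := by
    ext n
    simp [melonicT, mul_comm]
  have h0 := congrArg (PowerSeries.map (Nat.castRingHom ℂ))
    PowerSeries.catalanSeries_sq_mul_X_add_one
  have h1 := congrArg (PowerSeries.rescale (D : ℂ)) h0
  simp only [map_add, map_mul, map_pow, map_one, PowerSeries.map_X, PowerSeries.rescale_X] at h1
  rw [← h] at h1
  have h2 : (PowerSeries.C (D : ℂ)) = (D : PowerSeries ℂ) := by simp
  rw [h2] at h1
  linear_combination h1

end QuarticTensor

open QuarticTensor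

namespace QuarticTensor

open Equiv Equiv.Perm

/-! ## Counting the cycles of a permutation -/

/-! Wick's theorem turns each order in `z` into a finite sum over combinatorial maps. A quartic
interaction of color `c` is an edge of color `c`; each of its two sides carries one tensor and one
conjugate tensor. The external pairs are cilia, and a Wick pairing is a permutation `rot` of the
half-edges whose cycles are the vertices. With the pairing fixed, the index of color `c` is constant
along the cycles of `face rot col c`, which turns around vertices and crosses only the edges of
color `c`. Hence a map contributes `N` to the number of its internal faces, times the Kronecker
deltas labeled by `boundary`, the set of colors whose external face joins the two cilia
(`numIndices_eq`).

Maps factor into the component of a cilium and the rest (`egf_component`), so dividing by the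
partition function and subtracting the products of 2-point functions leaves connected maps. Cilia on
a common vertex need no separate treatment: composing `rot` with the transposition of the cilia
separates them and exchanges the two conjugate indices (`egf_two_cilia_apart`). The cumulant thus
becomes a sum over connected maps with cilia on different vertices (`cumulant4_eq`). Sorting them by
boundary set gives the bubble expansion. It is unique because for `N ≥ 2` there are external indices
at which a single unsymmetrized operator survives.

The power of `N` comes from inserting the edges one at a time. Each insertion multiplies the face
permutation of one color by a transposition, hence changes the number of faces of that color by one,
and it must lower this number if the edge joins two components. This gives `sum_cyc_flip_le`, and
applying it after merging the two ciliated vertices gives `sum_cyc_face_add_boundary_le`.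
Consequently trees have exponent exactly zero (`Tree.scaling_eq_zero`), and every other connected
map has exponent at most `-(D - 2)` (`scaling_le`). In a tree at most one color joins the cilia, so
bubbles with `2 ≤ |C| ≤ D / 2` receive no tree.

The perturbative weight of a tree is `1 / (2 ^ n n!)` per labeled tree. Relabelings of edges and
sides act freely on connected maps with a cilium, so this counts unlabeled trees
(`treeSeries_eq_labeledTreeSeries`). To count them, let `L_J` be the series of trees whose two cilia
are linked by edges with colors in `J`. Removing the edge that follows the first cilium gives `L_J =
T + (D + |J|) z T L_J`, that is `L_J (1 - |J| z T ^ 2) = T ^ 2`. The closed forms follow from `J =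
∅` (cilia on one vertex), `J = {c}` and `J` the set of all colors. -/

/-- Identifying two classes of an equivalence relation lowers the number of classes by one. -/
theorem card_quotient_merge {α : Type*} [Finite α] (r r' : Setoid α) (a b : α)
    (hle : ∀ x y, r x y → r' x y) (hab : r' a b)
    (hmin : ∀ f : α → Prop, (∀ x y, r x y → (f x ↔ f y)) → (f a ↔ f b) →
      ∀ x y, r' x y → (f x ↔ f y)) (h : ¬ r a b) :
    Nat.card (Quotient r) = Nat.card (Quotient r') + 1 := by
  classical
  -- Minimality of `r'` is applied to the predicate on the right, with `x` fixed.
  have key : ∀ x y, r' x y → r x y ∨ ((r x a ∨ r x b) ∧ (r y a ∨ r y b)) := by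
    intro x y hxy
    refine (hmin (fun z => r x z ∨ ((r x a ∨ r x b) ∧ (r z a ∨ r z b))) ?_ ?_ x y hxy).1
      (Or.inl (r.refl x))
    · intro z w hzw
      have h1 : r x z ↔ r x w := ⟨fun h => r.trans h hzw, fun h => r.trans h (r.symm hzw)⟩
      have h2 : ∀ c, r z c ↔ r w c :=
        fun c => ⟨fun h => r.trans (r.symm hzw) h, fun h => r.trans hzw h⟩
      simp only [h1, h2]
    · have ha := r.refl a
      have hb := r.refl b
      simp only [ha, hb, true_or, or_true, and_true]
      tauto
  -- Once the class of `b` is discarded, the projection to the coarser quotient is a bijection.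
  let f : {q : Quotient r // q ≠ Quotient.mk r b} → Quotient r' :=
    fun q => Quotient.map' id (fun x y hxy => hle x y hxy) q.1
  have hf : Function.Bijective f := by
    constructor
    · rintro ⟨q, hq⟩ ⟨q', hq'⟩
      induction q using Quotient.inductionOn with | h x => ?_
      induction q' using Quotient.inductionOn with | h y => ?_
      intro hxy
      have hxy' : r' x y := Quotient.exact hxy
      have hx : ¬ r x b := fun h => hq (Quotient.sound h)
      have hy : ¬ r y b := fun h => hq' (Quotient.sound h)
      apply Subtype.ext
      apply Quotient.sound
      rcases key x y hxy' with h | ⟨h1, h2⟩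
      · exact h
      · have h1 := h1.resolve_right hx
        have h2 := h2.resolve_right hy
        exact r.trans h1 (r.symm h2)
    · intro q
      induction q using Quotient.inductionOn with | h x => ?_
      by_cases hx : r x b
      · exact ⟨⟨Quotient.mk r a, fun h' => h (Quotient.exact h')⟩,
          Quotient.sound (r'.trans hab (r'.symm (hle _ _ hx)))⟩
      · exact ⟨⟨Quotient.mk r x, fun h' => hx (Quotient.exact h')⟩, rfl⟩
  rw [← Nat.card_congr (Equiv.optionSubtypeNe (Quotient.mk r b)), Finite.card_option,
    Nat.card_congr (Equiv.ofBijective f hf)]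

/-- The number of cycles of a permutation, fixed points included. -/
noncomputable def cyc {α : Type*} (σ : Perm α) : ℕ := Nat.card (Quotient (SameCycle.setoid σ))

/-- A predicate stable under `σ` cannot change along a cycle. In this form cycles can be compared
with `Linked`, which is defined by invariant predicates. -/
theorem SameCycle.iff_of_invariant {α : Type*} {σ : Perm α} {x y : α} (h : SameCycle σ x y)
    {f : α → Prop} (hf : ∀ z, f (σ z) ↔ f z) : f x ↔ f y := by
  obtain ⟨n, rfl⟩ := h
  have hinv : ∀ z, f (σ⁻¹ z) ↔ f z := fun z => by rw [← hf (σ⁻¹ z)]; simp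
  induction n using Int.induction_on with
  | zero => simp
  | succ n ih => exact ih.trans (by rw [add_comm, zpow_add, zpow_one, Perm.mul_apply, hf])
  | pred n ih =>
    exact ih.trans (by rw [sub_eq_neg_add, zpow_add, zpow_neg_one, Perm.mul_apply, hinv])

theorem cyc_conj {α β : Type*} (e : α ≃ β) (σ : Perm α) : cyc (e.permCongr σ) = cyc σ := by
  have hpow : ∀ (n : ℤ) x, ((e.permCongr σ) ^ n) (e x) = e ((σ ^ n) x) := by
    intro n x
    have : (e.permCongr σ) ^ n = e.permCongr (σ ^ n) := (map_zpow e.permCongrHom σ n).symm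
    rw [this]
    simp [Equiv.permCongr_apply]
  refine Nat.card_congr (Quotient.congr e fun x y => ?_).symm
  change SameCycle σ x y ↔ SameCycle (e.permCongr σ) (e x) (e y)
  simp only [SameCycle, hpow, e.apply_eq_iff_eq]

theorem cyc_mul_comm {α : Type*} (σ τ : Perm α) : cyc (σ * τ) = cyc (τ * σ) := by
  have h : τ * σ = Equiv.permCongr τ (σ * τ) := by
    ext x
    simp
  rw [h, cyc_conj]

/-! ### Effect of a transposition on the cycles of a permutation. -/

section Swap

variable {α : Type*} [DecidableEq α] {σ : Perm α} {a b : α}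

/-- The transposition sends `b` to `a` at the first step, and then has no effect until the `σ`-orbit
of `a` meets `a` or `b`. -/
theorem mul_swap_pow_apply {k : ℕ}
    (h : ∀ j, 0 < j → j < k → (σ ^ j) a ≠ a ∧ (σ ^ j) a ≠ b) :
    ∀ j, 0 < j → j ≤ k → ((σ * swap a b) ^ j) b = (σ ^ j) a := by
  intro j hj hjk
  induction j with
  | zero => omega
  | succ j ih =>
    rcases Nat.eq_zero_or_pos j with rfl | hj'
    · simp
    · obtain ⟨h1, h2⟩ := h j hj' (by omega)
      rw [pow_succ', Perm.mul_apply, ih hj' (by omega), Perm.mul_apply, swap_apply_of_ne_of_ne h1 h2,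
        pow_succ' σ, Perm.mul_apply]

/-- Starting from `b`, the new permutation follows the old cycle of `a`, which avoids `b`, until its
first return to `a`. -/
theorem sameCycle_mul_swap [Finite α] (h : ¬ SameCycle σ a b) : SameCycle (σ * swap a b) a b := by
  classical
  have hex : ∃ m, 0 < m ∧ (σ ^ m) a = a :=
    ⟨orderOf σ, orderOf_pos σ, by simp [pow_orderOf_eq_one]⟩
  obtain ⟨hm, hma⟩ := Nat.find_spec hex
  have := mul_swap_pow_apply (σ := σ) (a := a) (b := b)
    (fun j hj hjm => ⟨fun h' => Nat.find_min hex hjm ⟨hj, h'⟩, fun h' => h ⟨j, by simpa using h'⟩⟩)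
    _ hm le_rfl
  exact SameCycle.symm ⟨(Nat.find hex : ℕ), by rw [zpow_natCast, this, hma]⟩

/-- The arc of the old cycle that leads from `a` to `b` closes up into a cycle through `b` that
avoids `a`. -/
theorem not_sameCycle_mul_swap [Finite α] (hab : a ≠ b) (h : SameCycle σ a b) :
    ¬ SameCycle (σ * swap a b) a b := by
  classical
  have hex : ∃ k, 0 < k ∧ (σ ^ k) a = b := by
    obtain ⟨i, hi, -, h⟩ := h.exists_pow_eq''
    exact ⟨i, hi, h⟩
  obtain ⟨hk, hkb⟩ := Nat.find_spec hex
  have hne : ∀ j, 0 < j → j < Nat.find hex → (σ ^ j) a ≠ a ∧ (σ ^ j) a ≠ b := by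
    refine fun j hj hjm => ⟨fun h' => ?_, fun h' => Nat.find_min hex hjm ⟨hj, h'⟩⟩
    -- A return to `a` on the way would give a shorter path from `a` to `b`.
    refine Nat.find_min hex (m := Nat.find hex - j) (by omega) ⟨by omega, ?_⟩
    have : (σ ^ (Nat.find hex - j)) ((σ ^ j) a) = b := by
      rw [← Perm.mul_apply, ← pow_add, Nat.sub_add_cancel hjm.le, hkb]
    rwa [h'] at this
  have hp := mul_swap_pow_apply (σ := σ) (a := a) (b := b) hne
  intro hs
  obtain ⟨i, hi⟩ := hs.symm.exists_nat_pow_eq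
  have hper : ((σ * swap a b) ^ Nat.find hex) b = b := by rw [hp _ hk le_rfl, hkb]
  have hmod : ((σ * swap a b) ^ (i % Nat.find hex)) b = a := by
    rw [← Nat.mod_add_div i (Nat.find hex), pow_add, Perm.mul_apply, pow_mul] at hi
    rwa [Perm.pow_apply_eq_self_of_apply_eq_self hper] at hi
  rcases Nat.eq_zero_or_pos (i % Nat.find hex) with h0 | h0
  · rw [h0] at hmod
    exact hab (by simpa using hmod.symm)
  · rw [hp _ h0 (Nat.mod_lt _ hk).le] at hmod
    exact (hne _ h0 (Nat.mod_lt _ hk)).1 hmod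

theorem SameCycle.mul_swap [Finite α] (h : ¬ SameCycle σ a b) {x y : α} (hxy : SameCycle σ x y) :
    SameCycle (σ * swap a b) x y := by
  have hs := sameCycle_mul_swap h
  refine (SameCycle.iff_of_invariant hxy (f := fun z => SameCycle (σ * swap a b) x z) ?_).1
    (SameCycle.refl _ _)
  intro z
  have hz : SameCycle (σ * swap a b) z (σ z) := by
    have h1 : SameCycle (σ * swap a b) (swap a b z) (σ z) := ⟨1, by simp⟩
    rcases eq_or_ne z a with rfl | hza
    · rw [swap_apply_left] at h1
      exact hs.trans h1
    · rcases eq_or_ne z b with rfl | hzb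
      · rw [swap_apply_right] at h1
        exact hs.symm.trans h1
      · rwa [swap_apply_of_ne_of_ne hza hzb] at h1
  exact ⟨fun h => h.trans hz.symm, fun h => h.trans hz⟩

/-- With `cyc_mul_swap_split`, this determines how one transposition changes the number of cycles.
All counting of faces rests on these two facts. -/
theorem cyc_mul_swap_merge [Finite α] (h : ¬ SameCycle σ a b) :
    cyc (σ * swap a b) + 1 = cyc σ := by
  refine (card_quotient_merge (SameCycle.setoid σ) (SameCycle.setoid (σ * swap a b)) a b
    (fun x y hxy => SameCycle.mul_swap h hxy) (sameCycle_mul_swap h) ?_ h).symm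
  intro f hf hab x y hxy
  refine SameCycle.iff_of_invariant hxy fun z => ?_
  have h1 : ∀ w, f (σ w) ↔ f w := fun w => (hf w (σ w) ⟨1, by simp⟩).symm
  rw [Perm.mul_apply, h1]
  rcases eq_or_ne z a with rfl | hza
  · rw [swap_apply_left, hab]
  · rcases eq_or_ne z b with rfl | hzb
    · rw [swap_apply_right, hab]
    · rw [swap_apply_of_ne_of_ne hza hzb]

/-- Multiplying by the transposition once more restores `σ`, so a splitting is a merging read
backwards. -/
theorem cyc_mul_swap_split [Finite α] (hab : a ≠ b) (h : SameCycle σ a b) :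
    cyc (σ * swap a b) = cyc σ + 1 := by
  have := cyc_mul_swap_merge (not_sameCycle_mul_swap hab h)
  rw [mul_assoc, swap_mul_self, mul_one] at this
  exact this.symm

theorem sameCycle_swap_mul [Finite α] (h : ¬ SameCycle σ a b) : SameCycle (swap a b * σ) a b := by
  rw [← sameCycle_inv, mul_inv_rev, swap_inv]
  exact sameCycle_mul_swap (by rwa [sameCycle_inv])

theorem not_sameCycle_swap_mul [Finite α] (hab : a ≠ b) (h : SameCycle σ a b) :
    ¬ SameCycle (swap a b * σ) a b := by
  rw [← sameCycle_inv, mul_inv_rev, swap_inv]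
  exact not_sameCycle_mul_swap hab (by rwa [sameCycle_inv])

theorem SameCycle.swap_mul [Finite α] (h : ¬ SameCycle σ a b) {x y : α} (hxy : SameCycle σ x y) :
    SameCycle (swap a b * σ) x y := by
  rw [← sameCycle_inv, mul_inv_rev, swap_inv]
  exact SameCycle.mul_swap (by rwa [sameCycle_inv]) (by rwa [sameCycle_inv])

theorem cyc_swap_mul_merge [Finite α] (h : ¬ SameCycle σ a b) : cyc (swap a b * σ) + 1 = cyc σ := by
  rw [cyc_mul_comm, cyc_mul_swap_merge h]

theorem cyc_swap_mul_split [Finite α] (hab : a ≠ b) (h : SameCycle σ a b) :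
    cyc (swap a b * σ) = cyc σ + 1 := by
  rw [cyc_mul_comm, cyc_mul_swap_split hab h]

end Swap

theorem cyc_sumCongr {α β : Type*} [Finite α] [Finite β] (σ : Perm α) (τ : Perm β) :
    cyc (Perm.sumCongr σ τ) = cyc σ + cyc τ := by
  have hpow : ∀ n : ℤ, (Perm.sumCongr σ τ) ^ n = Perm.sumCongr (σ ^ n) (τ ^ n) := fun n =>
    (map_zpow (Perm.sumCongrHom α β) (σ, τ) n).symm
  rw [cyc, cyc, cyc, ← Nat.card_sum]
  refine Nat.card_congr
    { toFun := fun q => Quotient.liftOn' q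
        (Sum.map (Quotient.mk (SameCycle.setoid σ)) (Quotient.mk (SameCycle.setoid τ))) ?_
      invFun := Sum.elim
        (fun q => Quotient.map' Sum.inl (fun x y hxy => ?_) q)
        (fun q => Quotient.map' Sum.inr (fun x y hxy => ?_) q)
      left_inv := ?_
      right_inv := ?_ }
  · rintro (x | x) (y | y) ⟨n, hn⟩ <;> rw [hpow] at hn
    · exact congrArg Sum.inl (Quotient.sound ⟨n, by simpa using hn⟩)
    · simp at hn
    · simp at hn
    · exact congrArg Sum.inr (Quotient.sound ⟨n, by simpa using hn⟩)
  · obtain ⟨n, hn⟩ := hxy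
    exact ⟨n, by rw [hpow]; simpa using hn⟩
  · obtain ⟨n, hn⟩ := hxy
    exact ⟨n, by rw [hpow]; simpa using hn⟩
  · intro q
    induction q using Quotient.inductionOn with | h x => ?_
    cases x <;> rfl
  · rintro (q | q) <;> induction q using Quotient.inductionOn with | h x => rfl

theorem cyc_one {α : Type*} : cyc (1 : Perm α) = Nat.card α := by
  refine Nat.card_congr (Equiv.ofBijective (Quotient.mk _) ⟨fun x y h => ?_, Quotient.mk_surjective⟩).symm
  exact sameCycle_one.1 (Quotient.exact h)

end QuarticTensor

namespace QuarticTensor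

open Equiv Equiv.Perm

/-! ## Power counting -/

/-- The half-edges of a map with edges `E` and cilia `X`. -/
abbrev HalfEdge (E X : Type) : Type := (E × Bool) ⊕ X

/-! ### Crossing a set of edges, and the classes of half-edges it links. -/

section Flip

variable {E X : Type}

open Classical in
/-- The involution exchanging the two sides of the edges satisfying `p`. -/
noncomputable def flipOn (p : E → Prop) : Perm (HalfEdge E X) :=
  Function.Involutive.toPerm
    (Sum.map (fun x : E × Bool => (x.1, if p x.1 then !x.2 else x.2)) id) (by
      rintro (⟨e, s⟩ | i)
      · by_cases h : p e <;> simp [h]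
      · rfl)

@[simp] theorem flipOn_inr (p : E → Prop) (i : X) :
    flipOn p (Sum.inr i : HalfEdge E X) = Sum.inr i := rfl

theorem flipOn_of_pos {p : E → Prop} {e : E} (h : p e) (s : Bool) :
    flipOn p (Sum.inl (e, s) : HalfEdge E X) = Sum.inl (e, !s) := by
  simp [flipOn, Function.Involutive.toPerm, h]

theorem flipOn_of_neg {p : E → Prop} {e : E} (h : ¬ p e) (s : Bool) :
    flipOn p (Sum.inl (e, s) : HalfEdge E X) = Sum.inl (e, s) := by
  simp [flipOn, Function.Involutive.toPerm, h]

theorem flipOn_congr {p q : E → Prop} (h : ∀ e, p e ↔ q e) :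
    (flipOn p : Perm (HalfEdge E X)) = flipOn q := by
  rw [funext fun e => propext (h e)]

theorem flipOn_false {p : E → Prop} (h : ∀ e, ¬ p e) : (flipOn p : Perm (HalfEdge E X)) = 1 := by
  ext (⟨e, s⟩ | i)
  · rw [flipOn_of_neg (h e)]; rfl
  · rfl

/-- Allowing one more edge to be crossed amounts to one transposition, which is what permits
induction on the edges. -/
theorem flipOn_insert [DecidableEq E] [DecidableEq X] {p : E → Prop} {e : E} (he : ¬ p e) :
    (flipOn (fun x => x = e ∨ p x) : Perm (HalfEdge E X)) =
      swap (Sum.inl (e, true)) (Sum.inl (e, false)) * flipOn p := by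
  ext1 x
  rw [Perm.mul_apply]
  rcases x with ⟨x, s⟩ | i
  · rcases eq_or_ne x e with rfl | hx
    · rw [flipOn_of_pos (p := fun y => y = x ∨ p y) (Or.inl rfl), flipOn_of_neg he]
      cases s <;> simp
    · by_cases hp : p x
      · rw [flipOn_of_pos (p := fun y => y = e ∨ p y) (Or.inr hp), flipOn_of_pos hp, swap_apply_of_ne_of_ne] <;> simp [hx]
      · rw [flipOn_of_neg (p := fun y => y = e ∨ p y) (by tauto), flipOn_of_neg hp, swap_apply_of_ne_of_ne] <;> simp [hx]
  · rw [flipOn_inr, flipOn_inr, swap_apply_of_ne_of_ne] <;> simp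

/-- The half-edges linked by turning around the vertices and crossing the edges satisfying `p`. -/
def Linked (rot : Perm (HalfEdge E X)) (p : E → Prop) : Setoid (HalfEdge E X) where
  r x y := ∀ f : HalfEdge E X → Prop, (∀ h, f (rot h) ↔ f h) →
    (∀ e, p e → (f (Sum.inl (e, true)) ↔ f (Sum.inl (e, false)))) → (f x ↔ f y)
  iseqv :=
    { refl := fun _ _ _ _ => Iff.rfl
      symm := fun h f h1 h2 => (h f h1 h2).symm
      trans := fun h h' f h1 h2 => (h f h1 h2).trans (h' f h1 h2) }

variable {rot : Perm (HalfEdge E X)} {p q : E → Prop}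

theorem Linked.mono (h : ∀ e, p e → q e) {x y : HalfEdge E X} (hxy : Linked rot p x y) :
    Linked rot q x y := fun f h1 h2 => hxy f h1 fun e he => h2 e (h e he)

theorem Linked.congr (h : ∀ e, p e ↔ q e) : Linked rot p = Linked rot q := by
  rw [funext fun e => propext (h e)]

theorem linked_rot (rot : Perm (HalfEdge E X)) (p : E → Prop) (x : HalfEdge E X) :
    Linked rot p x (rot x) := fun _ h1 _ => (h1 x).symm

theorem linked_edge (rot : Perm (HalfEdge E X)) {p : E → Prop} {e : E} (h : p e) (s t : Bool) :
    Linked rot p (Sum.inl (e, s)) (Sum.inl (e, t)) := by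
  intro f _ h2
  have := h2 e h
  cases s <;> cases t <;> tauto

theorem linked_flipOn (rot : Perm (HalfEdge E X)) (p : E → Prop) (x : HalfEdge E X) :
    Linked rot p x (flipOn p x) := by
  rcases x with ⟨e, s⟩ | i
  · by_cases he : p e
    · rw [flipOn_of_pos he]
      exact linked_edge rot he _ _
    · rw [flipOn_of_neg he]
  · rfl

theorem Linked.iff_rot {x y : HalfEdge E X} : Linked rot p x (rot y) ↔ Linked rot p x y :=
  ⟨fun h => (Linked rot p).trans h ((Linked rot p).symm (linked_rot rot p y)),
    fun h => (Linked rot p).trans h (linked_rot rot p y)⟩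

theorem Linked.iff_edge {x : HalfEdge E X} {e : E} (he : p e) (s t : Bool) :
    Linked rot p x (Sum.inl (e, s)) ↔ Linked rot p x (Sum.inl (e, t)) :=
  ⟨fun h => (Linked rot p).trans h (linked_edge rot he s t),
    fun h => (Linked rot p).trans h (linked_edge rot he t s)⟩

theorem linked_of_sameCycle {x y : HalfEdge E X} (h : SameCycle rot x y) : Linked rot p x y :=
  fun _ h1 _ => SameCycle.iff_of_invariant h h1

/-- A face only turns around vertices and crosses allowed edges, so it stays inside one class. The
converse fails in general; for trees and one color it is `Tree.sameCycle_face_iff`. -/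
theorem linked_of_sameCycle_flip {x y : HalfEdge E X} (h : SameCycle (flipOn p * rot) x y) :
    Linked rot p x y := by
  refine (SameCycle.iff_of_invariant h (f := fun z => Linked rot p x z) fun z => ?_).1
    ((Linked rot p).refl x)
  have hz : Linked rot p z ((flipOn p * rot : Perm _) z) :=
    (Linked rot p).trans (linked_rot rot p z) (linked_flipOn rot p (rot z))
  exact ⟨fun h => (Linked rot p).trans h ((Linked rot p).symm hz),
    fun h => (Linked rot p).trans h hz⟩

theorem linked_false (h : ∀ e, ¬ p e) {x y : HalfEdge E X} :
    Linked rot p x y ↔ SameCycle rot x y := by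
  refine ⟨fun hxy => ?_, linked_of_sameCycle⟩
  refine (hxy (fun z => SameCycle rot x z) (fun z => ?_) fun e he => absurd he (h e)).1
    (SameCycle.refl _ _)
  exact sameCycle_apply_right

/-- The number of classes of linked half-edges. -/
noncomputable def numLinked (rot : Perm (HalfEdge E X)) (p : E → Prop) : ℕ :=
  Nat.card (Quotient (Linked rot p))

theorem numLinked_false (h : ∀ e, ¬ p e) : numLinked rot p = cyc rot := by
  have : Linked rot p = SameCycle.setoid rot := Setoid.ext fun x y => linked_false h
  rw [numLinked, this, cyc]

/-- This is the minimality hypothesis of `card_quotient_merge` when one edge is added. -/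
theorem linked_insert_min (e : E) (f : HalfEdge E X → Prop)
    (hf : ∀ x y, Linked rot p x y → (f x ↔ f y))
    (he : f (Sum.inl (e, true)) ↔ f (Sum.inl (e, false))) (x y : HalfEdge E X)
    (hxy : Linked rot (fun x => x = e ∨ p x) x y) : f x ↔ f y := by
  refine hxy f (fun h => (hf _ _ (linked_rot rot p h)).symm) ?_
  rintro e' (rfl | he')
  · exact he
  · exact hf _ _ (linked_edge rot he' _ _)

theorem numLinked_insert_of_linked {e : E}
    (h : Linked rot p (Sum.inl (e, true)) (Sum.inl (e, false))) :
    numLinked rot (fun x => x = e ∨ p x) = numLinked rot p := by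
  have : Linked rot (fun x => x = e ∨ p x) = Linked rot p := by
    refine Setoid.ext fun x y => ⟨fun hxy => ?_, Linked.mono fun _ => Or.inr⟩
    refine (linked_insert_min e (fun z => Linked rot p x z) ?_ ?_ x y hxy).1 ((Linked rot p).refl x)
    · exact fun z w hzw => ⟨fun h => (Linked rot p).trans h hzw,
        fun h => (Linked rot p).trans h ((Linked rot p).symm hzw)⟩
    · exact ⟨fun h' => (Linked rot p).trans h' h,
        fun h' => (Linked rot p).trans h' ((Linked rot p).symm h)⟩
  rw [numLinked, this, numLinked]

theorem numLinked_insert_of_not_linked [Finite E] [Finite X] {e : E}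
    (h : ¬ Linked rot p (Sum.inl (e, true)) (Sum.inl (e, false))) :
    numLinked rot p = numLinked rot (fun x => x = e ∨ p x) + 1 :=
  card_quotient_merge _ _ _ _ (fun _ _ => Linked.mono fun _ => Or.inr)
    (linked_edge rot (Or.inl rfl) _ _) (linked_insert_min e) h

/-- All half-edges are linked. -/
def Conn (rot : Perm (HalfEdge E X)) : Prop := ∀ x y, Linked rot (fun _ => True) x y

theorem Conn.numLinked_le (h : Conn rot) : numLinked rot (fun _ => True) ≤ 1 := by
  have : Subsingleton (Quotient (Linked rot fun _ => True)) := by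
    constructor
    intro a b
    induction a using Quotient.inductionOn with | h x => ?_
    induction b using Quotient.inductionOn with | h y => ?_
    exact Quotient.sound (h x y)
  exact Finite.card_le_one_iff_subsingleton.2 this

end Flip

/-! ### Inequalities between vertices, faces and components, by induction on the edges. -/

section PowerCounting

variable {E X : Type} [Finite E] [Finite X] {D : ℕ} (rot : Perm (HalfEdge E X)) (col : E → Fin D)

/-- Without edges the classes are the vertices, and each edge lowers their number by at most one. -/
theorem cyc_le_card_add_numLinked (S : Finset E) :
    cyc rot ≤ S.card + numLinked rot (fun e => e ∈ S) := by
  classical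
  induction S using Finset.induction_on with
  | empty => simp [numLinked_false]
  | insert e S he ih =>
    simp only [Finset.mem_insert]
    rw [Finset.card_insert_of_notMem he]
    by_cases h : Linked rot (· ∈ S) (Sum.inl (e, true)) (Sum.inl (e, false))
    · rw [numLinked_insert_of_linked h]; omega
    · rw [numLinked_insert_of_not_linked h] at ih; omega

theorem cyc_flip_insert_le [DecidableEq E] [DecidableEq X] {p : E → Prop} {e : E} (he : ¬ p e) :
    cyc (flipOn (fun x => x = e ∨ p x) * rot) ≤ cyc (flipOn p * rot) + 1 ∧
      cyc (flipOn p * rot) ≤ cyc (flipOn (fun x => x = e ∨ p x) * rot) + 1 := by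
  rw [flipOn_insert he, mul_assoc]
  by_cases h : SameCycle (flipOn p * rot) (Sum.inl (e, true)) (Sum.inl (e, false))
  · have := cyc_swap_mul_split (by simp) h
    omega
  · have := cyc_swap_mul_merge h
    omega

theorem cyc_le_cyc_flip_add_card (S : Finset E) :
    cyc rot ≤ cyc (flipOn (fun e => e ∈ S) * rot) + S.card := by
  classical
  induction S using Finset.induction_on with
  | empty => simp [flipOn_false]
  | insert e S he ih =>
    simp only [Finset.mem_insert]
    rw [Finset.card_insert_of_notMem he]
    have := (cyc_flip_insert_le rot (p := (· ∈ S)) he).2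
    omega

/-- Equality holds without edges, and a new edge affects the faces of its own color only. If its
sides are already linked, both sides of the inequality allow for one more face. If not, its sides
lie on different faces, which merge; the loss of one face balances the gain of one edge and the loss
of one component, counted twice. -/
theorem sum_cyc_flip_le (S : Finset E) :
    ∑ c : Fin D, cyc (flipOn (fun e => e ∈ S ∧ col e = c) * rot) + 2 * cyc rot ≤
      D * cyc rot + S.card + 2 * numLinked rot (fun e => e ∈ S) := by
  classical
  induction S using Finset.induction_on with
  | empty => simp [flipOn_false, numLinked_false]
  | insert e S he ih =>
    simp only [Finset.mem_insert]
    rw [Finset.card_insert_of_notMem he]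
    have h1 : ∀ c, c ≠ col e →
        cyc (flipOn (fun x => (x = e ∨ x ∈ S) ∧ col x = c) * rot) =
          cyc (flipOn (fun x => x ∈ S ∧ col x = c) * rot) := by
      intro c hc
      rw [flipOn_congr (q := fun x => x ∈ S ∧ col x = c)]
      intro x
      refine ⟨?_, fun h => ⟨Or.inr h.1, h.2⟩⟩
      rintro ⟨rfl | h, h'⟩
      · exact absurd h'.symm hc
      · exact ⟨h, h'⟩
    have h2 : (flipOn (fun x => (x = e ∨ x ∈ S) ∧ col x = col e) : Perm (HalfEdge E X)) =
        flipOn (fun x => x = e ∨ (x ∈ S ∧ col x = col e)) := by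
      refine flipOn_congr fun x => ?_
      constructor
      · rintro ⟨rfl | h, h'⟩
        · exact Or.inl rfl
        · exact Or.inr ⟨h, h'⟩
      · rintro (rfl | h)
        · exact ⟨Or.inl rfl, rfl⟩
        · exact ⟨Or.inr h.1, h.2⟩
    have he' : ¬ (e ∈ S ∧ col e = col e) := fun h => he h.1
    rw [← Finset.add_sum_erase _ _ (Finset.mem_univ (col e))] at ih ⊢
    rw [Finset.sum_congr rfl fun c hc => h1 c (Finset.ne_of_mem_erase hc), h2]
    by_cases h : Linked rot (· ∈ S) (Sum.inl (e, true)) (Sum.inl (e, false))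
    · have := (cyc_flip_insert_le rot (p := fun x => x ∈ S ∧ col x = col e) he').1
      rw [numLinked_insert_of_linked h]
      omega
    · have h3 : ¬ SameCycle (flipOn (fun x => x ∈ S ∧ col x = col e) * rot)
          (Sum.inl (e, true)) (Sum.inl (e, false)) := fun h' =>
        h (Linked.mono (fun _ h => h.1) (linked_of_sameCycle_flip h'))
      have := cyc_swap_mul_merge h3
      rw [← mul_assoc, ← flipOn_insert (p := fun x => x ∈ S ∧ col x = col e) he'] at this
      rw [numLinked_insert_of_not_linked h] at ih
      omega

end PowerCounting

/-! ### Faces of connected maps and of trees. -/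

section Faces

variable {E X : Type} [Fintype E] [Finite X] {D : ℕ}

/-- The faces of color `c` are the cycles of `face rot col c`. -/
noncomputable def face (rot : Perm (HalfEdge E X)) (col : E → Fin D) (c : Fin D) :
    Perm (HalfEdge E X) := flipOn (fun e => col e = c) * rot

variable {rot : Perm (HalfEdge E X)} (col : E → Fin D)

theorem Conn.cyc_le (h : Conn rot) : cyc rot ≤ Fintype.card E + 1 := by
  have := cyc_le_card_add_numLinked rot Finset.univ
  simp only [Finset.mem_univ, Finset.card_univ] at this
  have := h.numLinked_le
  omega

theorem Conn.sum_cyc_face_le (h : Conn rot) :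
    ∑ c, cyc (face rot col c) + 2 * cyc rot ≤ D * cyc rot + Fintype.card E + 2 := by
  have := sum_cyc_flip_le rot col Finset.univ
  simp only [Finset.mem_univ, Finset.card_univ, true_and] at this
  have := h.numLinked_le
  simp only [face]
  omega

theorem cyc_le_cyc_face (rot : Perm (HalfEdge E X)) (c : Fin D) :
    cyc rot ≤ cyc (face rot col c) + (Finset.univ.filter fun e => col e = c).card := by
  have := cyc_le_cyc_flip_add_card rot (Finset.univ.filter fun e => col e = c)
  simpa [face] using this

theorem cyc_le_numLinked_color (rot : Perm (HalfEdge E X)) (c : Fin D) :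
    cyc rot ≤ numLinked rot (fun e => col e = c) +
      (Finset.univ.filter fun e => col e = c).card := by
  have := cyc_le_card_add_numLinked rot (Finset.univ.filter fun e => col e = c)
  simp only [Finset.mem_filter, Finset.mem_univ, true_and] at this
  omega

theorem sum_card_color : ∑ c : Fin D, (Finset.univ.filter fun e => col e = c).card =
    Fintype.card E := by
  rw [← Finset.card_univ, Finset.card_eq_sum_card_fiberwise (f := col) (t := Finset.univ)]
  simp

/-- Before any crossing, each color has one face per vertex, and each edge removes at most one face
of its single color. For trees this meets the bound of `Conn.sum_cyc_face_le`. -/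
theorem mul_cyc_le_sum_cyc_face (rot : Perm (HalfEdge E X)) :
    D * cyc rot ≤ ∑ c, cyc (face rot col c) + Fintype.card E := by
  have := Finset.sum_le_sum fun (c : Fin D) (_ : c ∈ Finset.univ) => cyc_le_cyc_face col rot c
  rw [Finset.sum_add_distrib, sum_card_color] at this
  simpa using this

/-- A connected map with one more vertex than edges. -/
def Tree {E X : Type} (rot : Perm (HalfEdge E X)) : Prop := Conn rot ∧ cyc rot = Nat.card E + 1

/-- In a tree, two half-edges linked by edges of color `c` lie on the same face of color `c`. -/
theorem Tree.sameCycle_face_iff (h : Tree rot) (c : Fin D) (x y : HalfEdge E X) :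
    SameCycle (face rot col c) x y ↔ Linked rot (fun e => col e = c) x y := by
  refine ⟨linked_of_sameCycle_flip, fun hxy => ?_⟩
  have h1 := h.1.sum_cyc_face_le col
  have h2 : ∀ c ∈ Finset.univ, cyc rot ≤
      cyc (face rot col c) + (Finset.univ.filter fun e => col e = c).card :=
    fun c _ => cyc_le_cyc_face col rot c
  -- Summed over the colors, the bounds `h2` are equalities for a tree, so each of them is an
  -- equality.
  have h3 : cyc rot =
      cyc (face rot col c) + (Finset.univ.filter fun e => col e = c).card := by
    refine (Finset.sum_eq_sum_iff_of_le h2).1 (le_antisymm (Finset.sum_le_sum h2) ?_) c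
      (Finset.mem_univ c)
    rw [Finset.sum_add_distrib, sum_card_color]
    have := h.2
    rw [Nat.card_eq_fintype_card] at this
    simp only [Finset.sum_const, Finset.card_univ, Fintype.card_fin, smul_eq_mul]
    omega
  have h4 := cyc_le_numLinked_color col rot c
  -- Faces map onto linked classes, and by `h3` and `h4` there are no more faces than classes, so
  -- the map is injective.
  let g : Quotient (SameCycle.setoid (face rot col c)) →
      Quotient (Linked rot fun e => col e = c) :=
    Quotient.map' id fun x y => linked_of_sameCycle_flip
  have hg : Function.Surjective g := by
    intro q
    induction q using Quotient.inductionOn with | h x => exact ⟨Quotient.mk _ x, rfl⟩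
  have h5 : Nat.card (Quotient (SameCycle.setoid (face rot col c))) =
      Nat.card (Quotient (Linked rot fun e => col e = c)) := by
    refine le_antisymm ?_ (Nat.card_le_card_of_surjective g hg)
    change cyc (face rot col c) ≤ numLinked rot _
    omega
  have hg' : Function.Injective g := (hg.bijective_of_nat_card_le h5.le).1
  exact Quotient.exact (hg' (Quotient.sound hxy : g (Quotient.mk _ x) = g (Quotient.mk _ y)))

end Faces

/-! ### Scaling exponent of maps with two cilia. -/

section TwoCilia

variable {E : Type} {D : ℕ} {rot : Perm (HalfEdge E (Fin 2))} (col : E → Fin D)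

/-- The two cilia are on different vertices. -/
def Apart {E : Type} (rot : Perm (HalfEdge E (Fin 2))) : Prop := ¬ SameCycle rot (Sum.inr 0) (Sum.inr 1)

open Classical in
/-- The colors whose face through one cilium contains the other one. -/
noncomputable def boundary (rot : Perm (HalfEdge E (Fin 2))) (col : E → Fin D) : Finset (Fin D) :=
  Finset.univ.filter fun c => SameCycle (face rot col c) (Sum.inr 0) (Sum.inr 1)

theorem mem_boundary {c : Fin D} :
    c ∈ boundary rot col ↔ SameCycle (face rot col c) (Sum.inr 0) (Sum.inr 1) := by
  simp [boundary]

open Classical in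
-- Crossing edges fixes the cilia, so it commutes with their exchange.
theorem swap_cilia_mul_face (c : Fin D) :
    face (swap (Sum.inr 0) (Sum.inr 1) * rot) col c =
      swap (Sum.inr 0) (Sum.inr 1) * face rot col c := by
  have : (flipOn (fun e => col e = c) : Perm (HalfEdge E (Fin 2))) *
      swap (Sum.inr 0) (Sum.inr 1) = swap (Sum.inr 0) (Sum.inr 1) * flipOn fun e => col e = c := by
    rw [Equiv.mul_swap_eq_swap_mul, flipOn_inr, flipOn_inr]
  rw [face, face, ← mul_assoc, this, mul_assoc]

theorem sum_ite_boundary (a b : ℕ) : (∑ c, if c ∈ boundary rot col then a else b) + b *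
    (boundary rot col).card = b * D + a * (boundary rot col).card := by
  have h := Finset.sum_ite_mem Finset.univ (boundary rot col) fun _ => a
  rw [Finset.sum_ite]
  simp only [Finset.sum_const, smul_eq_mul, Finset.filter_mem_eq_inter, Finset.univ_inter]
  have h1 := Finset.card_filter_add_card_filter_not (s := (Finset.univ : Finset (Fin D)))
    (fun c => c ∈ boundary rot col)
  simp only [Finset.filter_mem_eq_inter, Finset.univ_inter, Finset.card_univ,
    Fintype.card_fin] at h1
  nlinarith

variable [Fintype E]

/-- Composing `rot` with the transposition of the cilia merges their two vertices and keeps the map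
connected. A face through both cilia splits, and two faces through one cilium each merge. The bound
is `Conn.sum_cyc_face_le` for this new map. -/
theorem sum_cyc_face_add_boundary_le (h : Conn rot) (ha : Apart rot) :
    ∑ c, cyc (face rot col c) + 2 * (boundary rot col).card + 2 * cyc rot ≤
      D * cyc rot + Fintype.card E + 4 := by
  classical
  set rot' := swap (Sum.inr 0) (Sum.inr 1) * rot with hrot'
  have h' : Conn rot' := by
    refine fun x y f h1 h2 => h x y f (fun z => ?_) h2
    exact (SameCycle.iff_of_invariant (SameCycle.swap_mul ha (x := z) ⟨1, by simp⟩) h1).symm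
  have h1 := h'.sum_cyc_face_le col
  have h2 : cyc rot' + 1 = cyc rot := cyc_swap_mul_merge ha
  have h3 : ∀ c, cyc (face rot' col c) + 1 =
      cyc (face rot col c) + if c ∈ boundary rot col then 2 else 0 := by
    intro c
    rw [hrot', swap_cilia_mul_face]
    split_ifs with hc <;> rw [mem_boundary] at hc
    · rw [cyc_swap_mul_split (by simp) hc]
    · rw [cyc_swap_mul_merge hc, add_zero]
  have h4 := Finset.sum_congr (s₁ := Finset.univ) rfl fun c _ => h3 c
  rw [Finset.sum_add_distrib, Finset.sum_add_distrib] at h4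
  have h5 := sum_ite_boundary (rot := rot) col 2 0
  simp only [Finset.sum_const, Finset.card_univ, Fintype.card_fin, smul_eq_mul, mul_one] at h4
  have h6 : D * cyc rot = D * cyc rot' + D := by rw [← h2]; ring
  omega

/-- The number of faces of color `c` without cilium. -/
noncomputable def internalFaces (rot : Perm (HalfEdge E (Fin 2))) (col : E → Fin D) (c : Fin D) :
    ℕ := cyc (face rot col c) - if c ∈ boundary rot col then 1 else 2

/-- The truncated subtraction in `internalFaces` is exact: there is always a face, and there are at
least two when the cilia lie on different faces. -/
theorem sum_internalFaces (rot : Perm (HalfEdge E (Fin 2))) :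
    ∑ c, internalFaces rot col c + 2 * D = ∑ c, cyc (face rot col c) + (boundary rot col).card := by
  have h : ∀ c, internalFaces rot col c + (if c ∈ boundary rot col then 1 else 2) =
      cyc (face rot col c) := by
    intro c
    refine Nat.sub_add_cancel ?_
    split_ifs with hc
    · exact Nat.card_pos (α := Quotient (SameCycle.setoid (face rot col c)))
    · rw [mem_boundary] at hc
      refine Finite.one_lt_card_iff_nontrivial.2 ⟨Quotient.mk _ (Sum.inr 0),
        Quotient.mk _ (Sum.inr 1), fun h => hc (Quotient.exact h)⟩
  have h4 := Finset.sum_congr (s₁ := Finset.univ) rfl fun c _ => h c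
  rw [Finset.sum_add_distrib] at h4
  have h5 := sum_ite_boundary (rot := rot) col 1 2
  omega

/-- A tree has `D V - E` faces at least, which leaves room for `2 |boundary| ≤ 2` in the previous
bound. Geometrically, the cilia share a face of color `c` only if the path between them is entirely
of color `c`. -/
theorem Tree.card_boundary_le (h : Tree rot) (ha : Apart rot) : (boundary rot col).card ≤ 1 := by
  have h1 := sum_cyc_face_add_boundary_le col h.1 ha
  have h2 := mul_cyc_le_sum_cyc_face col rot
  have h3 := h.2
  rw [Nat.card_eq_fintype_card] at h3
  omega

/-- The power of `N` of a map in the rescaled cumulant. -/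
noncomputable def scaling (rot : Perm (HalfEdge E (Fin 2))) (col : E → Fin D) : ℤ :=
  (∑ c, internalFaces rot col c : ℕ) - ((D : ℤ) - 1) * (Fintype.card E + 2) -
    ((D : ℤ) - 2 * ((D : ℤ) - 1) * 2 - (numComponents (boundary rot col) : ℤ))

/-- The number of faces is exactly `D V - E`, and the exponent reduces to `|boundary| + ρ - 2`. This
vanishes because `|boundary|` is `0` or `1`, with `ρ = 2` or `1` respectively. -/
theorem Tree.scaling_eq_zero (hD : 3 ≤ D) (h : Tree rot) (ha : Apart rot) :
    scaling rot col = 0 := by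
  have h0 := h.card_boundary_le col ha
  have h1 := h.1.sum_cyc_face_le col
  have h2 := mul_cyc_le_sum_cyc_face col rot
  have h3 := sum_internalFaces col rot
  have h4 : numComponents (boundary rot col) + (boundary rot col).card = 2 := by
    rw [numComponents]
    split_ifs with hb
    · rcases hb with hb | hb
      · simp [hb]
      · rw [hb, Finset.card_univ, Fintype.card_fin] at h0
        omega
    · have : boundary rot col ≠ ∅ := fun h => hb (Or.inl h)
      have := Finset.card_pos.2 (Finset.nonempty_of_ne_empty this)
      omega
  have h5 : ∑ c, cyc (face rot col c) + Fintype.card E = D * cyc rot := by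
    have := h.2
    rw [Nat.card_eq_fintype_card] at this
    omega
  rw [h.2, Nat.card_eq_fintype_card] at h5
  rw [scaling]
  zify at *
  linear_combination (1 : ℤ) * h3 + h5 + h4

/-- A connected map that is not a tree has `V ≤ E`. With empty boundary the bound
`Conn.sum_cyc_face_le` suffices. Otherwise the refined bound gives `-(D - 2) + ρ - |boundary|`, and
`ρ ≤ |boundary|`; when all colors are in the boundary this reads `2 ≤ D`. -/
theorem scaling_le (hD : 3 ≤ D) (h : Conn rot) (ha : Apart rot) (ht : ¬ Tree rot) :
    scaling rot col ≤ -((D : ℤ) - 2) := by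
  have h1 := h.sum_cyc_face_le col
  have h2 := sum_cyc_face_add_boundary_le col h ha
  have h3 := sum_internalFaces col rot
  have h4 : cyc rot ≤ Fintype.card E := by
    have := h.cyc_le
    have : cyc rot ≠ Fintype.card E + 1 := fun h' =>
      ht ⟨h, by rw [h', Nat.card_eq_fintype_card]⟩
    omega
  have h5 : (D - 2) * cyc rot ≤ (D - 2) * Fintype.card E := Nat.mul_le_mul_left _ h4
  have h6 : ((D : ℤ) - 2) * cyc rot ≤ ((D : ℤ) - 2) * Fintype.card E := by
    have : ((D - 2 : ℕ) : ℤ) = (D : ℤ) - 2 := by omega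
    rw [← this]
    exact_mod_cast h5
  rw [scaling]
  rcases Finset.eq_empty_or_nonempty (boundary rot col) with hb | hb
  · have : numComponents (boundary rot col) = 2 := by simp [numComponents, hb]
    rw [this]
    rw [hb] at h3
    zify at *
    simp only [Finset.card_empty] at h3
    push_cast at *
    linarith
  · have : numComponents (boundary rot col) ≤ (boundary rot col).card := by
      rw [numComponents]
      split_ifs with hb'
      · rcases hb' with hb' | hb'
        · simp [hb'] at hb
        · rw [hb', Finset.card_univ, Fintype.card_fin]; omega
      · exact Finset.card_pos.2 hb
    zify at *
    linarith

end TwoCilia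

end QuarticTensor

namespace QuarticTensor

open MeasureTheory

/-! ## Gaussian moments -/

theorem integral_norm_pow_mul_exp {l : ℝ} (hl : 0 < l) (m : ℕ) :
    ∫ z : ℂ, ‖z‖ ^ (2 * m) * Real.exp (-(l * ‖z‖ ^ 2)) =
      Real.pi * (m.factorial / l ^ (m + 1)) := by
  have h := Complex.integral_rpow_mul_exp_neg_mul_rpow (p := 2) (q := (2 * m : ℕ)) (b := l)
    (by norm_num) (by have : (0 : ℝ) ≤ ((2 * m : ℕ) : ℝ) := Nat.cast_nonneg _
                      linarith) hl
  simp only [Real.rpow_natCast] at h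
  have h2 : ∀ x : ℝ, x ^ (2 : ℝ) = x ^ 2 := fun x => by
    rw [← Real.rpow_natCast]; norm_num
  have h3 : (((2 * m : ℕ) : ℝ) + 2) / 2 = (m : ℝ) + 1 := by push_cast; ring
  have h4 : -(((2 * m : ℕ) : ℝ) + 2) / 2 = -((m + 1 : ℕ) : ℝ) := by push_cast; ring
  rw [h3, h4, Real.Gamma_nat_eq_factorial, Real.rpow_neg hl.le, Real.rpow_natCast] at h
  simp only [h2, neg_mul] at h
  rw [h]
  field_simp

/-- The integral of a non-integrable function is zero by convention, whereas this one has a positive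
value. -/
theorem integrable_norm_pow_mul_exp {l : ℝ} (hl : 0 < l) (m : ℕ) :
    Integrable fun z : ℂ => ‖z‖ ^ (2 * m) * Real.exp (-(l * ‖z‖ ^ 2)) := by
  refine not_imp_comm.1 integral_undef ?_
  rw [integral_norm_pow_mul_exp hl m]
  positivity

/-- The density of the complex Gaussian with covariance `1 / l`. -/
noncomputable def gaussianDensity (l : ℝ) (z : ℂ) : ℂ :=
  ((l / Real.pi * Real.exp (-(l * ‖z‖ ^ 2)) : ℝ) : ℂ)

theorem integrable_pow_mul_gaussianDensity {l : ℝ} (hl : 0 < l) (m k : ℕ) :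
    Integrable fun z : ℂ => z ^ m * (starRingEnd ℂ) z ^ k * gaussianDensity l z := by
  have h := ((integrable_norm_pow_mul_exp hl 0).add
    (integrable_norm_pow_mul_exp hl (m + k))).const_mul (l / Real.pi)
  refine h.mono (by unfold gaussianDensity; fun_prop) (Filter.Eventually.of_forall fun z => ?_)
  have hp : 0 < l / Real.pi := by positivity
  -- With `x = ‖z‖ ^ (m + k)` this is `x ≤ 1 + x ^ 2`, so the even moments dominate all the others.
  have hx : ‖z‖ ^ (m + k) ≤ ‖z‖ ^ (2 * 0) + ‖z‖ ^ (2 * (m + k)) := by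
    have := sq_nonneg (‖z‖ ^ (m + k) - 1)
    have h0 : 0 ≤ ‖z‖ ^ (m + k) := by positivity
    rw [pow_mul' ‖z‖ 2 (m + k), mul_zero, pow_zero]
    nlinarith
  rw [norm_mul, norm_mul, norm_pow, norm_pow, RCLike.norm_conj, gaussianDensity, Complex.norm_real,
    Real.norm_eq_abs, Real.norm_eq_abs, abs_of_pos (by positivity),
    abs_of_nonneg (mul_nonneg hp.le (by simp only [Pi.add_apply]; positivity)), ← pow_add]
  simp only [Pi.add_apply]
  calc ‖z‖ ^ (m + k) * (l / Real.pi * Real.exp (-(l * ‖z‖ ^ 2)))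
      ≤ (‖z‖ ^ (2 * 0) + ‖z‖ ^ (2 * (m + k))) * (l / Real.pi * Real.exp (-(l * ‖z‖ ^ 2))) := by
        gcongr
    _ = _ := by ring

theorem integral_pow_mul_gaussianDensity {l : ℝ} (hl : 0 < l) (m k : ℕ) :
    ∫ z : ℂ, z ^ m * (starRingEnd ℂ) z ^ k * gaussianDensity l z =
      if m = k then (m.factorial : ℂ) / (l : ℂ) ^ m else 0 := by
  split_ifs with h
  · subst h
    have h1 : ∀ z : ℂ, z ^ m * (starRingEnd ℂ) z ^ m * gaussianDensity l z =
        ((l / Real.pi * (‖z‖ ^ (2 * m) * Real.exp (-(l * ‖z‖ ^ 2))) : ℝ) : ℂ) := by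
      intro z
      rw [← mul_pow, Complex.mul_conj, Complex.normSq_eq_norm_sq, gaussianDensity]
      push_cast
      ring
    simp only [h1]
    rw [integral_complex_ofReal, integral_const_mul, integral_norm_pow_mul_exp hl]
    have : (Real.pi : ℂ) ≠ 0 := by exact_mod_cast Real.pi_ne_zero
    have : (l : ℂ) ≠ 0 := by exact_mod_cast hl.ne'
    push_cast
    field_simp
    ring
  · have hmk : (m : ℝ) - k ≠ 0 := sub_ne_zero.2 (by exact_mod_cast h)
    -- The rotation is chosen so that `w ^ (m - k) = -1`: it preserves the measure and the density,
    -- and changes the sign of the integrand.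
    let w : Circle := Circle.exp (Real.pi / ((m : ℝ) - k))
    have hw : (w : ℂ) ^ m * (starRingEnd ℂ) (w : ℂ) ^ k = -1 := by
      rw [← Circle.coe_inv_eq_conj]
      have h1 : (w : ℂ) = Complex.exp ((Real.pi / ((m : ℝ) - k) : ℝ) * Complex.I) :=
        Circle.coe_exp _
      have h3 : ((m : ℂ) - k) ≠ 0 := by exact_mod_cast hmk
      rw [Circle.coe_inv, h1, ← Complex.exp_neg, ← Complex.exp_nat_mul, ← Complex.exp_nat_mul,
        ← Complex.exp_add, ← Complex.exp_pi_mul_I]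
      congr 1
      push_cast
      field_simp
      ring
    have hinv := (LinearIsometryEquiv.measurePreserving (rotation w)).integral_comp
      (rotation w).toHomeomorph.measurableEmbedding
      (fun z : ℂ => z ^ m * (starRingEnd ℂ) z ^ k * gaussianDensity l z)
    have h2 : ∀ z : ℂ, (rotation w z) ^ m * (starRingEnd ℂ) (rotation w z) ^ k *
        gaussianDensity l (rotation w z) =
          -(z ^ m * (starRingEnd ℂ) z ^ k * gaussianDensity l z) := by
      intro z
      rw [gaussianDensity, LinearIsometryEquiv.norm_map, rotation_apply, map_mul, mul_pow, mul_pow,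
        ← gaussianDensity]
      linear_combination (z ^ m * (starRingEnd ℂ) z ^ k * gaussianDensity l z) * hw
    simp only [h2, integral_neg] at hinv
    exact self_eq_neg.1 hinv.symm

/-- The number of bijections matching two families of indices. -/
theorem card_matchings {I Y : Type*} [Fintype I] [DecidableEq I] [Fintype Y] [DecidableEq Y]
    (a b : I → Y) :
    (Fintype.card {π : Equiv.Perm I // ∀ i, a i = b (π i)} : ℂ) =
      ∏ y, if Fintype.card {i // a i = y} = Fintype.card {i // b i = y} then
        ((Fintype.card {i // a i = y}).factorial : ℂ) else 0 := by
  by_cases h : ∃ π : Equiv.Perm I, ∀ i, a i = b (π i)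
  · obtain ⟨π, hπ⟩ := h
    have hc : ∀ y, Fintype.card {i // a i = y} = Fintype.card {i // b i = y} := fun y =>
      Fintype.card_congr (π.subtypeEquiv fun i => by rw [hπ])
    -- Given one matching `π`, the others form a coset of the stabilizer of `b`, whose order is a
    -- product of factorials.
    have h1 : Fintype.card {σ : Equiv.Perm I // ∀ i, a i = b (σ i)} =
        Fintype.card {g : Equiv.Perm I // b ∘ g = b} := by
      refine Fintype.card_congr ((Equiv.mulRight π⁻¹).subtypeEquiv fun σ => ?_)
      constructor
      · intro h
        funext i
        simp only [Equiv.coe_mulRight, Function.comp_apply, Equiv.Perm.mul_apply]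
        rw [← h, hπ]; simp
      · intro h i
        have := congrFun h (π i)
        simp at this
        rw [this, hπ]
    rw [h1, DomMulAct.stabilizer_card]
    push_cast
    exact Finset.prod_congr rfl fun y _ => by rw [if_pos (hc y), hc y]
  · have hz : Fintype.card {π : Equiv.Perm I // ∀ i, a i = b (π i)} = 0 :=
      Fintype.card_eq_zero_iff.2 ⟨fun π => h ⟨π.1, π.2⟩⟩
    rw [hz, Nat.cast_zero, eq_comm, Finset.prod_eq_zero_iff]
    by_contra hc
    push Not at hc
    have hc' : ∀ y, Fintype.card {i // a i = y} = Fintype.card {i // b i = y} := by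
      intro y
      by_contra hy
      exact hc y (Finset.mem_univ y) (if_neg hy)
    refine h ⟨Equiv.ofFiberEquiv fun y => Fintype.equivOfCardEq (hc' y), fun i => ?_⟩
    exact (Equiv.ofFiberEquiv_map _ i).symm

/-! ### Wick's theorem for products of tensor components. -/

section Wick

variable {D N : ℕ} {I : Type*} [Fintype I]

/-- The product of the components of a tensor and of its conjugate. -/
noncomputable def monomial (a b : I → Idx D N) (T : Tensor D N) : ℂ :=
  ∏ i, (T (a i) * (starRingEnd ℂ) (T (b i)))

/-- Grouping the factors by the component they involve makes the integrand a product of functions of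
one complex variable. -/
theorem monomial_mul_density (a b : I → Idx D N) (T : Tensor D N) :
    monomial a b T * ((∏ y : Idx D N,
      ((N : ℝ) ^ (D - 1) / Real.pi * Real.exp (-((N : ℝ) ^ (D - 1) * ‖T y‖ ^ 2)) : ℝ)) : ℂ) =
    ∏ y : Idx D N, (T y ^ Fintype.card {i // a i = y} *
      (starRingEnd ℂ) (T y) ^ Fintype.card {i // b i = y} *
        gaussianDensity ((N : ℝ) ^ (D - 1)) (T y)) := by
  have h : ∀ (f : Idx D N → ℂ) (g : I → Idx D N),
      ∏ i, f (g i) = ∏ y, f y ^ Fintype.card {i // g i = y} := by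
    intro f g
    rw [← Finset.prod_fiberwise (Finset.univ) g]
    refine Finset.prod_congr rfl fun y _ => ?_
    rw [Fintype.card_subtype, ← Finset.prod_const]
    exact Finset.prod_congr rfl fun i hi => by rw [(Finset.mem_filter.1 hi).2]
  rw [monomial, Finset.prod_mul_distrib, h T a, h (fun y => (starRingEnd ℂ) (T y)) b,
    ← Finset.prod_mul_distrib, ← Finset.prod_mul_distrib]
  rfl

theorem integrable_monomial (hN : 1 ≤ N) (a b : I → Idx D N) :
    Integrable fun T : Tensor D N => monomial a b T * ((∏ y : Idx D N,
      ((N : ℝ) ^ (D - 1) / Real.pi * Real.exp (-((N : ℝ) ^ (D - 1) * ‖T y‖ ^ 2)) : ℝ)) : ℂ) := by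
  simp only [monomial_mul_density]
  have hl : (0 : ℝ) < (N : ℝ) ^ (D - 1) := by
    have : (0 : ℝ) < N := by exact_mod_cast hN
    positivity
  exact Integrable.fintype_prod (f := fun (y : Idx D N) (z : ℂ) =>
    z ^ Fintype.card {i // a i = y} * (starRingEnd ℂ) z ^ Fintype.card {i // b i = y} *
        gaussianDensity ((N : ℝ) ^ (D - 1)) z)
    fun y => integrable_pow_mul_gaussianDensity hl _ _

/-- Wick's theorem. -/
theorem gaussianExpectation_monomial [DecidableEq I] (hN : 1 ≤ N) (a b : I → Idx D N) :
    gaussianExpectation D N (monomial a b) =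
      ((N : ℂ) ^ (D - 1))⁻¹ ^ Fintype.card I *
        Fintype.card {π : Equiv.Perm I // ∀ i, a i = b (π i)} := by
  have hl : (0 : ℝ) < (N : ℝ) ^ (D - 1) := by
    have : (0 : ℝ) < N := by exact_mod_cast hN
    positivity
  rw [gaussianExpectation]
  simp only [monomial_mul_density]
  rw [integral_fintype_prod_volume_eq_prod (fun (y : Idx D N) (z : ℂ) =>
    z ^ Fintype.card {i // a i = y} * (starRingEnd ℂ) z ^ Fintype.card {i // b i = y} *
        gaussianDensity ((N : ℝ) ^ (D - 1)) z)]
  simp only [integral_pow_mul_gaussianDensity hl]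
  have hcard : Fintype.card I = ∑ y, Fintype.card {i // a i = y} := by
    rw [← Fintype.card_sigma, Fintype.card_congr (Equiv.sigmaFiberEquiv a)]
  rw [card_matchings, hcard, ← Finset.prod_pow_eq_pow_sum, ← Finset.prod_mul_distrib]
  refine Finset.prod_congr rfl fun y _ => ?_
  split_ifs with h
  · push_cast
    rw [inv_pow, div_eq_mul_inv, mul_comm]
  · simp

theorem gaussianExpectation_sum {J : Type*} (s : Finset J) (hN : 1 ≤ N) (w : J → ℂ)
    (a b : J → I → Idx D N) :
    gaussianExpectation D N (fun T => ∑ j ∈ s, w j * monomial (a j) (b j) T) =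
      ∑ j ∈ s, w j * gaussianExpectation D N (monomial (a j) (b j)) := by
  simp only [gaussianExpectation, Finset.sum_mul, mul_assoc]
  rw [integral_finsetSum]
  · simp only [integral_const_mul]
  · exact fun j _ => (integrable_monomial hN (a j) (b j)).const_mul (w j)

end Wick

end QuarticTensor

namespace QuarticTensor

open Equiv Equiv.Perm

/-! ## The perturbative expansion as a sum over maps -/

section Count

variable {E X : Type} {D N : ℕ}

/-- The indices of the conjugate tensors in terms of those of the tensors, at quartic vertices. -/
def mix (col : E → Fin D) (x : E × Bool → Idx D N) : E × Bool → Idx D N :=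
  fun h c => x (h.1, if col h.1 = c then !h.2 else h.2) c

/-- The number of index configurations of a map with external indices `a` and `b`. -/
noncomputable def numIndices (rot : Perm (HalfEdge E X)) (col : E → Fin D) (a b : X → Idx D N) : ℕ :=
  Nat.card {x : E × Bool → Idx D N // ∀ h, Sum.elim x a h = Sum.elim (mix col x) b (rot h)}

end Count

section Expansion

variable {D N : ℕ}

/-- The indices of the tensors determine those of the conjugates, which collapses the fourfold index
sum to a sum over two indices. -/
theorem traceOp_singleton (c : Fin D) (x y : Bool → Idx D N) :
    traceOp {c} (x true) (x false) (y true) (y false) =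
      if y = (fun s c' => x (if c = c' then !s else s) c') then 1 else 0 := by
  rw [traceOp]
  refine if_congr ?_ rfl rfl
  constructor
  · intro h
    funext s c'
    obtain ⟨h1, h2⟩ := h c'
    by_cases hc : c = c'
    · have := h2 (by simp [hc])
      cases s <;> simp [hc, this]
    · have := h1 (by simpa using fun h => hc h.symm)
      cases s <;> simp [hc, this]
  · rintro rfl c'
    constructor
    · intro h
      have : c ≠ c' := by simpa using fun h' : c = c' => h (by simp [h'])
      simp [this]
    · intro h
      have : c = c' := by simpa using (Finset.mem_singleton.1 h).symm
      simp [this]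

theorem sum_bool_fun {Y M : Type*} [Fintype Y] [DecidableEq Y] [AddCommMonoid M]
    (F : (Bool → Y) → M) :
    ∑ x : Bool → Y, F x = ∑ a : Y, ∑ b : Y, F (fun s => if s then a else b) := by
  rw [← Fintype.sum_prod_type']
  refine Fintype.sum_equiv (Equiv.boolArrowEquivProd Y |>.trans (Equiv.prodComm _ _)) _ _ fun x => ?_
  congr 1
  funext s
  cases s <;> simp

theorem traceB4_singleton (c : Fin D) (T : Tensor D N) :
    traceB4 {c} T = ∑ x : Bool → Idx D N,
      monomial x (fun s c' => x (if c = c' then !s else s) c') T := by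
  classical
  have h : ∀ x : Bool → Idx D N, monomial x (fun s c' => x (if c = c' then !s else s) c') T =
      ∑ y : Bool → Idx D N, traceOp {c} (x true) (x false) (y true) (y false) *
        (T (x true) * T (x false) * (starRingEnd ℂ) (T (y true)) *
          (starRingEnd ℂ) (T (y false))) := by
    intro x
    simp only [traceOp_singleton, ite_mul, one_mul, zero_mul, Finset.sum_ite_eq', Finset.mem_univ,
      if_true, monomial, Fintype.prod_bool]
    ring
  simp only [h]
  rw [sum_bool_fun]
  simp only [sum_bool_fun]
  rfl

theorem interaction_eq (T : Tensor D N) :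
    interaction D N T = (N : ℂ) ^ (D - 1) / 2 * ∑ q : Fin D × (Bool → Idx D N),
      monomial q.2 (fun s c' => q.2 (if q.1 = c' then !s else s) c') T := by
  rw [interaction, Fintype.sum_prod_type]
  simp only [traceB4_singleton, ← Finset.mul_sum]
  ring

theorem monomial_sumElim {I J : Type*} [Fintype I] [Fintype J] (x y : I → Idx D N)
    (a b : J → Idx D N) (T : Tensor D N) :
    monomial (Sum.elim x a) (Sum.elim y b) T = monomial x y T * monomial a b T := by
  simp [monomial, Fintype.prod_sum_type]

theorem interaction_pow (n : ℕ) (T : Tensor D N) :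
    interaction D N T ^ n = ((N : ℂ) ^ (D - 1) / 2) ^ n *
      ∑ q : (Fin n → Fin D) × (Fin n × Bool → Idx D N), monomial q.2 (mix q.1 q.2) T := by
  rw [interaction_eq, mul_pow, Fintype.sum_pow]
  congr 1
  refine Fintype.sum_equiv ((Equiv.arrowProdEquivProdArrow _ _ _).trans
    (Equiv.prodCongr (Equiv.refl _) (Equiv.curry _ _ _).symm)) _ _ fun p => ?_
  simp only [monomial, Fintype.prod_prod_type]
  rfl

/-- The sum over all maps of the number of index configurations. -/
noncomputable def moment (D : ℕ) {N : ℕ} (E X : Type) [Fintype E] [DecidableEq E] [Fintype X] [DecidableEq X]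
    (a b : X → Idx D N) : ℕ :=
  ∑ col : E → Fin D, ∑ rot : Perm (HalfEdge E X), numIndices rot col a b

/-- Each edge carries `N ^ (D - 1) / 2` and two propagators `N ^ -(D - 1)`, hence the weight `1 / (2
N ^ (D - 1))`; each cilium carries one propagator. Exchanging the sums over indices and pairings
produces the sum over maps. -/
theorem coeff_unnormalizedMoment (hN : 1 ≤ N) {X : Type} [Fintype X] [DecidableEq X]
    (a b : X → Idx D N) (n : ℕ) :
    PowerSeries.coeff n (unnormalizedMoment D N (monomial a b)) =
      ((N : ℂ) ^ (D - 1))⁻¹ ^ Fintype.card X * ((n.factorial : ℂ)⁻¹ *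
        (2 * (N : ℂ) ^ (D - 1))⁻¹ ^ n * moment D (Fin n) X a b) := by
  have hN' : (N : ℂ) ≠ 0 := by exact_mod_cast (by omega : N ≠ 0)
  have h1 : (fun T : Tensor D N => monomial a b T * interaction D N T ^ n) =
      fun T => ∑ q : (Fin n → Fin D) × (Fin n × Bool → Idx D N), ((N : ℂ) ^ (D - 1) / 2) ^ n *
        monomial (Sum.elim q.2 a) (Sum.elim (mix q.1 q.2) b) T := by
    funext T
    rw [interaction_pow, Finset.mul_sum, Finset.mul_sum]
    refine Finset.sum_congr rfl fun q _ => ?_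
    rw [monomial_sumElim]
    ring
  rw [unnormalizedMoment, PowerSeries.coeff_mk, h1,
    gaussianExpectation_sum (J := (Fin n → Fin D) × (Fin n × Bool → Idx D N)) _ hN
      (fun _ => ((N : ℂ) ^ (D - 1) / 2) ^ n)
      (fun q => Sum.elim q.2 a) (fun q => Sum.elim (mix q.1 q.2) b)]
  simp only [gaussianExpectation_monomial hN]
  have h2 : (moment D (Fin n) X a b : ℂ) =
      ∑ q : (Fin n → Fin D) × (Fin n × Bool → Idx D N),
        (Fintype.card {π : Perm (HalfEdge (Fin n) X) //
          ∀ h, Sum.elim q.2 a h = Sum.elim (mix q.1 q.2) b (π h)} : ℂ) := by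
    rw [moment, Fintype.sum_prod_type]
    push_cast
    refine Finset.sum_congr rfl fun col _ => ?_
    simp only [numIndices, Nat.card_eq_fintype_card, Fintype.card_subtype, Finset.card_filter]
    push_cast
    exact Finset.sum_comm
  rw [← Finset.mul_sum, ← Finset.mul_sum, ← h2]
  have h3 : Fintype.card ((Fin n × Bool) ⊕ X) = 2 * n + Fintype.card X := by
    simp [mul_comm]
  have h4 : ((N : ℂ) ^ (D - 1) / 2) ^ n * ((N : ℂ) ^ (D - 1))⁻¹ ^ (2 * n) =
      (2 * (N : ℂ) ^ (D - 1))⁻¹ ^ n := by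
    rw [pow_mul, ← mul_pow]
    congr 1
    field_simp
  rw [h3, pow_add, ← h4]
  ring

end Expansion

end QuarticTensor

namespace QuarticTensor

open Equiv Equiv.Perm

/-! ## Relabeling and gluing maps -/

section Relabel

variable {E E' X X' : Type}

/-- The relabeling of the half-edges given by relabelings of the edges and of the cilia. -/
def relabelEquiv (e : E ≃ E') (g : X ≃ X') : HalfEdge E X ≃ HalfEdge E' X' :=
  Equiv.sumCongr (Equiv.prodCongr e (Equiv.refl Bool)) g

@[simp] theorem relabelEquiv_inl (e : E ≃ E') (g : X ≃ X') (x : E) (s : Bool) :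
    relabelEquiv e g (Sum.inl (x, s)) = Sum.inl (e x, s) := rfl

@[simp] theorem relabelEquiv_inr (e : E ≃ E') (g : X ≃ X') (i : X) :
    relabelEquiv e g (Sum.inr i) = Sum.inr (g i) := rfl

theorem permCongr_apply_apply {α β : Type*} (φ : α ≃ β) (σ : Perm α) (x : α) :
    φ.permCongr σ (φ x) = φ (σ x) := by simp [Equiv.permCongr_apply]

theorem linked_permCongr (φ : HalfEdge E X ≃ HalfEdge E' X') (rot : Perm (HalfEdge E X))
    (p : E → Prop) (p' : E' → Prop)
    (hp : ∀ e', p' e' → ∃ e s t, p e ∧ φ (Sum.inl (e, s)) = Sum.inl (e', true) ∧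
      φ (Sum.inl (e, t)) = Sum.inl (e', false))
    {x y : HalfEdge E X} (h : Linked (φ.permCongr rot) p' (φ x) (φ y)) : Linked rot p x y := by
  intro f h1 h2
  have := h (fun z => f (φ.symm z)) (fun z => ?_) (fun e' he' => ?_)
  · simpa using this
  · obtain ⟨z, rfl⟩ := φ.surjective z
    rw [permCongr_apply_apply]
    simpa using h1 z
  · obtain ⟨e, s, t, he, hs, ht⟩ := hp e' he'
    rw [← hs, ← ht]
    have := h2 e he
    simp only [Equiv.symm_apply_apply]
    cases s <;> cases t <;> tauto

theorem permCongr_relabelEquiv_symm (e : E ≃ E') (g : X ≃ X') (rot : Perm (HalfEdge E X)) :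
    (relabelEquiv e.symm g.symm).permCongr ((relabelEquiv e g).permCongr rot) = rot := by
  have h : relabelEquiv e.symm g.symm = (relabelEquiv e g).symm := rfl
  ext1 x
  rw [h, Equiv.permCongr_apply, Equiv.symm_symm, permCongr_apply_apply, Equiv.symm_apply_apply]

theorem linked_relabel (e : E ≃ E') (g : X ≃ X') (rot : Perm (HalfEdge E X)) {p : E → Prop}
    {p' : E' → Prop} (hp : ∀ x, p' (e x) ↔ p x) (x y : HalfEdge E X) :
    Linked ((relabelEquiv e g).permCongr rot) p' (relabelEquiv e g x) (relabelEquiv e g y) ↔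
      Linked rot p x y := by
  refine ⟨linked_permCongr _ rot p p' fun e' he' => ?_, fun h => ?_⟩
  · refine ⟨e.symm e', true, false, ?_, by simp, by simp⟩
    rw [← hp]; simpa using he'
  · refine linked_permCongr (relabelEquiv e.symm g.symm) ((relabelEquiv e g).permCongr rot) p' p
      (fun x hx => ⟨e x, true, false, (hp x).2 hx, by simp, by simp⟩) ?_
    rw [permCongr_relabelEquiv_symm]
    have h' : ∀ z, relabelEquiv e.symm g.symm (relabelEquiv e g z) = z := by
      rintro (⟨z, s⟩ | i) <;> simp
    rwa [h', h']

theorem conn_relabel (e : E ≃ E') (g : X ≃ X') (rot : Perm (HalfEdge E X)) :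
    Conn ((relabelEquiv e g).permCongr rot) ↔ Conn rot := by
  constructor
  · intro h x y
    exact (linked_relabel e g rot (fun _ => Iff.rfl) x y).1 (h _ _)
  · intro h x y
    obtain ⟨x, rfl⟩ := (relabelEquiv e g).surjective x
    obtain ⟨y, rfl⟩ := (relabelEquiv e g).surjective y
    exact (linked_relabel e g rot (fun _ => Iff.rfl) x y).2 (h _ _)

theorem tree_relabel (e : E ≃ E') (g : X ≃ X') (rot : Perm (HalfEdge E X)) :
    Tree ((relabelEquiv e g).permCongr rot) ↔ Tree rot := by
  rw [Tree, Tree, conn_relabel, cyc_conj, Nat.card_congr e]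

theorem sameCycle_permCongr {α β : Type*} (φ : α ≃ β) (σ : Perm α) (x y : α) :
    SameCycle (φ.permCongr σ) (φ x) (φ y) ↔ SameCycle σ x y := by
  have hpow : ∀ n : ℤ, ((φ.permCongr σ) ^ n) (φ x) = φ ((σ ^ n) x) := by
    intro n
    have : (φ.permCongr σ) ^ n = φ.permCongr (σ ^ n) := (map_zpow φ.permCongrHom σ n).symm
    rw [this, permCongr_apply_apply]
  simp only [SameCycle, hpow, φ.apply_eq_iff_eq]

theorem numIndices_relabel {D N : ℕ} (e : E ≃ E') (g : X ≃ X') (rot : Perm (HalfEdge E X))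
    (col : E → Fin D) (a b : X → Idx D N) :
    numIndices ((relabelEquiv e g).permCongr rot) (col ∘ e.symm) (a ∘ g.symm) (b ∘ g.symm) =
      numIndices rot col a b := by
  refine Nat.card_congr (Equiv.subtypeEquiv
    (Equiv.arrowCongr (Equiv.prodCongr e (Equiv.refl Bool)) (Equiv.refl _)) fun x => ?_).symm
  have h1 : ∀ z, Sum.elim ((Equiv.arrowCongr (Equiv.prodCongr e (Equiv.refl Bool))
      (Equiv.refl (Idx D N))) x) (a ∘ g.symm) (relabelEquiv e g z) = Sum.elim x a z := by
    rintro (⟨z, s⟩ | i) <;> simp [Equiv.arrowCongr_apply]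
  have h2 : ∀ z, Sum.elim (mix (col ∘ e.symm) ((Equiv.arrowCongr (Equiv.prodCongr e
      (Equiv.refl Bool)) (Equiv.refl (Idx D N))) x)) (b ∘ g.symm) (relabelEquiv e g z) =
        Sum.elim (mix col x) b z := by
    rintro (⟨z, s⟩ | i)
    · funext c; simp [mix, Equiv.arrowCongr_apply]
    · simp
  rw [← (relabelEquiv e g).forall_congr_right]
  simp only [permCongr_apply_apply, h1, h2]

end Relabel

/-! ### Disjoint unions of maps. -/

section Glue

variable {E₁ E₂ X₁ X₂ : Type}

/-- The half-edges of a disjoint union. -/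
def glueEquiv (E₁ E₂ X₁ X₂ : Type) :
    HalfEdge E₁ X₁ ⊕ HalfEdge E₂ X₂ ≃ HalfEdge (E₁ ⊕ E₂) (X₁ ⊕ X₂) :=
  (Equiv.sumSumSumComm _ _ _ _).trans
    (Equiv.sumCongr (Equiv.sumProdDistrib E₁ E₂ Bool).symm (Equiv.refl _))

@[simp] theorem glueEquiv_inl_inl (e : E₁) (s : Bool) :
    glueEquiv E₁ E₂ X₁ X₂ (Sum.inl (Sum.inl (e, s))) = Sum.inl (Sum.inl e, s) := rfl
@[simp] theorem glueEquiv_inr_inl (e : E₂) (s : Bool) :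
    glueEquiv E₁ E₂ X₁ X₂ (Sum.inr (Sum.inl (e, s))) = Sum.inl (Sum.inr e, s) := rfl
@[simp] theorem glueEquiv_inl_inr (i : X₁) :
    glueEquiv E₁ E₂ X₁ X₂ (Sum.inl (Sum.inr i)) = Sum.inr (Sum.inl i) := rfl
@[simp] theorem glueEquiv_inr_inr (i : X₂) :
    glueEquiv E₁ E₂ X₁ X₂ (Sum.inr (Sum.inr i)) = Sum.inr (Sum.inr i) := rfl
/-- The disjoint union of two maps. -/
def glue (rot₁ : Perm (HalfEdge E₁ X₁)) (rot₂ : Perm (HalfEdge E₂ X₂)) :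
    Perm (HalfEdge (E₁ ⊕ E₂) (X₁ ⊕ X₂)) :=
  (glueEquiv E₁ E₂ X₁ X₂).permCongr (Perm.sumCongr rot₁ rot₂)

variable {rot₁ : Perm (HalfEdge E₁ X₁)} {rot₂ : Perm (HalfEdge E₂ X₂)}

@[simp] theorem glue_inl (x : HalfEdge E₁ X₁) :
    glue rot₁ rot₂ (glueEquiv E₁ E₂ X₁ X₂ (Sum.inl x)) =
      glueEquiv E₁ E₂ X₁ X₂ (Sum.inl (rot₁ x)) := by
  rw [glue, permCongr_apply_apply]; rfl

@[simp] theorem glue_inr (x : HalfEdge E₂ X₂) :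
    glue rot₁ rot₂ (glueEquiv E₁ E₂ X₁ X₂ (Sum.inr x)) =
      glueEquiv E₁ E₂ X₁ X₂ (Sum.inr (rot₂ x)) := by
  rw [glue, permCongr_apply_apply]; rfl

theorem glueEquiv_forall {f : HalfEdge (E₁ ⊕ E₂) (X₁ ⊕ X₂) → Prop} :
    (∀ x, f x) ↔ (∀ x, f (glueEquiv E₁ E₂ X₁ X₂ (Sum.inl x))) ∧
      ∀ x, f (glueEquiv E₁ E₂ X₁ X₂ (Sum.inr x)) := by
  rw [← (glueEquiv E₁ E₂ X₁ X₂).forall_congr_right, Sum.forall]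

theorem glue_injective {rot₁' : Perm (HalfEdge E₁ X₁)} {rot₂' : Perm (HalfEdge E₂ X₂)}
    (h : glue rot₁ rot₂ = glue rot₁' rot₂') : rot₁ = rot₁' ∧ rot₂ = rot₂' := by
  constructor
  · ext1 x
    have := congrArg (fun σ => σ (glueEquiv E₁ E₂ X₁ X₂ (Sum.inl x))) h
    simpa using this
  · ext1 x
    have := congrArg (fun σ => σ (glueEquiv E₁ E₂ X₁ X₂ (Sum.inr x))) h
    simpa using this

/-- The half-edge lies in the first part of a disjoint union. -/
def IsFirst : HalfEdge (E₁ ⊕ E₂) (X₁ ⊕ X₂) → Prop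
  | Sum.inl (e, _) => e.isLeft
  | Sum.inr i => i.isLeft

theorem isFirst_inl (x : HalfEdge E₁ X₁) : IsFirst (glueEquiv E₁ E₂ X₁ X₂ (Sum.inl x)) := by
  rcases x with ⟨e, s⟩ | i <;> simp [IsFirst]

theorem not_isFirst_inr (x : HalfEdge E₂ X₂) : ¬ IsFirst (glueEquiv E₁ E₂ X₁ X₂ (Sum.inr x)) := by
  rcases x with ⟨e, s⟩ | i <;> simp [IsFirst]

theorem isFirst_glue (x : HalfEdge (E₁ ⊕ E₂) (X₁ ⊕ X₂)) :
    IsFirst (glue rot₁ rot₂ x) ↔ IsFirst x := by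
  revert x
  rw [glueEquiv_forall]
  simp [isFirst_inl, not_isFirst_inr]

theorem IsFirst.iff_of_linked {p : E₁ ⊕ E₂ → Prop} {x y : HalfEdge (E₁ ⊕ E₂) (X₁ ⊕ X₂)}
    (h : Linked (glue rot₁ rot₂) p x y) : IsFirst x ↔ IsFirst y :=
  h IsFirst isFirst_glue fun _ _ => Iff.rfl

theorem linked_glue_inl {p : E₁ ⊕ E₂ → Prop} {x y : HalfEdge E₁ X₁} :
    Linked (glue rot₁ rot₂) p (glueEquiv _ _ _ _ (Sum.inl x)) (glueEquiv _ _ _ _ (Sum.inl y)) ↔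
      Linked rot₁ (fun e => p (Sum.inl e)) x y := by
  constructor
  · intro h f h1 h2
    have := h (fun z => Sum.elim f (fun _ => False) ((glueEquiv _ _ _ _).symm z)) ?_ ?_
    · simpa using this
    · rw [glueEquiv_forall]
      simp only [glue_inl, glue_inr, Equiv.symm_apply_apply, Sum.elim_inl, Sum.elim_inr]
      exact ⟨h1, fun _ => trivial⟩
    · rintro (e | e) he
      · simpa [← glueEquiv_inl_inl] using h2 e he
      · simp [← glueEquiv_inr_inl]
  · intro h f h1 h2
    refine h (fun z => f (glueEquiv _ _ _ _ (Sum.inl z))) (fun z => ?_) fun e he => h2 _ he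
    rw [← glue_inl (rot₂ := rot₂), h1]

theorem sameCycle_glue_inl {x y : HalfEdge E₁ X₁} :
    SameCycle (glue rot₁ rot₂) (glueEquiv _ _ _ _ (Sum.inl x)) (glueEquiv _ _ _ _ (Sum.inl y)) ↔
      SameCycle rot₁ x y := by
  rw [← linked_false (p := fun _ => False) fun _ => id, linked_glue_inl, linked_false fun _ => id]

/-- A map is the disjoint union of a connected component and of the rest. -/
theorem exists_glue_iff [Finite E₁] [Finite E₂] [Finite X₁] [Finite X₂] (x₀ : X₁)
    (rot : Perm (HalfEdge (E₁ ⊕ E₂) (X₁ ⊕ X₂))) :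
    (∀ h, Linked rot (fun _ => True) (Sum.inr (Sum.inl x₀)) h ↔ IsFirst h) ↔
      ∃ rot₁ rot₂, Conn rot₁ ∧ rot = glue rot₁ rot₂ := by
  constructor
  · intro h
    have hF : ∀ z, IsFirst (rot z) ↔ IsFirst z := fun z => by rw [← h, ← h, Linked.iff_rot]
    set σ := (glueEquiv E₁ E₂ X₁ X₂).symm.permCongr rot with hσ
    have hmem : σ ∈ (Perm.sumCongrHom (HalfEdge E₁ X₁) (HalfEdge E₂ X₂)).range := by
      -- The component of `x₀` is stable under `rot`, so `rot` acts separately on the two parts.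
      refine Perm.mem_sumCongrHom_range_of_perm_mapsTo_inl ?_
      rintro _ ⟨x, rfl⟩
      rw [hσ, Equiv.permCongr_apply, Equiv.symm_symm]
      have := (hF _).2 (isFirst_inl (E₂ := E₂) (X₂ := X₂) x)
      rcases hz : (glueEquiv E₁ E₂ X₁ X₂).symm (rot (glueEquiv E₁ E₂ X₁ X₂ (Sum.inl x))) with y | y
      · exact ⟨y, rfl⟩
      · rw [Equiv.symm_apply_eq] at hz
        rw [hz] at this
        exact absurd this (not_isFirst_inr y)
    obtain ⟨⟨rot₁, rot₂⟩, hr⟩ := hmem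
    have hrot : rot = glue rot₁ rot₂ := by
      rw [glue]
      change Perm.sumCongr rot₁ rot₂ = σ at hr
      rw [hr, hσ]
      ext z
      simp [Equiv.permCongr_apply]
    refine ⟨rot₁, rot₂, fun x y => ?_, hrot⟩
    have h1 : ∀ z, Linked rot₁ (fun _ => True) (Sum.inr x₀) z := by
      intro z
      have := (h _).2 (isFirst_inl (E₂ := E₂) (X₂ := X₂) z)
      rw [hrot, ← glueEquiv_inl_inr] at this
      exact linked_glue_inl.1 this
    exact (Linked _ _).trans ((Linked _ _).symm (h1 x)) (h1 y)
  · rintro ⟨rot₁, rot₂, hc, rfl⟩ h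
    constructor
    · exact fun h' => (IsFirst.iff_of_linked h').1 (isFirst_inl (Sum.inr x₀))
    · revert h
      rw [glueEquiv_forall]
      refine ⟨fun x _ => ?_, fun x hx => absurd hx (not_isFirst_inr x)⟩
      rw [← glueEquiv_inl_inr]
      exact linked_glue_inl.2 (hc _ _)

theorem numIndices_glue {D N : ℕ} (c₁ : E₁ → Fin D) (c₂ : E₂ → Fin D) (a₁ b₁ : X₁ → Idx D N)
    (a₂ b₂ : X₂ → Idx D N) :
    numIndices (glue rot₁ rot₂) (Sum.elim c₁ c₂) (Sum.elim a₁ a₂) (Sum.elim b₁ b₂) =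
      numIndices rot₁ c₁ a₁ b₁ * numIndices rot₂ c₂ a₂ b₂ := by
  rw [numIndices, numIndices, numIndices, ← Nat.card_prod]
  refine Nat.card_congr (Equiv.trans (Equiv.subtypeEquiv (((Equiv.arrowCongr
    (Equiv.sumProdDistrib E₁ E₂ Bool) (Equiv.refl (Idx D N))).trans
      (Equiv.sumArrowEquivProdArrow _ _ _))) (q := fun x =>
        (∀ h, Sum.elim x.1 a₁ h = Sum.elim (mix c₁ x.1) b₁ (rot₁ h)) ∧
        ∀ h, Sum.elim x.2 a₂ h = Sum.elim (mix c₂ x.2) b₂ (rot₂ h)) fun x => ?_)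
      (Equiv.subtypeProdEquivProd
        (p := fun x => ∀ h, Sum.elim x a₁ h = Sum.elim (mix c₁ x) b₁ (rot₁ h))
        (q := fun x => ∀ h, Sum.elim x a₂ h = Sum.elim (mix c₂ x) b₂ (rot₂ h))))
  rw [glueEquiv_forall]
  simp only [glue_inl, glue_inr]
  refine and_congr (forall_congr' fun h => ?_) (forall_congr' fun h => ?_)
  · generalize rot₁ h = h'
    rcases h with ⟨e, s⟩ | i <;> rcases h' with ⟨e', s'⟩ | i' <;> rfl
  · generalize rot₂ h = h'
    rcases h with ⟨e, s⟩ | i <;> rcases h' with ⟨e', s'⟩ | i' <;> rfl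

end Glue

end QuarticTensor

namespace QuarticTensor

open Equiv Equiv.Perm

/-! ## Generating series of maps -/

/-- A statistic on the maps with cilia `X` and edges colored by `Fin D`. -/
abbrev MapStat (X : Type) (D : ℕ) : Type 1 :=
  (E : Type) → Perm (HalfEdge E X) → (E → Fin D) → ℕ

section Total

variable {X : Type} [Fintype X] [DecidableEq X] {D : ℕ}

/-- The sum of a statistic over all maps with edges `E`. -/
def MapStat.total (F : MapStat X D) (E : Type) [Fintype E] [DecidableEq E] : ℕ :=
  ∑ col : E → Fin D, ∑ rot : Perm (HalfEdge E X), F E rot col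

/-- The statistic does not depend on the labels of the edges. -/
def MapStat.Invariant (F : MapStat X D) : Prop :=
  ∀ ⦃E E' : Type⦄ (e : E ≃ E') (rot : Perm (HalfEdge E X)) (col : E → Fin D),
    F E' ((relabelEquiv e (Equiv.refl X)).permCongr rot) (col ∘ e.symm) = F E rot col

/-- The exponential generating series of a statistic, with a weight `r` per edge. -/
noncomputable def MapStat.egf (r : ℂ) (F : MapStat X D) : PowerSeries ℂ :=
  PowerSeries.mk fun n => r ^ n * (n.factorial : ℂ)⁻¹ * F.total (Fin n)

/-- A sum over subsets that depends only on cardinalities is a binomial convolution; the weights `r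
^ n` are multiplicative. -/
theorem egf_mul {A B C : ℕ → ℂ} {r : ℂ}
    (h : ∀ n, C n = ∑ S : Finset (Fin n), A S.card * B (n - S.card)) :
    (PowerSeries.mk fun n => r ^ n * (n.factorial : ℂ)⁻¹ * C n) =
      (PowerSeries.mk fun n => r ^ n * (n.factorial : ℂ)⁻¹ * A n) *
        PowerSeries.mk fun n => r ^ n * (n.factorial : ℂ)⁻¹ * B n := by
  ext n
  rw [PowerSeries.coeff_mk, PowerSeries.coeff_mul, h n]
  have h1 : ∑ S : Finset (Fin n), A S.card * B (n - S.card) =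
      ∑ k ∈ Finset.range (n + 1), n.choose k • (A k * B (n - k)) := by
    rw [← Finset.powerset_univ, Finset.sum_powerset_apply_card (fun k => A k * B (n - k)),
      Finset.card_univ, Fintype.card_fin]
  rw [h1, Finset.Nat.sum_antidiagonal_eq_sum_range_succ_mk, Finset.mul_sum]
  refine Finset.sum_congr rfl fun k hk => ?_
  have hk' : k ≤ n := Nat.lt_succ_iff.1 (Finset.mem_range.1 hk)
  simp only [PowerSeries.coeff_mk]
  have h2 : (n.choose k : ℂ) = n.factorial / (k.factorial * (n - k).factorial) :=
    Nat.cast_choose ℂ hk'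
  have h3 : r ^ n = r ^ k * r ^ (n - k) := by rw [← pow_add, Nat.add_sub_cancel' hk']
  have h4 : (n.factorial : ℂ) ≠ 0 := by exact_mod_cast n.factorial_ne_zero
  rw [nsmul_eq_mul, h2, h3]
  field_simp

end Total

section Component

variable {X₁ X₂ : Type} [Fintype X₁] [DecidableEq X₁] [Fintype X₂] [DecidableEq X₂] {D : ℕ}

/-- The component of the cilium `x₀` contains exactly the cilia of the first kind. -/
def CiliaComponent (x₀ : X₁) {E : Type} (rot : Perm (HalfEdge E (X₁ ⊕ X₂))) : Prop :=
  ∀ i : X₁ ⊕ X₂, Linked rot (fun _ => True) (Sum.inr (Sum.inl x₀)) (Sum.inr i) ↔ i.isLeft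

/-- By `exists_glue_iff`, the maps in which the component of `x₀` is exactly the first part
correspond to pairs whose first map is connected. The hypothesis `h₁` discards the other pairs. -/
theorem sum_glue {E₁ E₂ : Type} [Fintype E₁] [DecidableEq E₁] [Fintype E₂] [DecidableEq E₂]
    (x₀ : X₁) (f : Perm (HalfEdge (E₁ ⊕ E₂) (X₁ ⊕ X₂)) → ℕ)
    (f₁ : Perm (HalfEdge E₁ X₁) → ℕ) (f₂ : Perm (HalfEdge E₂ X₂) → ℕ)
    (h₁ : ∀ rot₁, ¬ Conn rot₁ → f₁ rot₁ = 0)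
    (h : ∀ rot₁ rot₂, Conn rot₁ → f (glue rot₁ rot₂) = f₁ rot₁ * f₂ rot₂)
    [DecidablePred fun rot : Perm (HalfEdge (E₁ ⊕ E₂) (X₁ ⊕ X₂)) =>
      ∀ h, Linked rot (fun _ => True) (Sum.inr (Sum.inl x₀)) h ↔ IsFirst h] :
    (∑ rot, if ∀ h, Linked rot (fun _ => True) (Sum.inr (Sum.inl x₀)) h ↔ IsFirst h then f rot
      else 0) = (∑ rot₁, f₁ rot₁) * ∑ rot₂, f₂ rot₂ := by
  classical
  rw [Finset.sum_mul_sum, ← Finset.sum_product', ← Finset.sum_filter]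
  symm
  rw [← Finset.sum_filter_of_ne (p := fun q : Perm (HalfEdge E₁ X₁) × Perm (HalfEdge E₂ X₂) =>
    Conn q.1)]
  · refine Finset.sum_bij (fun q _ => glue q.1 q.2) ?_ ?_ ?_ ?_
    · intro q hq
      exact Finset.mem_filter.2 ⟨Finset.mem_univ _,
        (exists_glue_iff x₀ _).2 ⟨_, _, (Finset.mem_filter.1 hq).2, rfl⟩⟩
    · rintro ⟨a, b⟩ - ⟨a', b'⟩ - hab
      obtain ⟨rfl, rfl⟩ := glue_injective hab
      rfl
    · intro rot hrot
      obtain ⟨rot₁, rot₂, hc, rfl⟩ := (exists_glue_iff x₀ _).1 (Finset.mem_filter.1 hrot).2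
      exact ⟨(rot₁, rot₂), by simpa using hc, rfl⟩
    · intro q hq
      exact (h _ _ (Finset.mem_filter.1 hq).2).symm
  · intro q _ hq
    by_contra hc
    exact hq (by rw [h₁ _ hc, zero_mul])

theorem exists_equiv_sum {n : ℕ} (S : Finset (Fin n)) :
    ∃ e : Fin n ≃ Fin S.card ⊕ Fin (n - S.card), ∀ i, (e i).isLeft ↔ i ∈ S := by
  classical
  have h2 : Fintype.card {i : Fin n // i ∉ S} = n - S.card := by
    rw [Fintype.card_subtype_compl, Fintype.card_fin, Fintype.card_coe]
  refine ⟨(Equiv.sumCompl (· ∈ S)).symm.trans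
    (Equiv.sumCongr S.equivFin (Fintype.equivFinOfCardEq h2)), fun i => ?_⟩
  by_cases hi : i ∈ S
  · simp [Equiv.sumCompl_symm_apply_of_pos, hi]
  · simp [Equiv.sumCompl_symm_apply_of_neg, hi]

open Classical in
/-- Decomposition of maps into the component of a cilium and the rest. -/
theorem egf_component (r : ℂ) (x₀ : X₁) (F : MapStat (X₁ ⊕ X₂) D) (F₁ : MapStat X₁ D)
    (F₂ : MapStat X₂ D) (hF : F.Invariant)
    (h₁ : ∀ (E : Type) rot col, ¬ Conn rot → F₁ E rot col = 0)
    (h : ∀ (E₁ E₂ : Type) [Finite E₁] [Finite E₂] rot₁ rot₂ c₁ c₂, Conn rot₁ →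
      F (E₁ ⊕ E₂) (glue rot₁ rot₂) (Sum.elim c₁ c₂) = F₁ E₁ rot₁ c₁ * F₂ E₂ rot₂ c₂) :
    MapStat.egf r (fun E rot col => if CiliaComponent x₀ rot then F E rot col else 0) =
      MapStat.egf r F₁ * MapStat.egf r F₂ := by
  refine egf_mul fun n => ?_
  norm_cast
  let In (S : Finset (Fin n)) (z : HalfEdge (Fin n) (X₁ ⊕ X₂)) : Prop :=
    Sum.elim (fun x : Fin n × Bool => x.1 ∈ S) (fun i => (i.isLeft : Prop)) z
  -- The maps are sorted by the set `S` of the edges in the component of `x₀`; exactly one `S` fits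
  -- a given map.
  have key : ∀ rot : Perm (HalfEdge (Fin n) (X₁ ⊕ X₂)), ∀ m : ℕ,
      (if CiliaComponent x₀ rot then m else 0) =
      ∑ S : Finset (Fin n), if ∀ z, Linked rot (fun _ => True) (Sum.inr (Sum.inl x₀)) z ↔ In S z
        then m else 0 := by
    intro rot m
    by_cases hc : CiliaComponent x₀ rot
    · rw [if_pos hc, Finset.sum_eq_single (Finset.univ.filter fun e =>
        Linked rot (fun _ => True) (Sum.inr (Sum.inl x₀)) (Sum.inl (e, true))), if_pos]
      · rintro (⟨e, s⟩ | i)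
        · simp only [In, Sum.elim_inl, Finset.mem_filter, Finset.mem_univ, true_and]
          exact Linked.iff_edge trivial _ _
        · exact hc i
      · intro S _ hS
        rw [if_neg]
        intro h'
        refine hS ?_
        ext e
        simpa [In] using (h' (Sum.inl (e, true))).symm
      · simp
    · rw [if_neg hc, Finset.sum_eq_zero]
      intro S _
      rw [if_neg]
      exact fun h' => hc fun i => h' (Sum.inr i)
  have hswap : MapStat.total (fun E rot col => if CiliaComponent x₀ rot then F E rot col else 0)
      (Fin n) = ∑ S : Finset (Fin n), ∑ col : Fin n → Fin D,
        ∑ rot : Perm (HalfEdge (Fin n) (X₁ ⊕ X₂)),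
        if ∀ z, Linked rot (fun _ => True) (Sum.inr (Sum.inl x₀)) z ↔ In S z
          then F _ rot col else 0 := by
    symm
    rw [MapStat.total, Finset.sum_comm]
    refine Finset.sum_congr rfl fun col _ => ?_
    rw [Finset.sum_comm]
    exact Finset.sum_congr rfl fun rot _ => (key rot _).symm
  rw [hswap]
  refine Finset.sum_congr rfl fun S _ => ?_
  obtain ⟨e, he⟩ := exists_equiv_sum S
  have h2 : (∑ col : Fin n → Fin D, ∑ rot : Perm (HalfEdge (Fin n) (X₁ ⊕ X₂)),
        if ∀ z, Linked rot (fun _ => True) (Sum.inr (Sum.inl x₀)) z ↔ In S z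
          then F _ rot col else 0) =
      ∑ col : Fin S.card ⊕ Fin (n - S.card) → Fin D,
        ∑ rot : Perm (HalfEdge (Fin S.card ⊕ Fin (n - S.card)) (X₁ ⊕ X₂)),
          if ∀ z, Linked rot (fun _ => True) (Sum.inr (Sum.inl x₀)) z ↔ IsFirst z
            then F _ rot col else 0 := by
    refine Fintype.sum_equiv (Equiv.arrowCongr e (Equiv.refl _)) _ _ fun col => ?_
    refine Fintype.sum_equiv (relabelEquiv e (Equiv.refl _)).permCongr _ _ fun rot => ?_
    refine if_congr ?_ (hF e rot col).symm rfl
    rw [← (relabelEquiv e (Equiv.refl (X₁ ⊕ X₂))).forall_congr_right]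
    refine forall_congr' fun z => ?_
    have h3 := linked_relabel e (Equiv.refl (X₁ ⊕ X₂)) rot (p := fun _ => True)
      (p' := fun _ => True) (fun _ => Iff.rfl) (Sum.inr (Sum.inl x₀)) z
    rw [relabelEquiv_inr, Equiv.refl_apply] at h3
    rw [h3]
    refine iff_congr Iff.rfl ?_
    rcases z with ⟨x, s⟩ | i
    · exact (he x).symm
    · rfl
  rw [h2, MapStat.total, MapStat.total, 
    ← (Equiv.sumArrowEquivProdArrow (Fin S.card) (Fin (n - S.card)) (Fin D)).symm.sum_comp,
    Fintype.sum_prod_type, Finset.sum_mul_sum]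
  refine Finset.sum_congr rfl fun c₁ _ => Finset.sum_congr rfl fun c₂ _ => ?_
  exact sum_glue x₀ (fun rot => F _ rot (Sum.elim c₁ c₂)) _ _ (fun rot₁ => h₁ _ rot₁ c₁)
    fun rot₁ rot₂ hc => h _ _ rot₁ rot₂ c₁ c₂ hc

end Component

end QuarticTensor

namespace QuarticTensor

open Equiv Equiv.Perm

/-! ## The 4-point cumulant as a sum over connected maps -/

section Stats

variable {X X' : Type} [Fintype X] [DecidableEq X] [Fintype X'] [DecidableEq X'] {D N : ℕ}

theorem egf_congr_cilia (r : ℂ) (g : X ≃ X') {F : MapStat X D} {F' : MapStat X' D}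
    (h : ∀ (E : Type) [Finite E] rot col,
      F' E ((relabelEquiv (Equiv.refl E) g).permCongr rot) col = F E rot col) :
    F.egf r = F'.egf r := by
  ext n
  rw [MapStat.egf, MapStat.egf, PowerSeries.coeff_mk, PowerSeries.coeff_mk]
  congr 2
  exact Finset.sum_congr rfl fun col _ =>
    Fintype.sum_equiv (relabelEquiv (Equiv.refl _) g).permCongr _ _ fun rot => (h _ rot col).symm

theorem egf_congr (r : ℂ) {F F' : MapStat X D}
    (h : ∀ (E : Type) [Finite E] rot col, F E rot col = F' E rot col) : F.egf r = F'.egf r := by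
  ext n
  rw [MapStat.egf, MapStat.egf, PowerSeries.coeff_mk, PowerSeries.coeff_mk]
  congr 2
  exact Finset.sum_congr rfl fun col _ => Finset.sum_congr rfl fun rot _ => h _ _ _

theorem egf_add (r : ℂ) (F F' : MapStat X D) :
    MapStat.egf r (fun E rot col => F E rot col + F' E rot col) = F.egf r + F'.egf r := by
  ext n
  simp only [MapStat.egf, PowerSeries.coeff_mk, map_add, MapStat.total, Finset.sum_add_distrib,
    Nat.cast_add, mul_add]

/-- The number of index configurations, as a statistic. -/
noncomputable def indexStat (a b : X → Idx D N) : MapStat X D :=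
  fun _ rot col => numIndices rot col a b

open Classical in
/-- The restriction of `indexStat` to the connected maps. -/
noncomputable def connStat (a b : X → Idx D N) : MapStat X D :=
  fun _ rot col => if Conn rot then numIndices rot col a b else 0

open Classical in
/-- The restriction of `indexStat` to the connected maps with two cilia on different vertices. -/
noncomputable def connApartStat (a b : Fin 2 → Idx D N) : MapStat (Fin 2) D :=
  fun _ rot col => if Conn rot ∧ Apart rot then numIndices rot col a b else 0

open Classical in
/-- The restriction of `indexStat` to the maps with two cilia on different vertices. -/
noncomputable def apartStat (a b : Fin 2 → Idx D N) : MapStat (Fin 2) D :=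
  fun _ rot col => if Apart rot then numIndices rot col a b else 0

omit [Fintype X] [DecidableEq X] in
theorem indexStat_invariant (a b : X → Idx D N) : (indexStat a b).Invariant :=
  fun _ _ e rot col => numIndices_relabel e (Equiv.refl X) rot col a b

theorem unnormalizedMoment_monomial (hN : 1 ≤ N) (a b : X → Idx D N) :
    unnormalizedMoment D N (monomial a b) = (((N : ℂ) ^ (D - 1))⁻¹ ^ Fintype.card X) •
      (indexStat a b).egf (2 * (N : ℂ) ^ (D - 1))⁻¹ := by
  ext n
  rw [coeff_unnormalizedMoment hN, map_smul, MapStat.egf, PowerSeries.coeff_mk, smul_eq_mul]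
  have : moment D (Fin n) X a b = (indexStat a b).total (Fin n) := rfl
  rw [this]
  ring

end Stats

/-! ### Extraction of the connected maps. -/

section Cumulant

variable {D N : ℕ} (r : ℂ)

/-- The generating series of the maps without cilia. -/
noncomputable def vacuumEgf (D N : ℕ) (r : ℂ) : PowerSeries ℂ :=
  (indexStat (X := Empty) (D := D) (N := N) Empty.elim Empty.elim).egf r

/-- The generating series of the connected maps with one cilium. -/
noncomputable def connEgf (a b : Idx D N) : PowerSeries ℂ :=
  (connStat (X := Unit) (fun _ => a) (fun _ => b)).egf r

theorem constantCoeff_vacuumEgf : PowerSeries.constantCoeff (vacuumEgf D N r) = 1 := by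
  have h : (indexStat (X := Empty) (D := D) (N := N) Empty.elim Empty.elim).total (Fin 0) = 1 := by
    rw [MapStat.total, Fintype.sum_unique, Fintype.sum_unique]
    refine Nat.card_eq_one_iff_unique.2 ⟨inferInstance, ⟨⟨fun z => z.1.elim0, ?_⟩⟩⟩
    rintro (⟨i, _⟩ | i)
    · exact i.elim0
    · exact i.elim
  rw [← PowerSeries.coeff_zero_eq_constantCoeff_apply, vacuumEgf, MapStat.egf, PowerSeries.coeff_mk,
    h]
  simp

theorem egf_one_cilium (a b : Idx D N) :
    (indexStat (X := Unit) (fun _ => a) (fun _ => b)).egf r =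
      connEgf r a b * vacuumEgf D N r := by
  classical
  rw [connEgf, vacuumEgf, ← egf_component r () (indexStat (X := Unit ⊕ Empty)
    (Sum.elim (fun _ => a) Empty.elim) (Sum.elim (fun _ => b) Empty.elim)) _ _
    (indexStat_invariant _ _)]
  · refine egf_congr_cilia r (Equiv.sumEmpty Unit Empty).symm fun E _ rot col => ?_
    rw [if_pos, indexStat, indexStat, ← numIndices_relabel (Equiv.refl E)
      (Equiv.sumEmpty Unit Empty).symm rot col]
    · congr 1 <;> funext i <;> rcases i with i | i <;> first | rfl | exact i.elim
    · rintro (i | i)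
      · exact iff_of_true ((Linked _ _).refl _) rfl
      · exact i.elim
  · intro E rot col hc
    rw [connStat, if_neg hc]
  · intro E₁ E₂ _ _ rot₁ rot₂ c₁ c₂ hc
    rw [connStat, if_pos hc, indexStat, indexStat, numIndices_glue]

theorem numIndices_swap_cilia {E : Type} [DecidableEq E] (rot : Perm (HalfEdge E (Fin 2)))
    (col : E → Fin D) (a b : Fin 2 → Idx D N) :
    numIndices (swap (Sum.inr 0) (Sum.inr 1) * rot) col a (b ∘ swap 0 1) =
      numIndices rot col a b := by
  have h : ∀ (x : E × Bool → Idx D N) (z : HalfEdge E (Fin 2)),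
      Sum.elim x (b ∘ swap 0 1) (swap (Sum.inr 0) (Sum.inr 1) z) = Sum.elim x b z := by
    rintro x (z | i)
    · rw [swap_apply_of_ne_of_ne] <;> simp
    · fin_cases i <;> simp
  simp only [numIndices, Perm.mul_apply, h]

/-- Composing with the transposition of the cilia is a bijection from maps with cilia on one vertex
to maps with cilia apart. By `numIndices_swap_cilia` it preserves the index count provided the two
conjugate indices are exchanged. -/
theorem egf_two_cilia_apart (a b : Fin 2 → Idx D N) :
    (indexStat a b).egf r = (apartStat a b).egf r + (apartStat a (b ∘ swap 0 1)).egf r := by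
  classical
  ext n
  rw [map_add, MapStat.egf, MapStat.egf, MapStat.egf, PowerSeries.coeff_mk, PowerSeries.coeff_mk,
    PowerSeries.coeff_mk, ← mul_add]
  congr 1
  norm_cast
  rw [MapStat.total, MapStat.total, MapStat.total, ← Finset.sum_add_distrib]
  refine Finset.sum_congr rfl fun col _ => ?_
  have h : ∑ rot, apartStat a (b ∘ swap 0 1) (Fin n) rot col =
      ∑ rot, if Apart rot then 0 else indexStat a b (Fin n) rot col := by
    rw [← Equiv.sum_comp (Equiv.mulLeft (swap (Sum.inr 0) (Sum.inr 1)))]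
    refine Finset.sum_congr rfl fun rot _ => ?_
    rw [Equiv.coe_mulLeft, apartStat, numIndices_swap_cilia]
    by_cases hr : Apart rot
    · rw [if_pos hr, if_neg]
      exact fun h' => h' (sameCycle_swap_mul hr)
    · rw [if_neg hr, if_pos]
      · rfl
      · exact not_sameCycle_swap_mul (by simp) (not_not.1 hr)
  rw [h, ← Finset.sum_add_distrib]
  refine Finset.sum_congr rfl fun rot _ => ?_
  rw [apartStat, indexStat]
  split_ifs <;> simp

/-- Either the component of the first cilium contains the second one, or the two cilia have separate
components. The second case is the product that the 2-point cumulants cancel, and the components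
without cilia give the partition function in both. -/
theorem egf_apart_component (a b : Fin 2 → Idx D N) :
    (apartStat a b).egf r = (connApartStat a b).egf r * vacuumEgf D N r +
      connEgf r (a 0) (b 0) * (connEgf r (a 1) (b 1) * vacuumEgf D N r) := by
  classical
  have h1 : MapStat.egf r (fun E rot col => if Linked rot (fun _ => True) (Sum.inr 0) (Sum.inr 1)
      then apartStat a b E rot col else 0) = (connApartStat a b).egf r * vacuumEgf D N r := by
    rw [vacuumEgf, ← egf_component r (0 : Fin 2) (fun E rot col => if SameCycle rot
      (Sum.inr (Sum.inl 0)) (Sum.inr (Sum.inl 1)) then 0 else indexStat (X := Fin 2 ⊕ Empty)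
        (Sum.elim a Empty.elim) (Sum.elim b Empty.elim) E rot col)]
    · refine egf_congr_cilia r (Equiv.sumEmpty (Fin 2) Empty).symm fun E _ rot col => ?_
      have hl := linked_relabel (Equiv.refl E) (Equiv.sumEmpty (Fin 2) Empty).symm rot
        (p := fun _ => True) (p' := fun _ => True) (fun _ => Iff.rfl) (Sum.inr 0) (Sum.inr 1)
      have hs := sameCycle_permCongr (relabelEquiv (Equiv.refl E)
        (Equiv.sumEmpty (Fin 2) Empty).symm) rot (Sum.inr 0) (Sum.inr 1)
      simp only [relabelEquiv_inr, Equiv.sumEmpty_symm_apply] at hl hs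
      have hn := numIndices_relabel (Equiv.refl E) (Equiv.sumEmpty (Fin 2) Empty).symm rot col a b
      have ha : ∀ a : Fin 2 → Idx D N, a ∘ (Equiv.sumEmpty (Fin 2) Empty).symm.symm =
          Sum.elim a Empty.elim := by
        intro a
        funext i
        rcases i with i | i
        · rfl
        · exact i.elim
      rw [ha, ha] at hn
      change numIndices _ col _ _ = _ at hn
      refine if_congr ?_ ?_ rfl
      · rw [← hl]
        constructor
        · exact fun h => (h (Sum.inl 1)).2 rfl
        · rintro h (i | i)
          · fin_cases i
            · exact iff_of_true ((Linked _ _).refl _) rfl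
            · exact iff_of_true h rfl
          · exact i.elim
      · rw [apartStat, indexStat, hn, Apart, ← hs]
        split_ifs <;> rfl
    · intro E E' e rot col
      have hs := sameCycle_permCongr (relabelEquiv e (Equiv.refl (Fin 2 ⊕ Empty))) rot
        (Sum.inr (Sum.inl 0)) (Sum.inr (Sum.inl 1))
      simp only [relabelEquiv_inr, Equiv.refl_apply] at hs
      exact if_congr hs rfl (indexStat_invariant _ _ e rot col)
    · intro E rot col hc
      rw [connApartStat, if_neg fun h => hc h.1]
    · intro E₁ E₂ _ _ rot₁ rot₂ c₁ c₂ hc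
      rw [connApartStat, indexStat, indexStat, numIndices_glue, ← glueEquiv_inl_inr,
        ← glueEquiv_inl_inr, sameCycle_glue_inl, Apart]
      by_cases hs : SameCycle rot₁ (Sum.inr 0) (Sum.inr 1) <;> simp [hs, hc]
  have h2 : MapStat.egf r (fun E rot col => if Linked rot (fun _ => True) (Sum.inr 0) (Sum.inr 1)
      then 0 else apartStat a b E rot col) =
        connEgf r (a 0) (b 0) * (connEgf r (a 1) (b 1) * vacuumEgf D N r) := by
    rw [← egf_one_cilium, connEgf, ← egf_component r () (indexStat (X := Unit ⊕ Unit)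
      (Sum.elim (fun _ => a 0) fun _ => a 1) (Sum.elim (fun _ => b 0) fun _ => b 1)) _ _
      (indexStat_invariant _ _)]
    · let g : Fin 2 ≃ Unit ⊕ Unit :=
        { toFun := fun i => if i = 0 then Sum.inl () else Sum.inr ()
          invFun := Sum.elim (fun _ => 0) fun _ => 1
          left_inv := fun i => by fin_cases i <;> rfl
          right_inv := by rintro (⟨⟩ | ⟨⟩) <;> rfl }
      refine egf_congr_cilia r g fun E _ rot col => ?_
      have hl := linked_relabel (Equiv.refl E) g rot
        (p := fun _ => True) (p' := fun _ => True) (fun _ => Iff.rfl) (Sum.inr 0) (Sum.inr 1)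
      have hn := numIndices_relabel (Equiv.refl E) g rot col a b
      have ha : ∀ a : Fin 2 → Idx D N, a ∘ g.symm = Sum.elim (fun _ => a 0) fun _ => a 1 := by
        intro a
        funext i
        rcases i with i | i <;> rfl
      rw [ha, ha] at hn
      change numIndices _ col _ _ = _ at hn
      by_cases hlink : Linked rot (fun _ => True) (Sum.inr 0) (Sum.inr 1)
      · rw [if_pos hlink, if_neg]
        exact fun h => by simpa using (h (Sum.inr ())).1 (hl.2 hlink)
      · rw [if_neg hlink, if_pos, indexStat, hn, apartStat, if_pos]
        · exact fun h => hlink (linked_of_sameCycle h)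
        · rintro (i | i)
          · exact iff_of_true ((Linked _ _).refl _) rfl
          · exact iff_of_false (fun h => hlink (hl.1 h)) (by simp)
    · intro E rot col hc
      rw [connStat, if_neg hc]
    · intro E₁ E₂ _ _ rot₁ rot₂ c₁ c₂ hc
      rw [connStat, if_pos hc, indexStat, indexStat, numIndices_glue]
  rw [← h1, ← h2, ← egf_add]
  refine egf_congr r fun E _ rot col => ?_
  by_cases hl : Linked rot (fun _ => True) (Sum.inr 0) (Sum.inr 1)
  · rw [if_pos hl, if_pos hl, add_zero]
  · rw [if_neg hl, if_neg hl, zero_add]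

theorem unnormalizedMoment_one (hN : 1 ≤ N) : (unnormalizedMoment D N fun _ => 1) =
    vacuumEgf D N (2 * (N : ℂ) ^ (D - 1))⁻¹ := by
  have h := unnormalizedMoment_monomial (D := D) hN (X := Empty) Empty.elim Empty.elim
  rw [Fintype.card_empty, pow_zero, one_smul] at h
  exact h

theorem vacuumEgf_mul_inv : vacuumEgf D N r * (vacuumEgf D N r)⁻¹ = 1 :=
  PowerSeries.mul_inv_cancel _ (by rw [constantCoeff_vacuumEgf]; exact one_ne_zero)

theorem cumulant2_eq (hN : 1 ≤ N) (a b : Idx D N) :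
    cumulant2 D N a b = ((N : ℂ) ^ (D - 1))⁻¹ • connEgf (2 * (N : ℂ) ^ (D - 1))⁻¹ a b := by
  have h := unnormalizedMoment_monomial (D := D) hN (X := Unit) (fun _ => a) (fun _ => b)
  have h1 : monomial (I := Unit) (fun _ => a) (fun _ => b) =
      fun T : Tensor D N => T a * (starRingEnd ℂ) (T b) := by
    funext T; simp [monomial]
  rw [h1, Fintype.card_unit, pow_one] at h
  rw [cumulant2, expectation, h, unnormalizedMoment_one hN, egf_one_cilium, smul_mul_assoc,
    mul_assoc, vacuumEgf_mul_inv, mul_one]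

/-- The 4-point cumulant is a sum over connected maps with two cilia on different vertices. -/
theorem cumulant4_eq (hN : 1 ≤ N) (a b : Fin 2 → Idx D N) :
    cumulant4 D N (a 0) (a 1) (b 0) (b 1) = (((N : ℂ) ^ (D - 1))⁻¹ ^ 2) •
      ((connApartStat a b).egf (2 * (N : ℂ) ^ (D - 1))⁻¹ +
        (connApartStat a (b ∘ swap 0 1)).egf (2 * (N : ℂ) ^ (D - 1))⁻¹) := by
  have h := unnormalizedMoment_monomial (D := D) hN a b
  have h1 : monomial a b = fun T : Tensor D N =>
      T (a 0) * T (a 1) * (starRingEnd ℂ) (T (b 0)) * (starRingEnd ℂ) (T (b 1)) := by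
    funext T
    simp only [monomial, Fin.prod_univ_two]
    ring
  rw [h1, Fintype.card_fin, egf_two_cilia_apart, egf_apart_component, egf_apart_component] at h
  rw [cumulant4, expectation, h, unnormalizedMoment_one hN, cumulant2_eq hN, cumulant2_eq hN,
    cumulant2_eq hN, cumulant2_eq hN]
  set r := (2 * (N : ℂ) ^ (D - 1))⁻¹
  have hz := vacuumEgf_mul_inv (D := D) (N := N) r
  simp only [Function.comp_apply, swap_apply_left, swap_apply_right, PowerSeries.smul_eq_C_mul,
    map_pow]
  set c := PowerSeries.C (((N : ℂ) ^ (D - 1))⁻¹)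
  linear_combination (c ^ 2 * ((connApartStat a b).egf r + (connApartStat a (b ∘ swap 0 1)).egf r +
    connEgf r (a 0) (b 0) * connEgf r (a 1) (b 1) +
    connEgf r (a 0) (b 1) * connEgf r (a 1) (b 0))) * hz

end Cumulant

end QuarticTensor

namespace QuarticTensor

open Equiv Equiv.Perm

/-! ## The number of index configurations of a map with two cilia -/

theorem card_functions_two_values {Q : Type*} [Finite Q] {N : ℕ} {q₀ q₁ : Q} (hq : q₀ ≠ q₁)
    (i₀ i₁ : Fin N) : Nat.card {v : Q → Fin N // v q₀ = i₀ ∧ v q₁ = i₁} = N ^ (Nat.card Q - 2) := by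
  classical
  have := Fintype.ofFinite Q
  have h : ∀ v : Q → Fin N, (v q₀ = i₀ ∧ v q₁ = i₁) ↔ v ∈ Fintype.piFinset fun q =>
      if q = q₀ then {i₀} else if q = q₁ then {i₁} else Finset.univ := by
    intro v
    rw [Fintype.mem_piFinset]
    constructor
    · rintro ⟨h0, h1⟩ q
      split_ifs with h h'
      · simp [h, h0]
      · simp [h', h1]
      · exact Finset.mem_univ _
    · intro h
      have h0 := h q₀
      have h1 := h q₁
      simp only [if_true, if_neg hq.symm, Finset.mem_singleton] at h0 h1
      exact ⟨h0, h1⟩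
  rw [Nat.card_congr (Equiv.subtypeEquivRight h), Nat.card_eq_fintype_card, Fintype.card_coe,
    Fintype.card_piFinset]
  have h2 : ∀ q, (if q = q₀ then {i₀} else if q = q₁ then {i₁} else (Finset.univ :
      Finset (Fin N))).card = if q ∈ ({q₀, q₁} : Finset Q) then 1 else N := by
    intro q
    simp only [Finset.mem_insert, Finset.mem_singleton]
    split_ifs <;> simp_all
  simp only [h2]
  rw [Finset.prod_ite, Finset.prod_const_one, one_mul, Finset.prod_const,
    Finset.filter_not, Finset.filter_mem_eq_inter, Finset.univ_inter,
    ← Finset.compl_eq_univ_sdiff, Finset.card_compl, Finset.card_pair hq, Nat.card_eq_fintype_card]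

section Faces

variable {Y : Type} [Finite Y] {N : ℕ} {φ : Perm (Y ⊕ Fin 2)} {α β : Fin 2 → Fin N}

/-- Going backwards from a cilium, the value `β i` is carried along the cycle until a cilium is met;
since the cycles of the two cilia differ, that cilium is the same one and its value is `α i`. -/
theorem eq_of_constraint (h : ¬ SameCycle φ (Sum.inr 0) (Sum.inr 1)) {u : Y → Fin N}
    (hu : ∀ z, Sum.elim u α z = Sum.elim u β (φ z)) : α = β := by
  funext i
  have key : ∀ k : ℕ, Sum.elim u α ((φ⁻¹ ^ (k + 1)) (Sum.inr i)) = β i := by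
    intro k
    induction k with
    | zero =>
      rw [hu]
      simp
    | succ k ih =>
      rw [hu, pow_succ', Perm.mul_apply, show ∀ w, φ (φ⁻¹ w) = w from fun w => by simp]
      rcases hz : (φ⁻¹ ^ (k + 1)) (Sum.inr i) with y | j
      · rw [hz] at ih
        exact ih
      · have hs : SameCycle φ (Sum.inr i) (Sum.inr j) :=
          sameCycle_inv.1 ⟨(k + 1 : ℕ), by rw [zpow_natCast, hz]⟩
        have : j = i := by
          fin_cases i <;> fin_cases j
          · rfl
          · exact absurd hs h
          · exact absurd hs.symm h
          · rfl
        rw [this]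
        rfl
  -- The exponent in `key` is `k + 1`, and the power `orderOf φ⁻¹` brings the walk back to its
  -- start.
  have := key (orderOf φ⁻¹ - 1)
  rw [Nat.sub_add_cancel (orderOf_pos _), pow_orderOf_eq_one] at this
  exact this

theorem card_constraint_of_not_sameCycle (h : ¬ SameCycle φ (Sum.inr 0) (Sum.inr 1)) :
    Nat.card {u : Y → Fin N // ∀ z, Sum.elim u α z = Sum.elim u β (φ z)} =
      if α = β then N ^ (cyc φ - 2) else 0 := by
  split_ifs with hαβ
  · subst hαβ
    have hq : Quotient.mk (SameCycle.setoid φ) (Sum.inr 0) ≠ Quotient.mk _ (Sum.inr 1) :=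
      fun h' => h (Quotient.exact h')
    rw [cyc, ← card_functions_two_values hq (α 0) (α 1)]
    refine Nat.card_congr
      { toFun := fun u => ⟨fun q => Quotient.liftOn' q (Sum.elim u.1 α) fun x y hxy => ?_, rfl, rfl⟩
        invFun := fun v => ⟨fun y => v.1 (Quotient.mk _ (Sum.inl y)), fun z => ?_⟩
        left_inv := fun u => rfl
        right_inv := fun v => ?_ }
    · exact (SameCycle.iff_of_invariant hxy
        (f := fun z => Sum.elim u.1 α x = Sum.elim u.1 α z) fun z => by rw [← u.2 z]).1 rfl
    · have hv : ∀ z, Sum.elim (fun y => v.1 (Quotient.mk _ (Sum.inl y))) α z =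
          v.1 (Quotient.mk _ z) := by
        rintro (y | i)
        · rfl
        · fin_cases i
          · exact v.2.1.symm
          · exact v.2.2.symm
      rw [hv, hv]
      refine congrArg v.1 ?_
      exact Quotient.sound (s := SameCycle.setoid φ)
        (show SameCycle φ z (φ z) from ⟨1, by simp⟩)
    · apply Subtype.ext
      funext q
      induction q using Quotient.inductionOn with | h z => ?_
      rcases z with y | i
      · rfl
      · fin_cases i
        · exact v.2.1.symm
        · exact v.2.2.symm
  · refine Nat.card_eq_zero.2 (Or.inl ⟨fun u => hαβ (eq_of_constraint h u.2)⟩)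

/-- Exchanging the cilia splits their common cycle and exchanges the values of `β`, which reduces to
the previous case with one more cycle. -/
theorem card_constraint_of_sameCycle (h : SameCycle φ (Sum.inr 0) (Sum.inr 1)) :
    Nat.card {u : Y → Fin N // ∀ z, Sum.elim u α z = Sum.elim u β (φ z)} =
      if α = β ∘ swap 0 1 then N ^ (cyc φ - 1) else 0 := by
  classical
  have h1 := card_constraint_of_not_sameCycle (α := α) (β := β ∘ swap 0 1)
    (not_sameCycle_swap_mul (by simp) h)
  rw [cyc_swap_mul_split (by simp) h] at h1
  rw [show cyc φ + 1 - 2 = cyc φ - 1 by omega] at h1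
  rw [← h1]
  have h : ∀ (u : Y → Fin N) (z : Y ⊕ Fin 2),
      Sum.elim u (β ∘ swap 0 1) (swap (Sum.inr 0) (Sum.inr 1) z) = Sum.elim u β z := by
    rintro x (z | i)
    · rw [swap_apply_of_ne_of_ne] <;> simp
    · fin_cases i <;> simp
  simp only [Perm.mul_apply, h]

end Faces

section NumIndices

variable {E : Type} {D N : ℕ}

/-- The Kronecker deltas act on each color separately, and for color `c` the passage from tensors to
conjugates is the crossing of the edges of color `c`. The constraint is therefore invariance along
faces. -/
theorem numIndices_eq_prod (rot : Perm (HalfEdge E (Fin 2))) (col : E → Fin D)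
    (a b : Fin 2 → Idx D N) :
    numIndices rot col a b = ∏ c, Nat.card {u : E × Bool → Fin N //
      ∀ z, Sum.elim u (fun i => a i c) z = Sum.elim u (fun i => b i c) (face rot col c z)} := by
  rw [← Nat.card_pi]
  have h1 : ∀ (x : E × Bool → Idx D N) (c : Fin D) z,
      Sum.elim x a z c = Sum.elim (fun h => x h c) (fun i => a i c) z := by
    rintro x c (z | i) <;> rfl
  have h2 : ∀ (x : E × Bool → Idx D N) (c : Fin D) z, Sum.elim (mix col x) b z c =
      Sum.elim (fun h => x h c) (fun i => b i c) (flipOn (fun e => col e = c) z) := by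
    rintro x c (⟨e, s⟩ | i)
    · by_cases he : col e = c
      · rw [flipOn_of_pos (p := fun e => col e = c) he]; simp [mix, he]
      · rw [flipOn_of_neg (p := fun e => col e = c) he]; simp [mix, he]
    · rfl
  have h3 : ∀ (x : E × Bool → Idx D N) c,
      (∀ z, Sum.elim x a z c = Sum.elim (mix col x) b (rot z) c) ↔
      ∀ z, Sum.elim (fun h => x h c) (fun i => a i c) z =
        Sum.elim (fun h => x h c) (fun i => b i c) (face rot col c z) := by
    intro x c
    simp only [h1, h2]
    rfl
  refine Nat.card_congr
    { toFun := fun x c => ⟨fun h => x.1 h c, (h3 x.1 c).1 fun z => by rw [x.2 z]⟩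
      invFun := fun u => ⟨fun h c => (u c).1 h, fun z => funext fun c =>
        (h3 (fun h c => (u c).1 h) c).2 (u c).2 z⟩
      left_inv := fun x => rfl
      right_inv := fun u => rfl }

/-- Each internal face has a free index with `N` values. The external faces carry no free index:
they identify external indices, as prescribed by the boundary set. -/
theorem numIndices_eq [Finite E] (rot : Perm (HalfEdge E (Fin 2))) (col : E → Fin D) (a b : Fin 2 → Idx D N) :
    (numIndices rot col a b : ℂ) = (N : ℂ) ^ (∑ c, internalFaces rot col c) *
      traceOp (boundary rot col) (a 0) (a 1) (b 0) (b 1) := by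
  classical
  have h : ∀ c, Nat.card {u : E × Bool → Fin N //
      ∀ z, Sum.elim u (fun i => a i c) z = Sum.elim u (fun i => b i c) (face rot col c z)} =
      if (c ∉ boundary rot col → a 0 c = b 0 c ∧ a 1 c = b 1 c) ∧
        (c ∈ boundary rot col → a 0 c = b 1 c ∧ a 1 c = b 0 c) then
        N ^ internalFaces rot col c else 0 := by
    intro c
    by_cases hc : c ∈ boundary rot col
    · rw [card_constraint_of_sameCycle ((mem_boundary col).1 hc), internalFaces, if_pos hc]
      refine if_congr ?_ rfl rfl
      simp [funext_iff, Fin.forall_fin_two, hc]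
    · rw [card_constraint_of_not_sameCycle (fun h => hc ((mem_boundary col).2 h)), internalFaces,
        if_neg hc]
      refine if_congr ?_ rfl rfl
      simp [funext_iff, Fin.forall_fin_two, hc]
  rw [numIndices_eq_prod]
  simp only [h]
  rw [traceOp]
  by_cases hall : ∀ c, (c ∉ boundary rot col → a 0 c = b 0 c ∧ a 1 c = b 1 c) ∧
        (c ∈ boundary rot col → a 0 c = b 1 c ∧ a 1 c = b 0 c)
  · rw [if_pos hall, mul_one, Finset.prod_congr rfl fun c _ => if_pos (hall c),
      Finset.prod_pow_eq_pow_sum]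
    push_cast
    rfl
  · rw [if_neg hall, mul_zero]
    push Not at hall
    obtain ⟨c, hc⟩ := hall
    rw [Finset.prod_eq_zero (Finset.mem_univ c), Nat.cast_zero]
    rw [if_neg]
    rintro ⟨h1, h2⟩
    exact absurd h2 (by
      intro h2
      obtain ⟨hm, hn⟩ := hc h1
      exact hn (h2 hm).1 (h2 hm).2)

end NumIndices

end QuarticTensor

namespace QuarticTensor

open Equiv Equiv.Perm

/-! ## The expansion of the 4-point cumulant over bubbles -/

section Bubble

variable {D N : ℕ}

open Classical in
/-- The contribution of the connected maps with boundary set `C`. -/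
noncomputable def boundarySeries (D N : ℕ) (C : Finset (Fin D)) : PowerSeries ℂ :=
  PowerSeries.mk fun n => ((N : ℂ) ^ (D - 1))⁻¹ ^ 2 * ((2 * (N : ℂ) ^ (D - 1))⁻¹ ^ n *
    (n.factorial : ℂ)⁻¹ * ∑ col : Fin n → Fin D, ∑ rot : Perm (HalfEdge (Fin n) (Fin 2)),
      if Conn rot ∧ Apart rot ∧ boundary rot col = C then (N : ℂ) ^ (∑ c, internalFaces rot col c)
      else 0)

/-- The coefficient of a bubble in the 4-point cumulant. -/
noncomputable def bubbleSeries (D N : ℕ) (C : Finset (Fin D)) : PowerSeries ℂ :=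
  boundarySeries D N C + boundarySeries D N Cᶜ

theorem connApartStat_egf (a b : Fin 2 → Idx D N) :
    (((N : ℂ) ^ (D - 1))⁻¹ ^ 2) • (connApartStat a b).egf (2 * (N : ℂ) ^ (D - 1))⁻¹ =
      ∑ C, traceOp C (a 0) (a 1) (b 0) (b 1) • boundarySeries D N C := by
  classical
  ext n
  rw [map_smul, map_sum, MapStat.egf, PowerSeries.coeff_mk, smul_eq_mul]
  simp only [map_smul, boundarySeries, PowerSeries.coeff_mk, smul_eq_mul]
  have h : ∀ C, traceOp C (a 0) (a 1) (b 0) (b 1) * (((N : ℂ) ^ (D - 1))⁻¹ ^ 2 *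
      ((2 * (N : ℂ) ^ (D - 1))⁻¹ ^ n * (n.factorial : ℂ)⁻¹ *
        ∑ col : Fin n → Fin D, ∑ rot : Perm (HalfEdge (Fin n) (Fin 2)),
          if Conn rot ∧ Apart rot ∧ boundary rot col = C then
            (N : ℂ) ^ (∑ c, internalFaces rot col c) else 0)) =
      ((N : ℂ) ^ (D - 1))⁻¹ ^ 2 * ((2 * (N : ℂ) ^ (D - 1))⁻¹ ^ n * (n.factorial : ℂ)⁻¹ *
        ∑ col : Fin n → Fin D, ∑ rot : Perm (HalfEdge (Fin n) (Fin 2)),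
          if C = boundary rot col then (if Conn rot ∧ Apart rot then
            (N : ℂ) ^ (∑ c, internalFaces rot col c) * traceOp (boundary rot col)
              (a 0) (a 1) (b 0) (b 1) else 0) else 0) := by
    intro C
    rw [mul_left_comm]
    congr 1
    rw [mul_left_comm]
    congr 1
    simp only [Finset.mul_sum]
    refine Finset.sum_congr rfl fun col _ => Finset.sum_congr rfl fun rot _ => ?_
    by_cases hC : C = boundary rot col
    · subst hC
      by_cases hc : Conn rot ∧ Apart rot
      · rw [if_pos ⟨hc.1, hc.2, rfl⟩, if_pos rfl, if_pos hc, mul_comm]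
      · rw [if_neg fun h => hc ⟨h.1, h.2.1⟩, if_pos rfl, if_neg hc, mul_zero]
    · rw [if_neg fun h => hC h.2.2.symm, if_neg hC, mul_zero]
  simp only [h]
  rw [← Finset.mul_sum, ← Finset.mul_sum, Finset.sum_comm, MapStat.total]
  push_cast
  congr 2
  refine Finset.sum_congr rfl fun col _ => ?_
  rw [Finset.sum_comm]
  refine Finset.sum_congr rfl fun rot _ => ?_
  rw [Finset.sum_ite_eq', if_pos (Finset.mem_univ _), connApartStat]
  split_ifs
  · exact numIndices_eq rot col a b
  · exact Nat.cast_zero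

/-- Exchanging the conjugates exchanges the roles of the two pairings, for every color. -/
theorem traceOp_swap_right (C : Finset (Fin D)) (a₁ a₂ b₁ b₂ : Idx D N) :
    traceOp C a₁ a₂ b₂ b₁ = traceOp Cᶜ a₁ a₂ b₁ b₂ := by
  simp only [traceOp, Finset.mem_compl, not_not]
  exact if_congr (forall_congr' fun c => and_comm) rfl rfl

theorem traceOp_swap_left (C : Finset (Fin D)) (a₁ a₂ b₁ b₂ : Idx D N) :
    traceOp C a₂ a₁ b₁ b₂ = traceOp Cᶜ a₁ a₂ b₁ b₂ := by
  simp only [traceOp, Finset.mem_compl, not_not]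
  exact if_congr (forall_congr' fun c => by tauto) rfl rfl

theorem symTraceOp_eq (C : Finset (Fin D)) (a₁ a₂ b₁ b₂ : Idx D N) :
    symTraceOp C a₁ a₂ b₁ b₂ = traceOp C a₁ a₂ b₁ b₂ + traceOp Cᶜ a₁ a₂ b₁ b₂ := by
  rw [symTraceOp, traceOp_swap_left C a₁ a₂]

theorem sum_compl {M : Type*} [AddCommMonoid M] (f : Finset (Fin D) → M) :
    ∑ C, f Cᶜ = ∑ C, f C :=
  Equiv.sum_comp (Equiv.ofBijective _ (compl_bijective (α := Finset (Fin D)))) f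

theorem isBubbleExpansion_bubbleSeries (hN : 1 ≤ N) :
    IsBubbleExpansion D N (bubbleSeries D N) := by
  refine ⟨fun C => by rw [bubbleSeries, bubbleSeries, compl_compl, add_comm], fun a₁ a₂ b₁ b₂ => ?_⟩
  have h := cumulant4_eq (D := D) hN ![a₁, a₂] ![b₁, b₂]
  rw [smul_add, connApartStat_egf, connApartStat_egf] at h
  simp only [Matrix.cons_val_zero, Matrix.cons_val_one, Function.comp_apply, swap_apply_left,
    swap_apply_right] at h
  rw [h]
  simp only [fun C => traceOp_swap_right C a₁ a₂ b₁ b₂]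
  simp only [symTraceOp_eq, bubbleSeries]
  -- Each term is `f C + f Cᶜ`; reindexing the second half by complements absorbs the factor `1 /
  -- 2`.
  have h1 : ∀ C : Finset (Fin D), ((1 / 2 : ℂ) * (traceOp C a₁ a₂ b₁ b₂ +
      traceOp Cᶜ a₁ a₂ b₁ b₂)) • (boundarySeries D N C + boundarySeries D N Cᶜ) =
      ((1 / 2 : ℂ) * (traceOp C a₁ a₂ b₁ b₂ + traceOp Cᶜ a₁ a₂ b₁ b₂)) • boundarySeries D N C +
      ((1 / 2 : ℂ) * (traceOp Cᶜ a₁ a₂ b₁ b₂ + traceOp Cᶜᶜ a₁ a₂ b₁ b₂)) •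
        boundarySeries D N Cᶜ := by
    intro C
    rw [compl_compl, smul_add, add_comm (traceOp Cᶜ a₁ a₂ b₁ b₂)]
  simp only [h1]
  rw [Finset.sum_add_distrib, sum_compl fun C => ((1 / 2 : ℂ) * (traceOp C a₁ a₂ b₁ b₂ +
    traceOp Cᶜ a₁ a₂ b₁ b₂)) • boundarySeries D N C, ← Finset.sum_add_distrib,
    ← Finset.sum_add_distrib]
  refine Finset.sum_congr rfl fun C _ => ?_
  rw [← add_smul, ← add_smul]
  congr 1
  ring

/-- With constant indices `0` and `1` for the two tensors, the color-`c` component of the conjugates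
tells whether `c` belongs to the set. Only the operator of `C` survives, so the coefficient is a
value of the cumulant. -/
theorem IsBubbleExpansion.eq_cumulant4 (hN : 2 ≤ N) {w : Finset (Fin D) → PowerSeries ℂ}
    (hw : IsBubbleExpansion D N w) (C : Finset (Fin D)) :
    w C = cumulant4 D N (fun _ => ⟨0, by omega⟩) (fun _ => ⟨1, by omega⟩)
      (fun c => if c ∈ C then ⟨1, by omega⟩ else ⟨0, by omega⟩)
      (fun c => if c ∈ C then ⟨0, by omega⟩ else ⟨1, by omega⟩) := by
  rw [hw.2]
  have h : ∀ C', traceOp (N := N) C' (fun _ => ⟨0, by omega⟩) (fun _ => ⟨1, by omega⟩)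
      (fun c => if c ∈ C then ⟨1, by omega⟩ else ⟨0, by omega⟩)
      (fun c => if c ∈ C then ⟨0, by omega⟩ else ⟨1, by omega⟩) = if C' = C then 1 else 0 := by
    intro C'
    rw [traceOp]
    refine if_congr ?_ rfl rfl
    rw [Finset.ext_iff]
    refine forall_congr' fun c => ?_
    by_cases h1 : c ∈ C <;> by_cases h2 : c ∈ C' <;> simp [h1, h2, Fin.ext_iff]
  simp only [symTraceOp_eq, h]
  have h1 : ∀ C' : Finset (Fin D), ((1 / 2 : ℂ) * ((if C' = C then 1 else 0) +
      if C'ᶜ = C then 1 else 0)) • w C' =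
      (if C' = C then (1 / 2 : ℂ) • w C' else 0) +
        if C'ᶜ = C then (1 / 2 : ℂ) • w C'ᶜ else 0 := by
    intro C'
    rw [hw.1, mul_add, add_smul]
    congr 1 <;> split_ifs <;> simp
  simp only [h1]
  rw [Finset.sum_add_distrib, sum_compl fun C' => if C' = C then (1 / 2 : ℂ) • w C' else 0,
    Finset.sum_ite_eq', if_pos (Finset.mem_univ _), ← add_smul]
  norm_num

theorem isBubbleExpansion_iff (hN : 2 ≤ N) (w : Finset (Fin D) → PowerSeries ℂ) :
    IsBubbleExpansion D N w ↔ w = bubbleSeries D N := by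
  have hb := isBubbleExpansion_bubbleSeries (D := D) (N := N) (by omega)
  refine ⟨fun hw => funext fun C => ?_, fun h => h ▸ hb⟩
  rw [hw.eq_cumulant4 hN, hb.eq_cumulant4 hN]

end Bubble

end QuarticTensor

namespace QuarticTensor

open Equiv Equiv.Perm

/-! ## The large `N` limit -/

section LargeN

variable {D : ℕ}

open Classical in
/-- The generating series of the labeled trees with two cilia and boundary graph `B_{4,C}`. -/
noncomputable def labeledTreeSeries (C : Finset (Fin D)) : PowerSeries ℂ :=
  PowerSeries.mk fun n => (2 : ℂ)⁻¹ ^ n * (n.factorial : ℂ)⁻¹ *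
    ∑ col : Fin n → Fin D, ∑ rot : Perm (HalfEdge (Fin n) (Fin 2)),
      if Tree rot ∧ Apart rot ∧ (boundary rot col = C ∨ boundary rot col = Cᶜ) then 1 else 0

theorem numComponents_compl (C : Finset (Fin D)) : numComponents Cᶜ = numComponents C := by
  rw [numComponents, numComponents]
  refine if_congr ?_ rfl rfl
  rw [Finset.compl_eq_empty_iff, Finset.compl_eq_univ_iff, or_comm]

/-- All powers of `N` are collected here into the exponent `scaling`. Its definition uses the
components of the map's own boundary set, which agree with those of `C` up to complement. -/
theorem rescaling_mul {N n : ℕ} (hD : 1 ≤ D) (hN : 1 ≤ N) {C : Finset (Fin D)}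
    {rot : Perm (HalfEdge (Fin n) (Fin 2))} {col : Fin n → Fin D}
    (hC : boundary rot col = C ∨ boundary rot col = Cᶜ) :
    ((N : ℂ) ^ ((D : ℤ) - 2 * ((D : ℤ) - 1) * 2 - (numComponents C : ℤ)))⁻¹ *
      (((N : ℂ) ^ (D - 1))⁻¹ ^ 2 * ((2 * (N : ℂ) ^ (D - 1))⁻¹ ^ n *
        (N : ℂ) ^ (∑ c, internalFaces rot col c))) = (2 : ℂ)⁻¹ ^ n * (N : ℂ) ^ scaling rot col := by
  have hN' : (N : ℂ) ≠ 0 := by exact_mod_cast (by omega : N ≠ 0)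
  have hc : numComponents C = numComponents (boundary rot col) := by
    rcases hC with h | h
    · rw [h]
    · rw [h, numComponents_compl]
  have h1 : (N : ℂ) ^ (D - 1) = (N : ℂ) ^ ((D : ℤ) - 1) := by
    rw [← zpow_natCast]
    congr 1
    omega
  have key : ∀ a b t c d : ℂ, a * (b * (t * c * d)) = t * (a * (b * (c * d))) := by
    intros; ring
  rw [h1, hc, mul_inv, mul_pow, scaling, ← zpow_natCast (N : ℂ) (∑ c, internalFaces rot col c),
    ← zpow_neg, ← zpow_neg, ← zpow_natCast, ← zpow_natCast _ n, ← zpow_natCast _ n, ← zpow_mul,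
    ← zpow_mul, key]
  congr 1
  rw [← zpow_add₀ hN', ← zpow_add₀ hN', ← zpow_add₀ hN']
  congr 1
  rw [Fintype.card_fin]
  push_cast
  ring

open Classical in
theorem coeff_rescaled_bubbleSeries (hD : 1 ≤ D) {N : ℕ} (hN : 1 ≤ N) (C : Finset (Fin D)) (n : ℕ) :
    PowerSeries.coeff n (rescaled N C (bubbleSeries D N C)) =
      (2 : ℂ)⁻¹ ^ n * (n.factorial : ℂ)⁻¹ *
        ∑ col : Fin n → Fin D, ∑ rot : Perm (HalfEdge (Fin n) (Fin 2)),
          if Conn rot ∧ Apart rot ∧ (boundary rot col = C ∨ boundary rot col = Cᶜ) then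
            (N : ℂ) ^ scaling rot col else 0 := by
  -- The two boundary series must not count the same map twice, which would happen only for `D = 0`.
  have hCC : C ≠ Cᶜ := by
    intro h
    have := Finset.mem_compl (s := C) (a := (⟨0, by omega⟩ : Fin D))
    rw [← h] at this
    tauto
  rw [rescaled, map_smul, bubbleSeries, map_add, boundarySeries, boundarySeries,
    PowerSeries.coeff_mk, PowerSeries.coeff_mk, ← mul_add, ← mul_add, ← Finset.sum_add_distrib,
    smul_eq_mul]
  simp only [← Finset.sum_add_distrib, Finset.mul_sum]
  refine Finset.sum_congr rfl fun col _ => Finset.sum_congr rfl fun rot _ => ?_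
  by_cases h : Conn rot ∧ Apart rot ∧ (boundary rot col = C ∨ boundary rot col = Cᶜ)
  · have h1 : ((if Conn rot ∧ Apart rot ∧ boundary rot col = C then
        (N : ℂ) ^ (∑ c, internalFaces rot col c) else 0) +
        if Conn rot ∧ Apart rot ∧ boundary rot col = Cᶜ then
          (N : ℂ) ^ (∑ c, internalFaces rot col c) else 0) =
        (N : ℂ) ^ (∑ c, internalFaces rot col c) := by
      rcases h.2.2 with h' | h'
      · rw [if_pos ⟨h.1, h.2.1, h'⟩, if_neg, add_zero]
        rintro ⟨-, -, h''⟩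
        exact hCC (h'.symm.trans h'')
      · rw [if_neg, if_pos ⟨h.1, h.2.1, h'⟩, zero_add]
        rintro ⟨-, -, h''⟩
        exact hCC (h''.symm.trans h')
    rw [h1, if_pos h, mul_right_comm _ _ ((N : ℂ) ^ scaling rot col), ← rescaling_mul hD hN h.2.2]
    ring
  · rw [if_neg h, if_neg fun h' => h ⟨h'.1, h'.2.1, Or.inl h'.2.2⟩,
      if_neg fun h' => h ⟨h'.1, h'.2.1, Or.inr h'.2.2⟩]
    simp

/-- The rescaled cumulant converges to the generating series of the trees. -/
theorem perturbativeBigO_rescaled (hD : 3 ≤ D) (C : Finset (Fin D)) :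
    PerturbativeBigO (fun N => rescaled N C (bubbleSeries D N C) - labeledTreeSeries C) (D - 2) := by
  classical
  intro n
  have h : (fun N : ℕ => PowerSeries.coeff n
      (rescaled N C (bubbleSeries D N C) - labeledTreeSeries C)) =ᶠ[Filter.atTop]
      fun N : ℕ => (2 : ℂ)⁻¹ ^ n * (n.factorial : ℂ)⁻¹ *
        ∑ col : Fin n → Fin D, ∑ rot : Perm (HalfEdge (Fin n) (Fin 2)),
          if (Conn rot ∧ Apart rot ∧ (boundary rot col = C ∨ boundary rot col = Cᶜ)) ∧ ¬ Tree rot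
            then (N : ℂ) ^ scaling rot col else 0 := by
    filter_upwards [Filter.eventually_ge_atTop 1] with N hN
    rw [map_sub, coeff_rescaled_bubbleSeries (by omega) hN, labeledTreeSeries, PowerSeries.coeff_mk,
      ← mul_sub]
    congr 1
    simp only [← Finset.sum_sub_distrib]
    refine Finset.sum_congr rfl fun col _ => Finset.sum_congr rfl fun rot _ => ?_
    -- Trees have exponent zero, so they cancel exactly against the limit series.
    by_cases ht : Tree rot
    · have hc := ht.1
      simp only [ht, hc, true_and, not_true, and_false, if_false]
      split_ifs with h'
      · rw [ht.scaling_eq_zero col hD h'.1, zpow_zero, sub_self]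
      · rw [sub_self]
    · simp only [ht, false_and, if_false, sub_zero, not_false_eq_true, and_true]
  refine h.trans_isBigO (Asymptotics.IsBigO.const_mul_left ?_ _)
  refine Asymptotics.IsBigO.fun_sum fun col _ => ?_
  refine Asymptotics.IsBigO.fun_sum fun rot _ => ?_
  split_ifs with h'
  · have hs := scaling_le col hD h'.1.1 h'.1.2.1 h'.2
    refine Asymptotics.IsBigO.of_bound 1 ?_
    filter_upwards [Filter.eventually_ge_atTop 1] with N hN
    have hN1 : (1 : ℝ) ≤ N := by exact_mod_cast hN
    rw [one_mul, norm_zpow, Complex.norm_natCast, norm_inv, norm_pow, Real.norm_natCast,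
      ← zpow_natCast, ← zpow_neg]
    refine zpow_le_zpow_right₀ hN1 (hs.trans (le_of_eq ?_))
    omega
  · exact Asymptotics.isBigO_zero _ _

end LargeN

end QuarticTensor

namespace QuarticTensor

open Equiv Equiv.Perm

/-! ## Labeled and unlabeled trees -/

namespace CiliatedMap

variable {D n : ℕ}

theorem edgeFlip_eq (n : ℕ) : edgeFlip n = flipOn fun _ => True := by
  ext1 x
  rcases x with ⟨e, s⟩ | i
  · rw [flipOn_of_pos trivial]; rfl
  · rfl

theorem faceStep_eq (M : CiliatedMap D n) (c : Fin D) : M.faceStep c = face M.rot M.color c := by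
  funext d
  rw [faceStep, face, Perm.mul_apply]
  rcases M.rot d with ⟨e, s⟩ | i
  · by_cases he : M.color e = c
    · rw [flipOn_of_pos (p := fun e => M.color e = c) he, if_pos (by simp [dartColor, he])]; rfl
    · rw [flipOn_of_neg (p := fun e => M.color e = c) he, if_neg (by simp [dartColor, he])]
  · rw [if_neg (by simp [dartColor])]; rfl

/-- On a common cycle, the first arrival at the second cilium cannot be preceded by a return to the
first one, which would give an earlier arrival. -/
theorem externalFace_iff (M : CiliatedMap D n) (c : Fin D) :
    M.ExternalFace c 0 1 ↔ c ∈ boundary M.rot M.color := by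
  classical
  rw [mem_boundary, ExternalFace, faceStep_eq]
  set φ := face M.rot M.color c
  have hit : ∀ (k : ℕ) x, φ^[k] x = (φ ^ k) x := fun k x => by rw [Perm.iterate_eq_pow]
  simp only [hit]
  constructor
  · rintro ⟨k, -, hk, -⟩
    exact ⟨k, by rw [zpow_natCast, hk]⟩
  · intro h
    have hex : ∃ k, 0 < k ∧ (φ ^ k) (Sum.inr 0) = Sum.inr 1 := by
      obtain ⟨i, hi, -, h⟩ := h.exists_pow_eq''
      exact ⟨i, hi, h⟩
    obtain ⟨hk, hkb⟩ := Nat.find_spec hex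
    refine ⟨Nat.find hex, hk, hkb, fun m hm hmk l => ?_⟩
    fin_cases l
    · intro h'
      refine Nat.find_min hex (m := Nat.find hex - m) (by omega) ⟨by omega, ?_⟩
      have : (φ ^ (Nat.find hex - m)) ((φ ^ m) (Sum.inr 0)) = Sum.inr 1 := by
        rw [← Perm.mul_apply, ← pow_add, Nat.sub_add_cancel hmk.le, hkb]
      rwa [h'] at this
    · exact fun h' => Nat.find_min hex hmk ⟨hm, h'⟩

theorem hasBoundary_iff (M : CiliatedMap D n) (C : Finset (Fin D)) :
    M.HasBoundary C ↔ boundary M.rot M.color = C ∨ boundary M.rot M.color = Cᶜ := by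
  rw [HasBoundary]
  simp only [externalFace_iff]
  rw [Finset.ext_iff, Finset.ext_iff]
  exact or_congr (forall_congr' fun c => iff_comm) (forall_congr' fun c => iff_comm)

/-- Orbits of the group generated by `rot` and the edge flip are compared with invariant predicates:
group elements preserve linked classes, and membership in an orbit is itself an invariant predicate.
-/
theorem connected_iff (M : CiliatedMap D n) : M.Connected ↔ Conn M.rot := by
  constructor
  · intro h x y
    obtain ⟨g, hg, rfl⟩ := h x y
    have key : ∀ z, Linked M.rot (fun _ => True) z (g z) := by
      induction hg using Subgroup.closure_induction with
      | mem g hg =>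
        rcases hg with rfl | rfl
        · exact linked_rot _ _
        · rw [edgeFlip_eq]
          exact linked_flipOn _ _
      | one => exact (Linked _ _).refl
      | mul g g' _ _ h h' => exact fun z => (Linked _ _).trans (h' z) (h (g' z))
      | inv g _ h =>
        intro z
        have := h (g⁻¹ z)
        rw [show g (g⁻¹ z) = z by simp] at this
        exact (Linked _ _).symm this
    exact key x
  · intro h x y
    have hr : M.rot ∈ Subgroup.closure {M.rot, edgeFlip n} := Subgroup.subset_closure (by simp)
    have he : edgeFlip n ∈ Subgroup.closure {M.rot, edgeFlip n} := Subgroup.subset_closure (by simp)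
    have key : ∀ g ∈ Subgroup.closure {M.rot, edgeFlip n}, ∀ z,
        (∃ g' ∈ Subgroup.closure {M.rot, edgeFlip n}, g' x = g z) ↔
          ∃ g' ∈ Subgroup.closure {M.rot, edgeFlip n}, g' x = z := by
      intro g hg z
      constructor
      · rintro ⟨g', hg', h'⟩
        exact ⟨g⁻¹ * g', mul_mem (inv_mem hg) hg', by rw [Perm.mul_apply, h']; simp⟩
      · rintro ⟨g', hg', rfl⟩
        exact ⟨g * g', mul_mem hg hg', rfl⟩
    exact (h x y (fun z => ∃ g ∈ Subgroup.closure {M.rot, edgeFlip n}, g x = z) (key _ hr)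
      fun e _ => key _ he (Sum.inl (e, false))).1 ⟨1, one_mem _, rfl⟩

theorem isTree_iff (M : CiliatedMap D n) : M.IsTree ↔ Tree M.rot := by
  rw [IsTree, Tree, connected_iff, Nat.card_eq_fintype_card, Fintype.card_fin]
  rfl

theorem Iso.isTree {M M' : CiliatedMap D n} (h : Iso M M') (hM : M.IsTree) : M'.IsTree := by
  rw [isTree_iff] at hM ⊢
  obtain ⟨g, -, hflip, hrot, -⟩ := h
  have hr : M'.rot = g.permCongr M.rot := by
    ext1 x
    obtain ⟨x, rfl⟩ := g.surjective x
    rw [permCongr_apply_apply, hrot]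
  refine ⟨fun x y f h1 h2 => ?_, by rw [hr, cyc_conj, hM.2]⟩
  have hf : ∀ z, f (edgeFlip n z) ↔ f z := by
    rintro (⟨e, s⟩ | i)
    · have := h2 e trivial
      cases s
      · exact this
      · exact this.symm
    · rfl
  obtain ⟨x, rfl⟩ := g.surjective x
  obtain ⟨y, rfl⟩ := g.surjective y
  refine hM.1 x y (fun z => f (g z)) (fun z => by rw [hrot, h1]) fun e _ => ?_
  have := hf (g (Sum.inl (e, false)))
  rwa [← hflip] at this

theorem Iso.hasBoundary {M M' : CiliatedMap D n} (h : Iso M M') {C : Finset (Fin D)}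
    (hM : M.HasBoundary C) : M'.HasBoundary C := by
  rw [hasBoundary_iff] at hM ⊢
  obtain ⟨g, hfix, hflip, hrot, hcol⟩ := h
  have hb : boundary M'.rot M'.color = boundary M.rot M.color := by
    ext c
    have hface : face M'.rot M'.color c = g.permCongr (face M.rot M.color c) := by
      ext1 x
      obtain ⟨x, rfl⟩ := g.surjective x
      rw [permCongr_apply_apply, ← faceStep_eq, ← faceStep_eq, faceStep, faceStep, ← hrot, hcol]
      split_ifs
      · rw [hflip]
      · rfl
    have := sameCycle_permCongr g (face M.rot M.color c) (Sum.inr 0) (Sum.inr 1)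
    rw [hfix, hfix, ← hface] at this
    rw [mem_boundary, mem_boundary, this]
  rwa [hb]

/-- The relabeling of the half-edges given by a permutation of the edges and a choice of the edges
whose sides are exchanged. -/
def relabeling (σ : Perm (Fin n) × (Fin n → Bool)) : Perm (Dart n) :=
  Equiv.sumCongr (Equiv.prodShear σ.1 fun e => if σ.2 e then Equiv.boolNot else Equiv.refl Bool)
    (Equiv.refl (Fin 2))

theorem relabeling_inl (σ : Perm (Fin n) × (Fin n → Bool)) (e : Fin n) (s : Bool) :
    relabeling σ (Sum.inl (e, s)) = Sum.inl (σ.1 e, if σ.2 e then !s else s) := by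
  rw [relabeling, Equiv.sumCongr_apply, Sum.map_inl, Equiv.prodShear_apply]
  dsimp only
  split_ifs <;> rfl

theorem relabeling_inr (σ : Perm (Fin n) × (Fin n → Bool)) (i : Fin 2) :
    relabeling σ (Sum.inr i) = Sum.inr i := rfl

theorem relabeling_edgeFlip (σ : Perm (Fin n) × (Fin n → Bool)) (d : Dart n) :
    relabeling σ (edgeFlip n d) = edgeFlip n (relabeling σ d) := by
  rcases d with ⟨e, s⟩ | i
  · change relabeling σ (Sum.inl (e, !s)) = _
    rw [relabeling_inl, relabeling_inl]
    split_ifs <;> rfl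
  · rfl

theorem relabeling_injective : Function.Injective (relabeling (n := n)) := by
  intro σ τ h
  have h1 : ∀ e s, (Sum.inl (σ.1 e, if σ.2 e then !s else s) : Dart n) =
      Sum.inl (τ.1 e, if τ.2 e then !s else s) := by
    intro e s
    rw [← relabeling_inl, ← relabeling_inl, h]
  refine Prod.ext (Equiv.ext fun e => ?_) (funext fun e => ?_)
  · have := h1 e true
    simp only [Sum.inl.injEq, Prod.mk.injEq] at this
    exact this.1
  · have := h1 e true
    simp only [Sum.inl.injEq, Prod.mk.injEq] at this
    cases hσ : σ.2 e <;> cases hτ : τ.2 e <;> simp_all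

/-- Fixing the cilia and commuting with the edge flip forces `g` to permute the edges, with a
possible exchange of sides on each. The image of the side `true` determines everything. -/
theorem exists_relabeling (g : Perm (Dart n)) (h1 : ∀ i : Fin 2, g (Sum.inr i) = Sum.inr i)
    (h2 : ∀ d, g (edgeFlip n d) = edgeFlip n (g d)) : ∃ σ, g = relabeling σ := by
  have hinl : ∀ e, ∃ x : Fin n × Bool, g (Sum.inl (e, true)) = Sum.inl x := by
    intro e
    rcases h : g (Sum.inl (e, true)) with x | i
    · exact ⟨x, rfl⟩
    · rw [← h1 i] at h
      simp at h
  choose x hx using hinl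
  have hx' : ∀ e, g (Sum.inl (e, false)) = Sum.inl ((x e).1, !(x e).2) := by
    intro e
    have := h2 (Sum.inl (e, true))
    rw [hx] at this
    exact this
  have hinj : Function.Injective fun e => (x e).1 := by
    intro e e' h
    have h : (x e).1 = (x e').1 := h
    by_cases hs : (x e).2 = (x e').2
    · have : g (Sum.inl (e, true)) = g (Sum.inl (e', true)) := by
        rw [hx, hx, Prod.ext h hs]
      simpa using this
    · have : g (Sum.inl (e, true)) = g (Sum.inl (e', false)) := by
        rw [hx, hx', ← h]
        congr 1
        refine Prod.ext rfl ?_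
        cases h1 : (x e).2 <;> cases h2 : (x e').2 <;> simp_all
      simp at this
  refine ⟨(Equiv.ofBijective _ (Finite.injective_iff_bijective.1 hinj), fun e => !(x e).2), ?_⟩
  ext1 d
  rcases d with ⟨e, s⟩ | i
  · rw [relabeling_inl]
    cases s
    · rw [hx']
      cases h : (x e).2 <;> simp [h]
    · rw [hx]
      refine congrArg Sum.inl (Prod.ext rfl ?_)
      cases h : (x e).2 <;> simp [h]
  · exact h1 i

/-- The map obtained by relabeling the edges and their sides. -/
def relabel (σ : Perm (Fin n) × (Fin n → Bool)) (M : CiliatedMap D n) : CiliatedMap D n where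
  rot := (relabeling σ).permCongr M.rot
  color := M.color ∘ σ.1.symm
  cilia_apart := fun h => M.cilia_apart ((sameCycle_permCongr (relabeling σ) M.rot _ _).1 h)

theorem iso_relabel (σ : Perm (Fin n) × (Fin n → Bool)) (M : CiliatedMap D n) :
    Iso M (relabel σ M) := by
  refine ⟨relabeling σ, relabeling_inr σ, relabeling_edgeFlip σ,
    fun d => (permCongr_apply_apply _ _ _).symm, ?_⟩
  rintro (⟨e, s⟩ | i)
  · rw [relabeling_inl]
    simp [dartColor, relabel]
  · rfl

theorem ext' {M M' : CiliatedMap D n} (h1 : M.rot = M'.rot) (h2 : M.color = M'.color) : M = M' := by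
  cases M
  cases M'
  simp_all

theorem Iso.exists_relabel {M M' : CiliatedMap D n} (h : Iso M M') : ∃ σ, M' = relabel σ M := by
  obtain ⟨g, hfix, hflip, hrot, hcol⟩ := h
  obtain ⟨σ, rfl⟩ := exists_relabeling g hfix hflip
  refine ⟨σ, ext' ?_ ?_⟩
  · ext1 x
    obtain ⟨x, rfl⟩ := (relabeling σ).surjective x
    rw [← hrot, relabel, permCongr_apply_apply]
  · funext e
    have := hcol (Sum.inl (σ.1.symm e, true))
    rw [relabeling_inl] at this
    simpa [dartColor, relabel] using this

/-- Two relabelings with the same result agree on the cilia. Agreement propagates through `rot` and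
across edges, hence everywhere on a connected map. This freeness is what the cilia are needed for.
-/
theorem relabel_injective {M : CiliatedMap D n} (hM : Conn M.rot) :
    Function.Injective fun σ => relabel σ M := by
  intro σ τ h
  have hrot : (relabeling σ).permCongr M.rot = (relabeling τ).permCongr M.rot :=
    congrArg CiliatedMap.rot h
  apply relabeling_injective
  have key : ∀ x : Dart n, relabeling σ x = relabeling τ x := by
    intro x
    refine (hM (Sum.inr 0) x (fun z => relabeling σ z = relabeling τ z) (fun z => ?_)
      fun e _ => ?_).1 rfl
    · rw [← permCongr_apply_apply, ← permCongr_apply_apply (relabeling τ), hrot]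
      constructor
      · exact fun h => ((relabeling τ).permCongr M.rot).injective h
      · exact fun h => congrArg _ h
    · have h1 : (Sum.inl (e, true) : Dart n) = edgeFlip n (Sum.inl (e, false)) := rfl
      rw [h1, relabeling_edgeFlip, relabeling_edgeFlip, (edgeFlip n).apply_eq_iff_eq]
  exact Equiv.ext key

/-- The orbits of the relabelings on labeled trees are free. -/
theorem card_labeled_trees (C : Finset (Fin D)) :
    Nat.card {M : CiliatedMap D n // M.IsTree ∧ M.HasBoundary C} =
      treeCount C n * (n.factorial * 2 ^ n) := by
  have hG : Nat.card (Perm (Fin n) × (Fin n → Bool)) = n.factorial * 2 ^ n := by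
    simp [Fintype.card_perm]
  rw [← hG, treeCount, ← Nat.card_coe_set_eq, ← Nat.card_prod]
  set S := {M : CiliatedMap D n | M.IsTree ∧ M.HasBoundary C}
  have hrep : ∀ q : (fun M : CiliatedMap D n => Quotient.mk (isoSetoid D n) M) '' S,
      ∃ M : S, Quotient.mk (isoSetoid D n) M.1 = q.1 := by
    rintro ⟨_, M, hM, rfl⟩
    exact ⟨⟨M, hM⟩, rfl⟩
  choose rep hrep using hrep
  have hS : ∀ {M M' : CiliatedMap D n}, Iso M M' → M ∈ S → M' ∈ S :=
    fun h hM => ⟨h.isTree hM.1, h.hasBoundary hM.2⟩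
  have hconn : ∀ M : S, Conn M.1.rot := fun M => ((isTree_iff _).1 M.2.1).1
  let f : ((fun M : CiliatedMap D n => Quotient.mk (isoSetoid D n) M) '' S) ×
      (Perm (Fin n) × (Fin n → Bool)) → S :=
    fun q => ⟨relabel q.2 (rep q.1).1, hS (iso_relabel _ _) (rep q.1).2⟩
  have hf : ∀ q, Quotient.mk (isoSetoid D n) (f q).1 = q.1.1 := fun q => by
    rw [← hrep q.1]
    exact Quotient.sound ((isoSetoid D n).symm (iso_relabel _ _))
  refine (Nat.card_congr (Equiv.ofBijective f ⟨?_, ?_⟩)).symm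
  · rintro ⟨q, σ⟩ ⟨q', σ'⟩ h
    have hq : q = q' := by
      apply Subtype.ext
      rw [← hf (q, σ), ← hf (q', σ'), h]
    subst hq
    exact congrArg (Prod.mk q) (relabel_injective (hconn (rep q)) (congrArg Subtype.val h))
  · intro M
    let q : (fun M : CiliatedMap D n => Quotient.mk (isoSetoid D n) M) '' S := ⟨_, M.1, M.2, rfl⟩
    obtain ⟨σ, hσ⟩ := Iso.exists_relabel (Quotient.exact (hrep q) : Iso (rep q).1 M.1)
    exact ⟨(q, σ), Subtype.ext hσ.symm⟩

end CiliatedMap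

open CiliatedMap in
theorem treeSeries_eq_labeledTreeSeries {D : ℕ} (C : Finset (Fin D)) :
    treeSeries C = labeledTreeSeries C := by
  classical
  ext n
  rw [treeSeries, labeledTreeSeries, PowerSeries.coeff_mk, PowerSeries.coeff_mk,
    ← Fintype.sum_prod_type' (f := fun (col : Fin n → Fin D) (rot : Perm (HalfEdge (Fin n)
      (Fin 2))) => if Tree rot ∧ Apart rot ∧ (boundary rot col = C ∨ boundary rot col = Cᶜ)
        then (1 : ℂ) else 0), Finset.sum_boole, ← Fintype.card_subtype]
  have h : Nat.card {M : CiliatedMap D n // M.IsTree ∧ M.HasBoundary C} =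
      Fintype.card {x : (Fin n → Fin D) × Perm (HalfEdge (Fin n) (Fin 2)) //
        Tree x.2 ∧ Apart x.2 ∧ (boundary x.2 x.1 = C ∨ boundary x.2 x.1 = Cᶜ)} := by
    rw [← Nat.card_eq_fintype_card]
    refine Nat.card_congr
      { toFun := fun M => ⟨(M.1.color, M.1.rot), (isTree_iff _).1 M.2.1, M.1.cilia_apart,
          (hasBoundary_iff _ _).1 M.2.2⟩
        invFun := fun x => ⟨⟨x.1.2, x.1.1, x.2.2.1⟩, (isTree_iff _).2 x.2.1,
          (hasBoundary_iff _ _).2 x.2.2.2⟩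
        left_inv := fun M => rfl
        right_inv := fun x => rfl }
  rw [← h, card_labeled_trees]
  have h1 : (n.factorial : ℂ) ≠ 0 := by exact_mod_cast n.factorial_ne_zero
  push_cast
  rw [inv_pow]
  field_simp

end QuarticTensor

namespace QuarticTensor

open Equiv Equiv.Perm

/-! ## Removing the half-edge that follows a cilium -/

section InsertAfter

variable {H H' K K' : Type}

open Classical in
/-- The permutation obtained by inserting a new point in a cycle, after the point `x₀`. -/
noncomputable def insertAfter (ψ : Option K ≃ H) (x₀ : K) (ρ : Perm K) : Perm H :=
  ψ.permCongr (Equiv.optionCongr ρ) * swap (ψ (some x₀)) (ψ none)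

variable (ψ : Option K ≃ H) (x₀ : K) (ρ : Perm K)

theorem insertAfter_root : insertAfter ψ x₀ ρ (ψ (some x₀)) = ψ none := by
  classical
  rw [insertAfter, Perm.mul_apply, swap_apply_left, permCongr_apply_apply]; rfl

theorem insertAfter_none : insertAfter ψ x₀ ρ (ψ none) = ψ (some (ρ x₀)) := by
  classical
  rw [insertAfter, Perm.mul_apply, swap_apply_right, permCongr_apply_apply]; rfl

theorem insertAfter_some {x : K} (hx : x ≠ x₀) :
    insertAfter ψ x₀ ρ (ψ (some x)) = ψ (some (ρ x)) := by
  classical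
  rw [insertAfter, Perm.mul_apply, swap_apply_of_ne_of_ne (by simpa using hx) (by simp),
    permCongr_apply_apply]; rfl

theorem insertAfter_injective : Function.Injective (insertAfter ψ x₀) := by
  intro ρ ρ' h
  have h1 := mul_right_cancel h
  have h2 := ψ.permCongr.injective h1
  ext1 x
  have := congrArg (fun σ : Perm (Option K) => σ (some x)) h2
  simpa using this

theorem exists_insertAfter {rot : Perm H} (h : rot (ψ (some x₀)) = ψ none) :
    ∃ ρ, rot = insertAfter ψ x₀ ρ := by
  classical
  set τ : Perm (Option K) := ψ.symm.permCongr (rot * swap (ψ (some x₀)) (ψ none)) with hτ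
  have hn : τ none = none := by
    rw [hτ, Equiv.permCongr_apply, Equiv.symm_symm, Perm.mul_apply, swap_apply_right, h,
      Equiv.symm_apply_apply]
  refine ⟨Equiv.removeNone τ, ?_⟩
  have h1 : Equiv.optionCongr (Equiv.removeNone τ) = τ := by
    rw [map_equiv_removeNone, hn, swap_self]; rfl
  rw [insertAfter, h1, hτ, ← mul_inv_eq_iff_eq_mul, swap_inv]
  ext x
  simp [Equiv.permCongr_apply]

theorem sum_insertAfter [Fintype H] [DecidableEq H] [Fintype K] [DecidableEq K]
    (f : Perm H → ℕ) :
    (∑ rot, if rot (ψ (some x₀)) = ψ none then f rot else 0) = ∑ ρ, f (insertAfter ψ x₀ ρ) := by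
  rw [← Finset.sum_filter]
  symm
  refine Finset.sum_bij (fun ρ _ => insertAfter ψ x₀ ρ) ?_ ?_ ?_ fun _ _ => rfl
  · exact fun ρ _ => Finset.mem_filter.2 ⟨Finset.mem_univ _, insertAfter_root ψ x₀ ρ⟩
  · exact fun ρ _ ρ' _ h => insertAfter_injective ψ x₀ h
  · intro rot hrot
    obtain ⟨ρ, rfl⟩ := exists_insertAfter ψ x₀ (Finset.mem_filter.1 hrot).2
    exact ⟨ρ, Finset.mem_univ _, rfl⟩

theorem insertAfter_trans (θ : H ≃ H') :
    insertAfter (ψ.trans θ) x₀ ρ = θ.permCongr (insertAfter ψ x₀ ρ) := by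
  ext1 z
  obtain ⟨y, rfl⟩ := θ.surjective z
  obtain ⟨k, rfl⟩ := ψ.surjective y
  rw [permCongr_apply_apply]
  rcases k with _ | k
  · exact (insertAfter_none (ψ.trans θ) x₀ ρ).trans (by rw [insertAfter_none]; rfl)
  · by_cases hk : k = x₀
    · subst hk
      exact (insertAfter_root (ψ.trans θ) k ρ).trans (by rw [insertAfter_root]; rfl)
    · exact (insertAfter_some (ψ.trans θ) x₀ ρ hk).trans (by rw [insertAfter_some _ _ _ hk]; rfl)

theorem insertAfter_permCongr (φ : K' ≃ K) (y₀ : K') (τ : Perm K') :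
    insertAfter ψ (φ y₀) (φ.permCongr τ) = insertAfter ((Equiv.optionCongr φ).trans ψ) y₀ τ := by
  ext1 z
  obtain ⟨k, rfl⟩ := ((Equiv.optionCongr φ).trans ψ).surjective z
  rcases k with _ | k
  · rw [insertAfter_none]
    change insertAfter ψ (φ y₀) (φ.permCongr τ) (ψ none) = ψ (some (φ (τ y₀)))
    rw [insertAfter_none, permCongr_apply_apply]
  · by_cases hk : k = y₀
    · subst hk
      rw [insertAfter_root]
      exact insertAfter_root ψ (φ k) _
    · rw [insertAfter_some _ _ _ hk]
      change insertAfter ψ (φ y₀) (φ.permCongr τ) (ψ (some (φ k))) = ψ (some (φ (τ k)))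
      rw [insertAfter_some _ _ _ (by simpa using hk), permCongr_apply_apply]

theorem cyc_optionCongr [Finite K] : cyc (Equiv.optionCongr ρ) = cyc ρ + 1 := by
  have h : (Equiv.optionEquivSumPUnit.{0} K).permCongr (Equiv.optionCongr ρ) =
      Perm.sumCongr ρ (1 : Perm PUnit.{1}) := by
    ext1 z
    obtain ⟨k, rfl⟩ := (Equiv.optionEquivSumPUnit.{0} K).surjective z
    rw [permCongr_apply_apply]
    cases k <;> rfl
  rw [← cyc_conj (Equiv.optionEquivSumPUnit.{0} K), h, cyc_sumCongr, cyc_one]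
  simp

/-- The new point first counts as one more fixed point, and the transposition then merges it into
the cycle of `x₀`. -/
theorem cyc_insertAfter [Finite H] [Finite K] : cyc (insertAfter ψ x₀ ρ) = cyc ρ := by
  classical
  have hn : ¬ SameCycle (ψ.permCongr (Equiv.optionCongr ρ)) (ψ (some x₀)) (ψ none) := by
    rw [sameCycle_permCongr]
    intro h
    have := h.eq_of_right (show (Equiv.optionCongr ρ) none = none from rfl)
    simp at this
  have h := cyc_mul_swap_merge hn
  rw [cyc_conj, cyc_optionCongr] at h
  rw [insertAfter]
  convert! Nat.add_right_cancel h

/-- Invariance after the insertion is invariance before it, with the new point agreeing with `x₀`.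
Connectivity can thus be tested on the smaller permutation. -/
theorem invariant_insertAfter (f : H → Prop) :
    (∀ h, f (insertAfter ψ x₀ ρ h) ↔ f h) ↔
      (∀ k, f (ψ (some (ρ k))) ↔ f (ψ (some k))) ∧ (f (ψ none) ↔ f (ψ (some x₀))) := by
  constructor
  · intro h
    have h0 : f (ψ none) ↔ f (ψ (some x₀)) := by
      have := h (ψ (some x₀))
      rwa [insertAfter_root] at this
    refine ⟨fun k => ?_, h0⟩
    by_cases hk : k = x₀
    · subst hk
      have := h (ψ none)
      rw [insertAfter_none] at this
      exact this.trans h0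
    · have := h (ψ (some k))
      rwa [insertAfter_some _ _ _ hk] at this
  · rintro ⟨h1, h2⟩ z
    obtain ⟨k, rfl⟩ := ψ.surjective z
    rcases k with _ | k
    · rw [insertAfter_none, h1, h2]
    · by_cases hk : k = x₀
      · subst hk
        rw [insertAfter_root, h2]
      · rw [insertAfter_some _ _ _ hk, h1]

end InsertAfter

/-! ### Removal of the edge that follows a cilium. -/

section RootEdge

variable {E E' X X' : Type}

/-- The half-edges of a map with a new edge: the side `s` of this edge is a new half-edge, and its
other side replaces the last cilium. -/
def newEdge (E X : Type) (s : Bool) : Option (HalfEdge E (X ⊕ Unit)) ≃ HalfEdge (E ⊕ Unit) X where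
  toFun z := match z with
    | none => Sum.inl (Sum.inr (), s)
    | some (Sum.inl (e, t)) => Sum.inl (Sum.inl e, t)
    | some (Sum.inr (Sum.inl i)) => Sum.inr i
    | some (Sum.inr (Sum.inr _)) => Sum.inl (Sum.inr (), !s)
  invFun z := match z with
    | Sum.inl (Sum.inl e, t) => some (Sum.inl (e, t))
    | Sum.inl (Sum.inr _, t) => if t = s then none else some (Sum.inr (Sum.inr ()))
    | Sum.inr i => some (Sum.inr (Sum.inl i))
  left_inv := by rintro (_ | ⟨⟨e, t⟩ | i | i⟩) <;> simp
  right_inv := by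
    rintro (⟨e | e, t⟩ | i)
    · rfl
    · cases s <;> cases t <;> rfl
    · rfl

@[simp] theorem newEdge_inl (s : Bool) (e : E) (t : Bool) :
    newEdge E X s (some (Sum.inl (e, t))) = Sum.inl (Sum.inl e, t) := rfl
variable {D : ℕ}

/-- The statistic of the map obtained by adding an edge of color `c` from a new half-edge after the
cilium `x₀` to the last cilium. -/
noncomputable def addEdgeStat (F : MapStat X D) (x₀ : X) (s : Bool) (c : Fin D) :
    MapStat (X ⊕ Unit) D :=
  fun E ρ col => F (E ⊕ Unit) (insertAfter (newEdge E X s) (Sum.inr (Sum.inl x₀)) ρ)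
    (Sum.elim col fun _ => c)

theorem addEdgeStat_invariant {F : MapStat X D} (hF : F.Invariant) (x₀ : X) (s : Bool) (c : Fin D) :
    (addEdgeStat F x₀ s c).Invariant := by
  intro E E' e ρ col
  have h := hF (Equiv.sumCongr e (Equiv.refl Unit))
    (insertAfter (newEdge E X s) (Sum.inr (Sum.inl x₀)) ρ) (Sum.elim col fun _ => c)
  rw [addEdgeStat, addEdgeStat, ← h]
  have h1 : (Sum.inr (Sum.inl x₀) : HalfEdge E' (X ⊕ Unit)) =
      relabelEquiv e (Equiv.refl _) (Sum.inr (Sum.inl x₀)) := rfl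
  rw [h1, insertAfter_permCongr, ← insertAfter_trans]
  congr 1
  · congr 1
    ext z
    rcases z with _ | ⟨⟨z, t⟩ | i | i⟩ <;> rfl
  · funext z
    rcases z with z | z <;> rfl

open Classical in
/-- The restriction of a statistic to the maps in which a cilium is followed by a cilium. -/
noncomputable def loopStat (F : MapStat X D) (x₀ : X) : MapStat X D :=
  fun _ rot col => if (rot (Sum.inr x₀)).isRight then F _ rot col else 0

variable [Fintype X] [DecidableEq X]

/-- The statistic does not see labels, so the distinguished edge can be taken to be the extra one,
which `insertAfter` then removes. -/
theorem sum_rooted_edge {F : MapStat X D} (hF : F.Invariant) (x₀ : X) {n : ℕ} (e : Fin (n + 1))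
    (s : Bool) :
    (∑ col : Fin (n + 1) → Fin D, ∑ rot : Perm (HalfEdge (Fin (n + 1)) X),
      if rot (Sum.inr x₀) = Sum.inl (e, s) then F _ rot col else 0) =
        ∑ c, (addEdgeStat F x₀ s c).total (Fin n) := by
  obtain ⟨ε, hε⟩ : ∃ ε : Fin (n + 1) ≃ Fin n ⊕ Unit, ε e = Sum.inr () :=
    ⟨(finSuccEquiv' e).trans (Equiv.optionEquivSumPUnit _), by simp⟩
  have h1 : (∑ col : Fin (n + 1) → Fin D, ∑ rot : Perm (HalfEdge (Fin (n + 1)) X),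
      if rot (Sum.inr x₀) = Sum.inl (e, s) then F _ rot col else 0) =
      ∑ col : Fin n ⊕ Unit → Fin D, ∑ rot : Perm (HalfEdge (Fin n ⊕ Unit) X),
        if rot (Sum.inr x₀) = Sum.inl (Sum.inr (), s) then F _ rot col else 0 := by
    refine Fintype.sum_equiv (Equiv.arrowCongr ε (Equiv.refl _)) _ _ fun col => ?_
    refine Fintype.sum_equiv (relabelEquiv ε (Equiv.refl X)).permCongr _ _ fun rot => ?_
    refine if_congr ?_ (hF ε rot col).symm rfl
    have h2 : (Sum.inr x₀ : HalfEdge (Fin n ⊕ Unit) X) =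
        relabelEquiv ε (Equiv.refl X) (Sum.inr x₀) := rfl
    have h3 : (Sum.inl (Sum.inr (), s) : HalfEdge (Fin n ⊕ Unit) X) =
        relabelEquiv ε (Equiv.refl X) (Sum.inl (e, s)) := by rw [relabelEquiv_inl, hε]
    rw [h2, h3, permCongr_apply_apply, Equiv.apply_eq_iff_eq]
  have h4 : ∀ col : Fin n ⊕ Unit → Fin D, (∑ rot : Perm (HalfEdge (Fin n ⊕ Unit) X),
        if rot (Sum.inr x₀) = Sum.inl (Sum.inr (), s) then F _ rot col else 0) =
      ∑ ρ, F _ (insertAfter (newEdge (Fin n) X s) (Sum.inr (Sum.inl x₀)) ρ) col := fun col =>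
    sum_insertAfter (newEdge (Fin n) X s) (Sum.inr (Sum.inl x₀)) fun rot => F _ rot col
  rw [h1]
  simp only [h4, MapStat.total]
  rw [← ((Equiv.sumArrowEquivProdArrow (Fin n) Unit (Fin D)).trans
    (Equiv.prodCongr (Equiv.refl _) (Equiv.funUnique Unit (Fin D)))).symm.sum_comp,
    Fintype.sum_prod_type, Finset.sum_comm]
  rfl

/-- The half-edge after `x₀` is either a cilium or one of the two sides of one of the `n + 1` edges,
and these edges contribute equally. The factor `n + 1` later cancels against the factorial. -/
theorem total_succ {F : MapStat X D} (hF : F.Invariant) (x₀ : X) (n : ℕ) :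
    F.total (Fin (n + 1)) = (loopStat F x₀).total (Fin (n + 1)) +
      (n + 1) * ∑ s : Bool, ∑ c, (addEdgeStat F x₀ s c).total (Fin n) := by
  have h1 : ∀ (col : Fin (n + 1) → Fin D) (rot : Perm (HalfEdge (Fin (n + 1)) X)),
      F _ rot col = loopStat F x₀ _ rot col + ∑ e : Fin (n + 1), ∑ s : Bool,
        if rot (Sum.inr x₀) = Sum.inl (e, s) then F _ rot col else 0 := by
    intro col rot
    rw [loopStat, ← Fintype.sum_prod_type' (f := fun (e : Fin (n + 1)) (s : Bool) =>
      if rot (Sum.inr x₀) = Sum.inl (e, s) then F _ rot col else 0)]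
    rcases rot (Sum.inr x₀) with ⟨e, s⟩ | i
    · simp
    · simp
  have h2 : F.total (Fin (n + 1)) = ∑ col : Fin (n + 1) → Fin D,
      ∑ rot : Perm (HalfEdge (Fin (n + 1)) X), (loopStat F x₀ _ rot col +
        ∑ e : Fin (n + 1), ∑ s : Bool,
          if rot (Sum.inr x₀) = Sum.inl (e, s) then F _ rot col else 0) :=
    Finset.sum_congr rfl fun col _ => Finset.sum_congr rfl fun rot _ => h1 col rot
  rw [h2]
  simp only [Finset.sum_add_distrib]
  congr 1
  have h3 : ∀ col : Fin (n + 1) → Fin D, (∑ rot : Perm (HalfEdge (Fin (n + 1)) X),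
      ∑ e : Fin (n + 1), ∑ s : Bool,
        if rot (Sum.inr x₀) = Sum.inl (e, s) then F _ rot col else 0) =
      ∑ e : Fin (n + 1), ∑ s : Bool, ∑ rot : Perm (HalfEdge (Fin (n + 1)) X),
        if rot (Sum.inr x₀) = Sum.inl (e, s) then F _ rot col else 0 := by
    intro col
    rw [Finset.sum_comm]
    exact Finset.sum_congr rfl fun e _ => Finset.sum_comm
  simp only [h3]
  rw [Finset.sum_comm]
  have h4 : ∀ e : Fin (n + 1), (∑ col : Fin (n + 1) → Fin D, ∑ s : Bool,
      ∑ rot : Perm (HalfEdge (Fin (n + 1)) X),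
        if rot (Sum.inr x₀) = Sum.inl (e, s) then F _ rot col else 0) =
      ∑ s : Bool, ∑ c, (addEdgeStat F x₀ s c).total (Fin n) := by
    intro e
    rw [Finset.sum_comm]
    exact Finset.sum_congr rfl fun s _ => sum_rooted_edge hF x₀ e s
  simp only [h4, Finset.sum_const, Finset.card_univ, Fintype.card_fin, smul_eq_mul]

/-- Removal of the edge following a cilium. -/
theorem egf_root_edge {F : MapStat X D} (hF : F.Invariant) (x₀ : X) :
    F.egf (1 / 2) = (loopStat F x₀).egf (1 / 2) +
      PowerSeries.X * ((1 / 2 : ℂ) • ∑ s : Bool, ∑ c, (addEdgeStat F x₀ s c).egf (1 / 2)) := by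
  ext n
  rcases n with _ | n
  · rw [map_add, PowerSeries.coeff_zero_X_mul, add_zero, MapStat.egf, MapStat.egf,
      PowerSeries.coeff_mk, PowerSeries.coeff_mk]
    congr 2
    refine Finset.sum_congr rfl fun col _ => Finset.sum_congr rfl fun rot _ => ?_
    rw [loopStat, if_pos]
    rcases rot (Sum.inr x₀) with ⟨e, s⟩ | i
    · exact e.elim0
    · rfl
  · rw [map_add, PowerSeries.coeff_succ_X_mul, map_smul, map_sum]
    simp only [map_sum, MapStat.egf, PowerSeries.coeff_mk]
    rw [total_succ hF x₀ n]
    simp only [← Finset.mul_sum]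
    have h1 : (n.factorial : ℂ) ≠ 0 := by exact_mod_cast n.factorial_ne_zero
    have h2 : ((n : ℂ) + 1) ≠ 0 := by exact_mod_cast n.succ_ne_zero
    rw [Nat.factorial_succ, smul_eq_mul]
    push_cast
    field_simp
    ring

end RootEdge

end QuarticTensor

namespace QuarticTensor

open Equiv Equiv.Perm

/-! ## Joining two maps by an edge -/

section Join

variable {E₁ E₂ X₁ X₂ X : Type}

/-- The half-edges of the map obtained by joining two maps by an edge: the side `s` of this edge is a
new half-edge, and its other side replaces the half-edge `r₂` of the second map. -/
structure IsJoin (Ψ : Option (HalfEdge E₁ X₁ ⊕ HalfEdge E₂ X₂) ≃ HalfEdge ((E₁ ⊕ E₂) ⊕ Unit) X)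
    (s : Bool) (r₂ : HalfEdge E₂ X₂) : Prop where
  left : ∀ e t, Ψ (some (Sum.inl (Sum.inl (e, t)))) = Sum.inl (Sum.inl (Sum.inl e), t)
  right : ∀ e t, Ψ (some (Sum.inr (Sum.inl (e, t)))) = Sum.inl (Sum.inl (Sum.inr e), t)
  source : Ψ none = Sum.inl (Sum.inr (), s)
  target : Ψ (some (Sum.inr r₂)) = Sum.inl (Sum.inr (), !s)

variable {Ψ : Option (HalfEdge E₁ X₁ ⊕ HalfEdge E₂ X₂) ≃ HalfEdge ((E₁ ⊕ E₂) ⊕ Unit) X}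
  {s : Bool} {r₂ : HalfEdge E₂ X₂} (hΨ : IsJoin Ψ s r₂) (r₁ : HalfEdge E₁ X₁)
  (m₁ : Perm (HalfEdge E₁ X₁)) (m₂ : Perm (HalfEdge E₂ X₂)) {p : (E₁ ⊕ E₂) ⊕ Unit → Prop}

include hΨ

/-- Extension of invariant predicates to the join. -/
theorem IsJoin.iff_of_linked {k k' : HalfEdge E₁ X₁ ⊕ HalfEdge E₂ X₂}
    (h : Linked (insertAfter Ψ (Sum.inl r₁) (Perm.sumCongr m₁ m₂)) p (Ψ (some k)) (Ψ (some k')))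
    (f₁ : HalfEdge E₁ X₁ → Prop) (f₂ : HalfEdge E₂ X₂ → Prop)
    (h₁ : ∀ x, f₁ (m₁ x) ↔ f₁ x) (h₂ : ∀ x, f₂ (m₂ x) ↔ f₂ x)
    (he₁ : ∀ e, p (Sum.inl (Sum.inl e)) → (f₁ (Sum.inl (e, true)) ↔ f₁ (Sum.inl (e, false))))
    (he₂ : ∀ e, p (Sum.inl (Sum.inr e)) → (f₂ (Sum.inl (e, true)) ↔ f₂ (Sum.inl (e, false))))
    (he : p (Sum.inr ()) → (f₁ r₁ ↔ f₂ r₂)) :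
    Sum.elim f₁ f₂ k ↔ Sum.elim f₁ f₂ k' := by
  have := h (fun z => Option.elim (Ψ.symm z) (f₁ r₁) (Sum.elim f₁ f₂)) ?_ ?_
  · simpa using this
  · refine (invariant_insertAfter _ _ _
      (fun z => Option.elim (Ψ.symm z) (f₁ r₁) (Sum.elim f₁ f₂))).2 ?_
    simp only [Equiv.symm_apply_apply, Option.elim_some, Option.elim_none, Sum.elim_inl, and_true]
    rintro (x | x)
    · exact h₁ x
    · exact h₂ x
  · rintro ((e | e) | e) hp
    · simpa only [← hΨ.left, Equiv.symm_apply_apply, Option.elim_some, Sum.elim_inl] using he₁ e hp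
    · simpa only [← hΨ.right, Equiv.symm_apply_apply, Option.elim_some, Sum.elim_inr] using he₂ e hp
    · have ha := hΨ.source
      have hb := hΨ.target
      have := he hp
      cases s
      · simp only [Bool.not_false] at hb
        simp only [← ha, ← hb, Equiv.symm_apply_apply, Option.elim_some, Option.elim_none,
          Sum.elim_inr]
        exact this.symm
      · simp only [Bool.not_true] at hb
        simp only [← ha, ← hb, Equiv.symm_apply_apply, Option.elim_some, Option.elim_none,
          Sum.elim_inr]
        exact this

/-- The new edge is a bridge: an invariant predicate of the first map extends to the join by its
constant value at `r₁` on the second. -/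
theorem IsJoin.linked_inl_inl {x y : HalfEdge E₁ X₁} :
    Linked (insertAfter Ψ (Sum.inl r₁) (Perm.sumCongr m₁ m₂)) p (Ψ (some (Sum.inl x)))
      (Ψ (some (Sum.inl y))) ↔ Linked m₁ (fun e => p (Sum.inl (Sum.inl e))) x y := by
  constructor
  · intro h f h1 h2
    exact hΨ.iff_of_linked r₁ m₁ m₂ h f (fun _ => f r₁) h1 (fun _ => Iff.rfl) h2
      (fun _ _ => Iff.rfl) fun _ => Iff.rfl
  · intro h g h1 h2
    rw [invariant_insertAfter] at h1
    refine h (fun z => g (Ψ (some (Sum.inl z)))) (fun z => h1.1 (Sum.inl z)) fun e he => ?_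
    rw [hΨ.left, hΨ.left]
    exact h2 _ he

theorem IsJoin.linked_inl_inr {y : HalfEdge E₂ X₂} :
    Linked (insertAfter Ψ (Sum.inl r₁) (Perm.sumCongr m₁ m₂)) p (Ψ (some (Sum.inl r₁)))
      (Ψ (some (Sum.inr y))) ↔
        p (Sum.inr ()) ∧ Linked m₂ (fun e => p (Sum.inl (Sum.inr e))) r₂ y := by
  constructor
  · intro h
    refine ⟨?_, fun f h1 h2 => ?_⟩
    · by_contra hp
      have := hΨ.iff_of_linked r₁ m₁ m₂ h (fun _ => True) (fun _ => False) (fun _ => Iff.rfl)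
        (fun _ => Iff.rfl) (fun _ _ => Iff.rfl) (fun _ _ => Iff.rfl) fun h => absurd h hp
      simp at this
    · exact hΨ.iff_of_linked r₁ m₁ m₂ h (fun _ => f r₂) f (fun _ => Iff.rfl) h1
        (fun _ _ => Iff.rfl) h2 fun _ => Iff.rfl
  · rintro ⟨hp, h⟩ g h1 h2
    rw [invariant_insertAfter] at h1
    have h3 : g (Ψ (some (Sum.inr r₂))) ↔ g (Ψ (some (Sum.inr y))) := by
      refine h (fun z => g (Ψ (some (Sum.inr z)))) (fun z => h1.1 (Sum.inr z)) fun e he => ?_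
      rw [hΨ.right, hΨ.right]
      exact h2 _ he
    rw [← h3, ← h1.2, hΨ.source, hΨ.target]
    have := h2 _ hp
    cases s
    · exact this.symm
    · exact this

theorem IsJoin.conn :
    Conn (insertAfter Ψ (Sum.inl r₁) (Perm.sumCongr m₁ m₂)) ↔ Conn m₁ ∧ Conn m₂ := by
  constructor
  · intro h
    have h2 : ∀ y, Linked m₂ (fun _ => True) r₂ y := fun y =>
      ((hΨ.linked_inl_inr r₁ m₁ m₂).1 (h _ _)).2
    exact ⟨fun x y => (hΨ.linked_inl_inl r₁ m₁ m₂).1 (h _ _),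
      fun x y => (Linked _ _).trans ((Linked _ _).symm (h2 x)) (h2 y)⟩
  · rintro ⟨h1, h2⟩
    have h3 : ∀ z, Linked (insertAfter Ψ (Sum.inl r₁) (Perm.sumCongr m₁ m₂)) (fun _ => True)
        (Ψ (some (Sum.inl r₁))) z := by
      intro z
      obtain ⟨k, rfl⟩ := Ψ.surjective z
      rcases k with _ | x | x
      · rw [← insertAfter_root Ψ (Sum.inl r₁) (Perm.sumCongr m₁ m₂)]
        exact linked_rot _ _ _
      · exact (hΨ.linked_inl_inl r₁ m₁ m₂).2 (h1 _ _)
      · exact (hΨ.linked_inl_inr r₁ m₁ m₂).2 ⟨trivial, h2 _ _⟩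
    exact fun x y => (Linked _ _).trans ((Linked _ _).symm (h3 x)) (h3 y)

/-- Vertices add up and edges add up to one more. As each connected part has at most one vertex more
than edges, the tree equality for the join forces it for both parts. -/
theorem IsJoin.tree [Finite E₁] [Finite E₂] [Finite X₁] [Finite X₂] [Finite X] :
    Tree (insertAfter Ψ (Sum.inl r₁) (Perm.sumCongr m₁ m₂)) ↔ Tree m₁ ∧ Tree m₂ := by
  cases nonempty_fintype E₁
  cases nonempty_fintype E₂
  rw [Tree, Tree, Tree, hΨ.conn, cyc_insertAfter, cyc_sumCongr]
  simp only [Nat.card_eq_fintype_card, Fintype.card_sum, Fintype.card_unit]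
  constructor
  · rintro ⟨⟨h1, h2⟩, h⟩
    have := h1.cyc_le
    have := h2.cyc_le
    exact ⟨⟨h1, by omega⟩, h2, by omega⟩
  · rintro ⟨⟨h1, h1'⟩, h2, h2'⟩
    exact ⟨⟨h1, h2⟩, by omega⟩

end Join

section AddEdge

variable {E X : Type}

/-- An edge added inside a component does not give a tree. -/
theorem not_tree_of_linked [Finite E] [Finite X] {s : Bool} {x₀ : X}
    {ρ : Perm (HalfEdge E (X ⊕ Unit))}
    (h : Linked ρ (fun _ => True) (Sum.inr (Sum.inl x₀)) (Sum.inr (Sum.inr ()))) :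
    ¬ Tree (insertAfter (newEdge E X s) (Sum.inr (Sum.inl x₀)) ρ) := by
  cases nonempty_fintype E
  rintro ⟨h1, h2⟩
  have hc : Conn ρ := by
    intro x y f hf he
    have := h1 (newEdge E X s (some x)) (newEdge E X s (some y))
      (fun z => Option.elim ((newEdge E X s).symm z) (f (Sum.inr (Sum.inl x₀))) f) ?_ ?_
    · simpa using this
    · refine (invariant_insertAfter _ _ _ (fun z =>
        Option.elim ((newEdge E X s).symm z) (f (Sum.inr (Sum.inl x₀))) f)).2 ?_
      simp only [Equiv.symm_apply_apply, Option.elim_some, Option.elim_none, and_true]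
      exact hf
    · have hpt := h f hf he
      rintro (e | e) -
      · simpa only [← newEdge_inl s, Equiv.symm_apply_apply, Option.elim_some] using he e trivial
      · have ha : (newEdge E X s).symm (Sum.inl (Sum.inr (), s)) = none := by
          rw [Equiv.symm_apply_eq]; rfl
        have hb : (newEdge E X s).symm (Sum.inl (Sum.inr (), !s)) = some (Sum.inr (Sum.inr ())) := by
          rw [Equiv.symm_apply_eq]; rfl
        cases s
        · simp only [Bool.not_false] at hb
          simpa only [ha, hb, Option.elim_some, Option.elim_none] using hpt.symm
        · simp only [Bool.not_true] at hb
          simpa only [ha, hb, Option.elim_some, Option.elim_none] using hpt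
  have h3 := hc.cyc_le
  rw [cyc_insertAfter] at h2
  simp only [Nat.card_eq_fintype_card, Fintype.card_sum, Fintype.card_unit] at h2
  omega

end AddEdge

/-! ## Trees with one or two cilia -/

section TreeStat

variable {X : Type} {D : ℕ}

open Classical in
/-- The indicator function of the trees whose cilia are linked by the edges with colors in `J`. -/
noncomputable def treeStat (X : Type) (J : Finset (Fin D)) : MapStat X D := fun _ rot col =>
  if Tree rot ∧ ∀ i j : X, Linked rot (fun e => col e ∈ J) (Sum.inr i) (Sum.inr j) then 1 else 0

theorem indicator_congr {P Q : Prop} {_ : Decidable P} {_ : Decidable Q} (h : P ↔ Q) :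
    (if P then 1 else 0 : ℕ) = if Q then 1 else 0 := if_congr h rfl rfl

theorem treeStat_invariant (J : Finset (Fin D)) : (treeStat X J).Invariant := by
  intro E E' e rot col
  refine indicator_congr (and_congr (tree_relabel _ _ _) (forall₂_congr fun i j => ?_))
  exact linked_relabel e (Equiv.refl X) rot (by simp) (Sum.inr i) (Sum.inr j)

theorem treeStat_eq_zero (J : Finset (Fin D)) {E : Type} {rot : Perm (HalfEdge E X)}
    {col : E → Fin D} (h : ¬ Tree rot) : treeStat X J E rot col = 0 :=
  if_neg fun h' => h h'.1

theorem ite_mul_ite {P Q R : Prop} {_ : Decidable P} {_ : Decidable Q} {_ : Decidable R} (h : P ↔ Q ∧ R) :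
    (if P then 1 else 0 : ℕ) = (if Q then 1 else 0) * if R then 1 else 0 := by
  by_cases hQ : Q <;> by_cases hR : R <;> simp [h, hQ, hR]

/-- The half-edges of the join of two maps at the cilium of the second one. -/
theorem isJoin_newEdge (E₁ E₂ X : Type) (s : Bool) :
    IsJoin ((Equiv.optionCongr (glueEquiv E₁ E₂ X Unit)).trans (newEdge (E₁ ⊕ E₂) X s)) s
      (Sum.inr ()) where
  left _ _ := rfl
  right _ _ := rfl
  source := rfl
  target := rfl

/-- All the cilia are in the first part, so the bridge and the second part do not affect how they
are linked. -/
theorem addEdgeStat_glue [Finite X] (J : Finset (Fin D)) (x₀ : X) (s : Bool) (c : Fin D)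
    {E₁ E₂ : Type} [Finite E₁] [Finite E₂] (m₁ : Perm (HalfEdge E₁ X))
    (m₂ : Perm (HalfEdge E₂ Unit)) (c₁ : E₁ → Fin D) (c₂ : E₂ → Fin D) :
    addEdgeStat (treeStat X J) x₀ s c (E₁ ⊕ E₂) (glue m₁ m₂) (Sum.elim c₁ c₂) =
      treeStat X J E₁ m₁ c₁ * treeStat Unit J E₂ m₂ c₂ := by
  classical
  have hR : insertAfter (newEdge (E₁ ⊕ E₂) X s) (Sum.inr (Sum.inl x₀)) (glue m₁ m₂) =
      insertAfter ((Equiv.optionCongr (glueEquiv E₁ E₂ X Unit)).trans (newEdge (E₁ ⊕ E₂) X s))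
        (Sum.inl (Sum.inr x₀)) (Perm.sumCongr m₁ m₂) := by
    rw [← glueEquiv_inl_inr, glue, insertAfter_permCongr]
  have hΨ := isJoin_newEdge E₁ E₂ X s
  rw [addEdgeStat, hR]
  refine ite_mul_ite ?_
  rw [hΨ.tree]
  have h1 : ∀ i j : X, Linked (insertAfter ((Equiv.optionCongr (glueEquiv E₁ E₂ X Unit)).trans
      (newEdge (E₁ ⊕ E₂) X s)) (Sum.inl (Sum.inr x₀)) (Perm.sumCongr m₁ m₂))
      (fun e => Sum.elim (Sum.elim c₁ c₂) (fun _ => c) e ∈ J) (Sum.inr i) (Sum.inr j) ↔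
      Linked m₁ (fun e => c₁ e ∈ J) (Sum.inr i) (Sum.inr j) := fun i j =>
    hΨ.linked_inl_inl (Sum.inr x₀) m₁ m₂ (p := fun e => Sum.elim (Sum.elim c₁ c₂) (fun _ => c) e ∈ J)
      (x := Sum.inr i) (y := Sum.inr j)
  simp only [h1]
  have h2 : ∀ i j : Unit, Linked m₂ (fun e => c₂ e ∈ J) (Sum.inr i) (Sum.inr j) := fun i j =>
    (Linked _ _).refl _
  tauto

/-- The series of the trees whose cilia are linked by the edges with colors in `J`. -/
noncomputable def linkedTreeSeries (X : Type) [Fintype X] [DecidableEq X] (J : Finset (Fin D)) :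
    PowerSeries ℂ :=
  (treeStat X J).egf (1 / 2)

open Classical in
theorem egf_addEdge_component [Fintype X] [DecidableEq X] (J : Finset (Fin D)) (x₀ : X) (s : Bool)
    (c : Fin D) :
    MapStat.egf (1 / 2) (fun E rot col => if CiliaComponent x₀ rot then
      addEdgeStat (treeStat X J) x₀ s c E rot col else 0) =
        linkedTreeSeries X J * linkedTreeSeries Unit J :=
  egf_component _ x₀ _ _ _ (addEdgeStat_invariant (treeStat_invariant J) x₀ s c)
    (fun _ _ _ h => treeStat_eq_zero J fun h' => h h'.1)
    fun _ _ _ _ m₁ m₂ c₁ c₂ _ => addEdgeStat_glue J x₀ s c m₁ m₂ c₁ c₂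

end TreeStat

/-! ### Trees with one cilium and the Catalan equation. -/

section OneCilium

variable {D : ℕ}

theorem isEmpty_of_fixed {E X : Type} {rot : Perm (HalfEdge E X)} {x₀ : X} (h : Conn rot)
    (h0 : rot (Sum.inr x₀) = Sum.inr x₀) (z : HalfEdge E X) : z = Sum.inr x₀ := by
  have := h (Sum.inr x₀) z (fun z => z = Sum.inr x₀) (fun z => ?_) ?_
  · exact this.1 rfl
  · constructor
    · intro hz
      rw [← h0] at hz
      exact rot.injective hz
    · rintro rfl
      exact h0
  · simp

theorem tree_of_isEmpty {E : Type} [IsEmpty E] (rot : Perm (HalfEdge E Unit)) : Tree rot := by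
  have h : Subsingleton (HalfEdge E Unit) := by
    refine ⟨?_⟩
    rintro (⟨e, -⟩ | i) (⟨e', -⟩ | i')
    exacts [isEmptyElim e, isEmptyElim e, isEmptyElim e', rfl]
  refine ⟨fun x y => ?_, ?_⟩
  · rw [Subsingleton.elim x y]
  · have h1 : rot = 1 := Subsingleton.elim _ _
    rw [h1, cyc_one]
    simp

/-- A cilium followed by itself is alone on its vertex, and by connectedness the tree has no edge.
-/
theorem egf_loopStat_unit (J : Finset (Fin D)) :
    (loopStat (treeStat Unit J) ()).egf (1 / 2) = 1 := by
  classical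
  ext n
  rw [MapStat.egf, PowerSeries.coeff_mk, PowerSeries.coeff_one]
  rcases n with _ | n
  · have h1 : ∀ (col : Fin 0 → Fin D) (rot : Perm (HalfEdge (Fin 0) Unit)),
        loopStat (treeStat Unit J) () _ rot col = 1 := by
      intro col rot
      rw [loopStat, if_pos, treeStat, if_pos]
      · exact ⟨tree_of_isEmpty rot, fun i j => (Linked _ _).refl _⟩
      · rcases rot (Sum.inr ()) with ⟨e, -⟩ | i
        · exact e.elim0
        · rfl
    simp [MapStat.total, h1, Fintype.card_perm]
  · have h1 : ∀ (col : Fin (n + 1) → Fin D) (rot : Perm (HalfEdge (Fin (n + 1)) Unit)),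
        loopStat (treeStat Unit J) () _ rot col = 0 := by
      intro col rot
      rw [loopStat]
      split_ifs with h
      · refine treeStat_eq_zero J fun ht => ?_
        have h0 : rot (Sum.inr ()) = Sum.inr () := by
          rcases hz : rot (Sum.inr ()) with z | i
          · rw [hz] at h; simp at h
          · rfl
        have := isEmpty_of_fixed ht.1 h0 (Sum.inl (0, true))
        simp at this
      · rfl
    simp [MapStat.total, h1]

/-- Removing the edge after the cilium leaves two trees with one cilium each. Its color is
arbitrary, and the sum over its two sides compensates the weight `1 / 2`. -/
theorem linkedTreeSeries_unit_eq (J : Finset (Fin D)) :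
    linkedTreeSeries Unit J = 1 + (D : PowerSeries ℂ) * PowerSeries.X * linkedTreeSeries Unit J ^ 2 := by
  classical
  have h1 : ∀ (s : Bool) (c : Fin D), (addEdgeStat (treeStat Unit J) () s c).egf (1 / 2) =
      linkedTreeSeries Unit J * linkedTreeSeries Unit J := by
    intro s c
    rw [← egf_addEdge_component J () s c]
    refine egf_congr _ fun E _ rot col => ?_
    split_ifs with h
    · rfl
    · refine treeStat_eq_zero J fun ht => h ?_
      rintro (i | i)
      · exact iff_of_true ((Linked _ _).refl _) rfl
      · exact iff_of_false (fun hl => not_tree_of_linked hl ht) (by simp)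
  have h2 := egf_root_edge (treeStat_invariant (X := Unit) J) ()
  rw [egf_loopStat_unit] at h2
  simp only [h1, Finset.sum_const, Finset.card_univ, Fintype.card_fin, Fintype.card_bool] at h2
  refine h2.trans ?_
  have h3 : (1 / 2 : ℂ) • 2 • D • (linkedTreeSeries Unit J * linkedTreeSeries Unit J) =
      (D : PowerSeries ℂ) * linkedTreeSeries Unit J ^ 2 := by
    rw [← Nat.cast_smul_eq_nsmul ℂ 2, smul_smul, nsmul_eq_mul, sq]
    norm_num
  rw [h3]
  ring

theorem linkedTreeSeries_unit (J : Finset (Fin D)) : linkedTreeSeries Unit J = melonicT D := by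
  set A := linkedTreeSeries Unit J with hA
  have h1 : A = 1 + (D : PowerSeries ℂ) * PowerSeries.X * A ^ 2 := linkedTreeSeries_unit_eq J
  have h2 := melonicT_eq D
  -- Both series solve the same quadratic equation. The second factor has constant coefficient `1`,
  -- so the first one vanishes.
  have h3 : (A - melonicT D) * (1 - (D : PowerSeries ℂ) * PowerSeries.X * (A + melonicT D)) = 0 := by
    linear_combination h1 + h2
  rcases mul_eq_zero.1 h3 with h | h
  · exact sub_eq_zero.1 h
  · have := congrArg PowerSeries.constantCoeff h
    simp at this

end OneCilium

end QuarticTensor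

namespace QuarticTensor

open Equiv Equiv.Perm

/-! ### Trees with two cilia linked by prescribed colors. -/

section TwoCilia

variable {D : ℕ}

/-- The half-edges of a map with two cilia, the second one being added after the first one. -/
def newCilium (E : Type) : Option (HalfEdge E Unit) ≃ HalfEdge E (Unit ⊕ Unit) where
  toFun z := match z with
    | none => Sum.inr (Sum.inr ())
    | some (Sum.inl y) => Sum.inl y
    | some (Sum.inr _) => Sum.inr (Sum.inl ())
  invFun z := match z with
    | Sum.inl y => some (Sum.inl y)
    | Sum.inr (Sum.inl _) => some (Sum.inr ())
    | Sum.inr (Sum.inr _) => none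
  left_inv := by rintro (_ | y | i) <;> rfl
  right_inv := by rintro (y | i | i) <;> rfl

theorem linked_insertAfter_newCilium {E : Type} (ρ : Perm (HalfEdge E Unit)) {p : E → Prop}
    {x y : HalfEdge E Unit} :
    Linked (insertAfter (newCilium E) (Sum.inr ()) ρ) p (newCilium E (some x))
      (newCilium E (some y)) ↔ Linked ρ p x y := by
  constructor
  · intro h f h1 h2
    have := h (fun z => Option.elim ((newCilium E).symm z) (f (Sum.inr ())) f) ?_ fun e he => ?_
    · simpa using this
    · refine (invariant_insertAfter _ _ _ (fun z =>
        Option.elim ((newCilium E).symm z) (f (Sum.inr ())) f)).2 ?_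
      simp only [Equiv.symm_apply_apply, Option.elim_some, Option.elim_none, and_true]
      exact h1
    · exact h2 e he
  · intro h g h1 h2
    rw [invariant_insertAfter] at h1
    exact h (fun z => g (newCilium E (some z))) h1.1 h2

theorem linked_insertAfter_cilia {E : Type} (ρ : Perm (HalfEdge E Unit)) (p : E → Prop)
    (i j : Unit ⊕ Unit) :
    Linked (insertAfter (newCilium E) (Sum.inr ()) ρ) p (Sum.inr i) (Sum.inr j) := by
  have h : ∀ i, Linked (insertAfter (newCilium E) (Sum.inr ()) ρ) p (Sum.inr (Sum.inl ()))
      (Sum.inr i) := by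
    rintro (i | i)
    · exact (Linked _ _).refl _
    · change Linked _ p (newCilium E (some (Sum.inr ()))) (newCilium E none)
      rw [← insertAfter_root (newCilium E) (Sum.inr ()) ρ]
      exact linked_rot _ _ _
  exact (Linked _ _).trans ((Linked _ _).symm (h i)) (h j)

theorem tree_insertAfter_newCilium {E : Type} [Finite E] (ρ : Perm (HalfEdge E Unit)) :
    Tree (insertAfter (newCilium E) (Sum.inr ()) ρ) ↔ Tree ρ := by
  rw [Tree, Tree, cyc_insertAfter]
  refine and_congr_left fun _ => ⟨fun h x y => ?_, fun h => ?_⟩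
  · exact (linked_insertAfter_newCilium ρ).1 (h _ _)
  · have h3 : ∀ z, Linked (insertAfter (newCilium E) (Sum.inr ()) ρ) (fun _ => True)
        (newCilium E (some (Sum.inr ()))) z := by
      intro z
      obtain ⟨k, rfl⟩ := (newCilium E).surjective z
      rcases k with _ | x
      · exact linked_insertAfter_cilia ρ _ (Sum.inl ()) (Sum.inr ())
      · exact (linked_insertAfter_newCilium ρ).2 (h _ _)
    exact fun x y => (Linked _ _).trans ((Linked _ _).symm (h3 x)) (h3 y)

theorem treeStat_newCilium (J : Finset (Fin D)) {E : Type} [Finite E] (ρ : Perm (HalfEdge E Unit))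
    (col : E → Fin D) : treeStat (Unit ⊕ Unit) J E (insertAfter (newCilium E) (Sum.inr ()) ρ) col =
      treeStat Unit J E ρ col := by
  have h : ∀ i j : Unit, Linked ρ (fun e => col e ∈ J) (Sum.inr i) (Sum.inr j) := fun i j =>
    (Linked _ _).refl _
  exact indicator_congr (and_congr (tree_insertAfter_newCilium ρ)
    (iff_of_true (linked_insertAfter_cilia ρ _) h))

/-- When the first cilium is followed by a cilium it must be the second one, since a cilium alone on
its vertex would disconnect the map. Erasing the second cilium leaves a tree with one cilium. -/
theorem egf_loopStat_two (J : Finset (Fin D)) :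
    (loopStat (treeStat (Unit ⊕ Unit) J) (Sum.inl ())).egf (1 / 2) = linkedTreeSeries Unit J := by
  classical
  ext n
  rw [linkedTreeSeries, MapStat.egf, MapStat.egf, PowerSeries.coeff_mk, PowerSeries.coeff_mk]
  congr 2
  refine Finset.sum_congr rfl fun col _ => ?_
  have h1 := sum_insertAfter (newCilium (Fin n)) (Sum.inr ())
    fun rot => treeStat (Unit ⊕ Unit) J _ rot col
  simp only [treeStat_newCilium] at h1
  rw [← h1]
  refine Finset.sum_congr rfl fun rot _ => ?_
  by_cases ht : Tree rot
  · rw [loopStat]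
    refine if_congr ?_ rfl rfl
    change _ ↔ rot (Sum.inr (Sum.inl ())) = Sum.inr (Sum.inr ())
    rcases hz : rot (Sum.inr (Sum.inl ())) with z | i | i
    · simp
    · have := isEmpty_of_fixed ht.1 hz (Sum.inr (Sum.inr ()))
      simp at this
    · simp
  · simp [loopStat, treeStat_eq_zero J ht]

theorem forall_linked_iff {E : Type} (rot : Perm (HalfEdge E (Unit ⊕ Unit))) (p : E → Prop) :
    (∀ i j : Unit ⊕ Unit, Linked rot p (Sum.inr i) (Sum.inr j)) ↔
      Linked rot p (Sum.inr (Sum.inr ())) (Sum.inr (Sum.inl ())) := by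
  refine ⟨fun h => h _ _, fun h => ?_⟩
  rintro (i | i) (j | j)
  exacts [(Linked _ _).refl _, (Linked _ _).symm h, h, (Linked _ _).refl _]

/-- The relabeling of three cilia. -/
abbrev assocCilia (E : Type) : HalfEdge E (Unit ⊕ Unit ⊕ Unit) ≃ HalfEdge E ((Unit ⊕ Unit) ⊕ Unit) :=
  relabelEquiv (Equiv.refl E) (Equiv.sumAssoc Unit Unit Unit).symm

/-- The half-edges of the join of a map with one cilium and of a map with two cilia, at the second
cilium of the latter. -/
theorem isJoin_assoc (E₁ E₂ : Type) (s : Bool) :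
    IsJoin ((Equiv.optionCongr (glueEquiv E₁ E₂ Unit (Unit ⊕ Unit))).trans
      ((Equiv.optionCongr (assocCilia (E₁ ⊕ E₂))).trans (newEdge (E₁ ⊕ E₂) (Unit ⊕ Unit) s))) s
        (Sum.inr (Sum.inr ())) where
  left _ _ := rfl
  right _ _ := rfl
  source := rfl
  target := rfl

open Classical in
/-- The trees whose first cilium is joined by an edge of color `c` to the part that contains the other
cilium. -/
noncomputable def separatedStat (J : Finset (Fin D)) (c : Fin D) : MapStat (Unit ⊕ Unit) D :=
  fun E rot col => if c ∈ J then treeStat (Unit ⊕ Unit) J E rot col else 0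

theorem addEdgeStat_glue_assoc (J : Finset (Fin D)) (s : Bool) (c : Fin D)
    {E₁ E₂ : Type} [Finite E₁] [Finite E₂] (m₁ : Perm (HalfEdge E₁ Unit))
    (m₂ : Perm (HalfEdge E₂ (Unit ⊕ Unit))) (c₁ : E₁ → Fin D) (c₂ : E₂ → Fin D) :
    addEdgeStat (treeStat (Unit ⊕ Unit) J) (Sum.inl ()) s c (E₁ ⊕ E₂)
      ((assocCilia (E₁ ⊕ E₂)).permCongr (glue m₁ m₂)) (Sum.elim c₁ c₂) =
      treeStat Unit J E₁ m₁ c₁ * separatedStat J c E₂ m₂ c₂ := by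
  classical
  have hΨ := isJoin_assoc E₁ E₂ s
  set Ψ := (Equiv.optionCongr (glueEquiv E₁ E₂ Unit (Unit ⊕ Unit))).trans
      ((Equiv.optionCongr (assocCilia (E₁ ⊕ E₂))).trans (newEdge (E₁ ⊕ E₂) (Unit ⊕ Unit) s)) with hdef
  have hR : insertAfter (newEdge (E₁ ⊕ E₂) (Unit ⊕ Unit) s) (Sum.inr (Sum.inl (Sum.inl ())))
      ((assocCilia (E₁ ⊕ E₂)).permCongr (glue m₁ m₂)) =
      insertAfter Ψ (Sum.inl (Sum.inr ())) (Perm.sumCongr m₁ m₂) := by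
    have h0 : (Sum.inr (Sum.inl (Sum.inl ())) : HalfEdge (E₁ ⊕ E₂) ((Unit ⊕ Unit) ⊕ Unit)) =
        assocCilia (E₁ ⊕ E₂) (glueEquiv E₁ E₂ Unit (Unit ⊕ Unit) (Sum.inl (Sum.inr ()))) := rfl
    rw [h0, insertAfter_permCongr, glue, insertAfter_permCongr]
  rw [addEdgeStat, hR, separatedStat, treeStat, treeStat, treeStat, ← ite_and]
  refine ite_mul_ite ?_
  have h1 : Linked (insertAfter Ψ (Sum.inl (Sum.inr ())) (Perm.sumCongr m₁ m₂))
      (fun e => Sum.elim (Sum.elim c₁ c₂) (fun _ => c) e ∈ J) (Sum.inr (Sum.inl ()))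
      (Sum.inr (Sum.inr ())) ↔
      c ∈ J ∧ Linked m₂ (fun e => c₂ e ∈ J) (Sum.inr (Sum.inr ())) (Sum.inr (Sum.inl ())) :=
    hΨ.linked_inl_inr (Sum.inr ()) m₁ m₂
      (p := fun e => Sum.elim (Sum.elim c₁ c₂) (fun _ => c) e ∈ J) (y := Sum.inr (Sum.inl ()))
  rw [hΨ.tree, forall_linked_iff, forall_linked_iff, (Linked _ _).comm', h1]
  have h2 : ∀ i j : Unit, Linked m₁ (fun e => c₁ e ∈ J) (Sum.inr i) (Sum.inr j) := fun i j =>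
    (Linked _ _).refl _
  tauto

/-- The transport of a statistic along the relabeling of three cilia. -/
def assocStat (F : MapStat ((Unit ⊕ Unit) ⊕ Unit) D) : MapStat (Unit ⊕ Unit ⊕ Unit) D :=
  fun E rot col => F E ((assocCilia E).permCongr rot) col

theorem assocStat_invariant {F : MapStat ((Unit ⊕ Unit) ⊕ Unit) D} (hF : F.Invariant) :
    (assocStat F).Invariant := by
  intro E E' e rot col
  rw [assocStat, assocStat, ← hF e]
  congr 1
  ext1 z
  obtain ⟨y, rfl⟩ := (assocCilia E').surjective z
  obtain ⟨x, rfl⟩ := (relabelEquiv e (Equiv.refl _)).surjective y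
  have h : ∀ x, assocCilia E' (relabelEquiv e (Equiv.refl _) x) =
      relabelEquiv e (Equiv.refl _) (assocCilia E x) := by
    rintro (⟨x, s⟩ | i) <;> rfl
  rw [permCongr_apply_apply, permCongr_apply_apply, h, h, permCongr_apply_apply,
    permCongr_apply_apply]

open Classical in
theorem egf_assocStat {F : MapStat ((Unit ⊕ Unit) ⊕ Unit) D} :
    MapStat.egf (1 / 2) (fun E rot col => if CiliaComponent () rot then assocStat F E rot col else 0) =
      MapStat.egf (1 / 2) (fun E rot col => if CiliaComponent (X₁ := Unit) (X₂ := Unit ⊕ Unit) ()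
        ((assocCilia E).symm.permCongr rot) then F E rot col else 0) := by
  refine egf_congr_cilia _ (Equiv.sumAssoc Unit Unit Unit).symm fun E _ rot col => ?_
  have h : (assocCilia E).symm.permCongr ((assocCilia E).permCongr rot) = rot := by
    ext1 z
    rw [Equiv.permCongr_apply, Equiv.symm_symm, permCongr_apply_apply, Equiv.symm_apply_apply]
  rw [h]
  rfl

open Classical in
theorem egf_addEdge_assoc (J : Finset (Fin D)) (s : Bool) (c : Fin D) :
    MapStat.egf (1 / 2) (fun E rot col =>
      if CiliaComponent (X₁ := Unit) (X₂ := Unit ⊕ Unit) () ((assocCilia E).symm.permCongr rot) then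
        addEdgeStat (treeStat (Unit ⊕ Unit) J) (Sum.inl ()) s c E rot col else 0) =
      linkedTreeSeries Unit J * (separatedStat J c).egf (1 / 2) := by
  rw [← egf_assocStat]
  exact egf_component (1 / 2) () _ _ _
    (assocStat_invariant (addEdgeStat_invariant (treeStat_invariant J) (Sum.inl ()) s c))
    (fun _ _ _ h => treeStat_eq_zero J fun h' => h h'.1)
    fun _ _ _ _ m₁ m₂ c₁ c₂ _ => addEdgeStat_glue_assoc J s c m₁ m₂ c₁ c₂

theorem egf_separatedStat (J : Finset (Fin D)) (c : Fin D) [Decidable (c ∈ J)] :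
    (separatedStat J c).egf (1 / 2) = if c ∈ J then linkedTreeSeries (Unit ⊕ Unit) J else 0 := by
  split_ifs with h
  · refine egf_congr _ fun E _ rot col => ?_
    rw [separatedStat, if_pos h]
  · ext n
    simp [MapStat.egf, MapStat.total, separatedStat, h]

/-- After the removal of the root edge, the second cilium lies either with the first one, and the
color of the edge is free, or at the other end, and the path between the cilia uses the edge, whose
color must be in `J`. -/
theorem egf_addEdge_two (J : Finset (Fin D)) (s : Bool) (c : Fin D) [Decidable (c ∈ J)] :
    (addEdgeStat (treeStat (Unit ⊕ Unit) J) (Sum.inl ()) s c).egf (1 / 2) =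
      linkedTreeSeries (Unit ⊕ Unit) J * linkedTreeSeries Unit J +
        linkedTreeSeries Unit J * if c ∈ J then linkedTreeSeries (Unit ⊕ Unit) J else 0 := by
  classical
  rw [← egf_separatedStat, ← egf_addEdge_assoc J s c, ← egf_addEdge_component J (Sum.inl ()) s c,
    ← egf_add]
  refine egf_congr _ fun E _ rot col => ?_
  -- Outside the support there is nothing to compare. On it, the ends of the removed edge lie in
  -- different components, so exactly one of the two cases occurs.
  by_cases ht : addEdgeStat (treeStat (Unit ⊕ Unit) J) (Sum.inl ()) s c E rot col = 0
  · simp [ht]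
  have hn : ¬ Linked rot (fun _ => True) (Sum.inr (Sum.inl (Sum.inl ()))) (Sum.inr (Sum.inr ())) := by
    intro hl
    exact ht (treeStat_eq_zero J (not_tree_of_linked hl))
  have hassoc : ∀ i, Linked ((assocCilia E).symm.permCongr rot) (fun _ => True)
      (Sum.inr (Sum.inl ())) (Sum.inr i) ↔ Linked rot (fun _ => True)
        (Sum.inr (Sum.inl (Sum.inl ()))) (Sum.inr ((Equiv.sumAssoc Unit Unit Unit).symm i)) := by
    intro i
    have := linked_relabel (Equiv.refl E) (Equiv.sumAssoc Unit Unit Unit) rot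
      (p := fun _ => True) (p' := fun _ => True) (fun _ => Iff.rfl)
      (Sum.inr (Sum.inl (Sum.inl ()))) (Sum.inr ((Equiv.sumAssoc Unit Unit Unit).symm i))
    rw [relabelEquiv_inr, relabelEquiv_inr, Equiv.apply_symm_apply] at this
    exact this
  have h1 : CiliaComponent (Sum.inl ()) rot ↔
      Linked rot (fun _ => True) (Sum.inr (Sum.inl (Sum.inl ()))) (Sum.inr (Sum.inl (Sum.inr ()))) := by
    refine ⟨fun h => (h _).2 rfl, fun h => ?_⟩
    rintro ((i | i) | i)
    · exact iff_of_true ((Linked _ _).refl _) rfl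
    · exact iff_of_true h rfl
    · exact iff_of_false hn (by simp)
  have h2 : CiliaComponent (X₁ := Unit) (X₂ := Unit ⊕ Unit) () ((assocCilia E).symm.permCongr rot) ↔
      ¬ Linked rot (fun _ => True) (Sum.inr (Sum.inl (Sum.inl ())))
        (Sum.inr (Sum.inl (Sum.inr ()))) := by
    refine ⟨fun h h' => ?_, fun h => ?_⟩
    · have := (h (Sum.inr (Sum.inl ()))).1 ((hassoc _).2 h')
      simp at this
    · rintro (i | i | i)
      · exact iff_of_true ((Linked _ _).refl _) rfl
      · exact iff_of_false (fun h' => h ((hassoc _).1 h')) (by simp)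
      · exact iff_of_false (fun h' => hn ((hassoc _).1 h')) (by simp)
  rw [if_congr h1 rfl rfl, if_congr h2 rfl rfl]
  split_ifs <;> simp

theorem linkedTreeSeries_two_eq (J : Finset (Fin D)) :
    linkedTreeSeries (Unit ⊕ Unit) J = melonicT D +
      ((D : PowerSeries ℂ) + (J.card : PowerSeries ℂ)) * PowerSeries.X * melonicT D *
        linkedTreeSeries (Unit ⊕ Unit) J := by
  classical
  have h2 := egf_root_edge (treeStat_invariant (X := Unit ⊕ Unit) J) (Sum.inl ())
  rw [egf_loopStat_two] at h2
  simp only [egf_addEdge_two, linkedTreeSeries_unit, Finset.sum_add_distrib, ← Finset.mul_sum,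
    Finset.sum_const, Finset.card_univ, Fintype.card_fin, Fintype.card_bool,
    Finset.sum_ite_mem, Finset.univ_inter] at h2
  refine h2.trans ?_
  have h3 : (PowerSeries.C (1 / 2 : ℂ)) * 2 = 1 := by
    rw [← map_ofNat PowerSeries.C 2, ← map_mul]
    norm_num
  rw [PowerSeries.smul_eq_C_mul]
  simp only [nsmul_eq_mul, Nat.cast_ofNat]
  linear_combination ((D : PowerSeries ℂ) + (J.card : PowerSeries ℂ)) * PowerSeries.X * melonicT D *
    linkedTreeSeries (Unit ⊕ Unit) J * h3

/-- The series of the trees whose two cilia are linked by the edges with colors in `J`. -/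
theorem linkedTreeSeries_two (J : Finset (Fin D)) :
    linkedTreeSeries (Unit ⊕ Unit) J *
      (1 - (J.card : PowerSeries ℂ) * PowerSeries.X * melonicT D ^ 2) = melonicT D ^ 2 := by
  -- The recursion is multiplied by `T`, and `T - D z T ^ 2 = 1` eliminates the dependence on `D`.
  linear_combination melonicT D * linkedTreeSeries_two_eq J +
    linkedTreeSeries (Unit ⊕ Unit) J * melonicT_eq D

end TwoCilia

end QuarticTensor

namespace QuarticTensor

open Equiv Equiv.Perm

/-! ## Closed forms -/

section ClosedForms

variable {D : ℕ}

theorem linkedTreeSeries_congr {X X' : Type} [Fintype X] [DecidableEq X] [Fintype X']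
    [DecidableEq X'] (g : X ≃ X') (J : Finset (Fin D)) :
    linkedTreeSeries X J = linkedTreeSeries X' J := by
  refine egf_congr_cilia _ g fun E _ rot col => ?_
  refine indicator_congr (and_congr (tree_relabel _ _ _) ?_)
  rw [← g.forall_congr_right]
  refine forall_congr' fun i => ?_
  rw [← g.forall_congr_right]
  exact forall_congr' fun j => linked_relabel (Equiv.refl E) g rot (p := fun e => col e ∈ J)
    (fun _ => Iff.rfl) (Sum.inr i) (Sum.inr j)

theorem linkedTreeSeries_fin_two (J : Finset (Fin D)) :
    linkedTreeSeries (Fin 2) J *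
      (1 - (J.card : PowerSeries ℂ) * PowerSeries.X * melonicT D ^ 2) = melonicT D ^ 2 := by
  rw [← linkedTreeSeries_congr (Fintype.equivFinOfCardEq (by simp) : Unit ⊕ Unit ≃ Fin 2)]
  exact linkedTreeSeries_two J

open Classical in
/-- The indicator function of the trees with two cilia and boundary graph `B_{4,C}`. -/
noncomputable def boundaryStat (C : Finset (Fin D)) : MapStat (Fin 2) D := fun _ rot col =>
  if Tree rot ∧ Apart rot ∧ (boundary rot col = C ∨ boundary rot col = Cᶜ) then 1 else 0

theorem labeledTreeSeries_eq_egf (C : Finset (Fin D)) :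
    labeledTreeSeries C = (boundaryStat C).egf (1 / 2) := by
  ext n
  rw [labeledTreeSeries, MapStat.egf, PowerSeries.coeff_mk, PowerSeries.coeff_mk, one_div,
    MapStat.total]
  simp only [boundaryStat, Nat.cast_sum, Nat.cast_ite, Nat.cast_one, Nat.cast_zero]

theorem egf_sum {ι X : Type} [Fintype ι] [Fintype X] [DecidableEq X] (r : ℂ) (F : ι → MapStat X D) :
    MapStat.egf r (fun E rot col => ∑ i, F i E rot col) = ∑ i, (F i).egf r := by
  ext n
  rw [map_sum]
  simp only [MapStat.egf, PowerSeries.coeff_mk, MapStat.total]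
  rw [← Finset.mul_sum, ← Nat.cast_sum]
  congr 2
  rw [Finset.sum_comm (s := (Finset.univ : Finset ι))]
  refine Finset.sum_congr rfl fun col _ => ?_
  rw [Finset.sum_comm]

variable {E : Type} {rot : Perm (HalfEdge E (Fin 2))} {col : E → Fin D}

theorem forall_linked_fin_two (p : E → Prop) :
    (∀ i j : Fin 2, Linked rot p (Sum.inr i) (Sum.inr j)) ↔ Linked rot p (Sum.inr 0) (Sum.inr 1) := by
  refine ⟨fun h => h _ _, fun h i j => ?_⟩
  fin_cases i <;> fin_cases j
  exacts [(Linked _ _).refl _, h, (Linked _ _).symm h, (Linked _ _).refl _]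

open Classical in
theorem treeStat_fin_two (h : Tree rot) (J : Finset (Fin D)) : treeStat (Fin 2) J E rot col =
    if Linked rot (fun e => col e ∈ J) (Sum.inr 0) (Sum.inr 1) then 1 else 0 :=
  indicator_congr ((and_iff_right h).trans (forall_linked_fin_two fun e => col e ∈ J))

theorem treeStat_of_not_apart (h : Tree rot) (ha : ¬ Apart rot) (J : Finset (Fin D)) :
    treeStat (Fin 2) J E rot col = 1 := by
  rw [treeStat_fin_two h, if_pos (linked_of_sameCycle (not_not.1 ha))]

theorem treeStat_empty_of_apart (h : Tree rot) (ha : Apart rot) :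
    treeStat (Fin 2) (∅ : Finset (Fin D)) E rot col = 0 := by
  rw [treeStat_fin_two h, if_neg]
  rwa [linked_false (by simp)]

theorem boundaryStat_of_not_tree (h : ¬ Tree rot) (C : Finset (Fin D)) :
    boundaryStat C E rot col = 0 := if_neg fun h' => h h'.1

theorem boundaryStat_of_not_apart (h : ¬ Apart rot) (C : Finset (Fin D)) :
    boundaryStat C E rot col = 0 := if_neg fun h' => h h'.2.1

open Classical in
theorem boundaryStat_of_apart (h : Tree rot) (ha : Apart rot) (C : Finset (Fin D)) :
    boundaryStat C E rot col =
      if boundary rot col = C ∨ boundary rot col = Cᶜ then 1 else 0 :=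
  indicator_congr ((and_iff_right h).trans (and_iff_right ha))

variable [Finite E]

open Classical in
theorem treeStat_singleton_of_apart (h : Tree rot) (c : Fin D) :
    treeStat (Fin 2) {c} E rot col = if c ∈ boundary rot col then 1 else 0 := by
  cases nonempty_fintype E
  rw [treeStat_fin_two h]
  refine if_congr ?_ rfl rfl
  rw [mem_boundary, h.sameCycle_face_iff col c]
  rw [Linked.congr fun e => Finset.mem_singleton]

open Classical in
theorem boundaryStat_singleton_of_apart (hD : 3 ≤ D) (h : Tree rot) (ha : Apart rot) (c : Fin D) :
    boundaryStat {c} E rot col = if c ∈ boundary rot col then 1 else 0 := by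
  cases nonempty_fintype E
  have hb := h.card_boundary_le col ha
  rw [boundaryStat_of_apart h ha]
  refine if_congr ⟨?_, fun hc => Or.inl ?_⟩ rfl rfl
  · rintro (hc | hc)
    · simp [hc]
    · rw [hc, Finset.card_compl, Fintype.card_fin, Finset.card_singleton] at hb
      omega
  · exact (Finset.eq_of_subset_of_card_le (Finset.singleton_subset_iff.2 hc) (by simpa using hb)).symm

open Classical in
theorem boundaryStat_empty_of_apart (hD : 3 ≤ D) (h : Tree rot) (ha : Apart rot) :
    boundaryStat (∅ : Finset (Fin D)) E rot col = if boundary rot col = ∅ then 1 else 0 := by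
  cases nonempty_fintype E
  have hb := h.card_boundary_le col ha
  rw [boundaryStat_of_apart h ha]
  refine if_congr (or_iff_left fun hc => ?_) rfl rfl
  rw [hc, Finset.compl_empty, Finset.card_univ, Fintype.card_fin] at hb
  omega

/-- Cilia linked by edges of color `c` are either on one vertex or share a face of color `c`. In the
second case the boundary is `{c}`, since it has at most one element. -/
theorem treeStat_singleton (hD : 3 ≤ D) (rot : Perm (HalfEdge E (Fin 2))) (col : E → Fin D)
    (c : Fin D) : treeStat (Fin 2) {c} E rot col =
      boundaryStat {c} E rot col + treeStat (Fin 2) ∅ E rot col := by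
  by_cases h : Tree rot
  · by_cases ha : Apart rot
    · rw [treeStat_singleton_of_apart h, boundaryStat_singleton_of_apart hD h ha,
        treeStat_empty_of_apart h ha, add_zero]
    · rw [treeStat_of_not_apart h ha, treeStat_of_not_apart h ha, boundaryStat_of_not_apart ha]
  · rw [treeStat_eq_zero _ h, treeStat_eq_zero _ h, boundaryStat_of_not_tree h]

/-- In a tree the cilia are always linked by some edges. If they are apart, the boundary is empty or
a single color, and these cases are disjoint. -/
theorem treeStat_univ (hD : 3 ≤ D) (rot : Perm (HalfEdge E (Fin 2))) (col : E → Fin D) :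
    treeStat (Fin 2) Finset.univ E rot col =
      boundaryStat ∅ E rot col + ∑ c, boundaryStat {c} E rot col + treeStat (Fin 2) ∅ E rot col := by
  classical
  cases nonempty_fintype E
  by_cases h : Tree rot
  · by_cases ha : Apart rot
    · have hb := h.card_boundary_le col ha
      simp only [boundaryStat_singleton_of_apart hD h ha, Finset.sum_boole, Finset.filter_univ_mem]
      rw [boundaryStat_empty_of_apart hD h ha, treeStat_empty_of_apart h ha, treeStat_fin_two h,
        if_pos (Linked.mono (fun e _ => Finset.mem_univ _) (h.1 _ _)), add_zero]
      split_ifs with hc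
      · simp [hc]
      · have := Finset.card_pos.2 (Finset.nonempty_iff_ne_empty.2 hc)
        simp only [Nat.cast_id]
        omega
    · simp [treeStat_of_not_apart h ha, boundaryStat_of_not_apart ha]
  · simp [treeStat_eq_zero _ h, boundaryStat_of_not_tree h]

theorem linkedTreeSeries_singleton (hD : 3 ≤ D) (c : Fin D) : linkedTreeSeries (Fin 2) {c} =
    labeledTreeSeries {c} + linkedTreeSeries (Fin 2) (∅ : Finset (Fin D)) := by
  rw [labeledTreeSeries_eq_egf, linkedTreeSeries, linkedTreeSeries, ← egf_add]
  exact egf_congr _ fun E _ rot col => treeStat_singleton hD rot col c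

theorem linkedTreeSeries_univ (hD : 3 ≤ D) : linkedTreeSeries (Fin 2) (Finset.univ : Finset (Fin D)) =
    labeledTreeSeries (∅ : Finset (Fin D)) + ∑ c : Fin D, labeledTreeSeries {c} +
      linkedTreeSeries (Fin 2) (∅ : Finset (Fin D)) := by
  simp only [labeledTreeSeries_eq_egf]
  rw [linkedTreeSeries, linkedTreeSeries, ← egf_sum, ← egf_add, ← egf_add]
  exact egf_congr _ fun E _ rot col => treeStat_univ hD rot col

theorem linkedTreeSeries_empty :
    linkedTreeSeries (Fin 2) (∅ : Finset (Fin D)) = melonicT D ^ 2 := by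
  simpa using linkedTreeSeries_fin_two (∅ : Finset (Fin D))

theorem labeledTreeSeries_singleton_mul (hD : 3 ≤ D) (c : Fin D) :
    labeledTreeSeries {c} * (1 - PowerSeries.X * melonicT D ^ 2) =
      PowerSeries.X * melonicT D ^ 4 := by
  have h1 := linkedTreeSeries_fin_two {c}
  rw [linkedTreeSeries_singleton hD, linkedTreeSeries_empty, Finset.card_singleton, Nat.cast_one] at h1
  linear_combination h1

theorem labeledTreeSeries_singleton (hD : 3 ≤ D) (c : Fin D) : labeledTreeSeries {c} =
    PowerSeries.X * melonicT D ^ 4 * (1 - PowerSeries.X * melonicT D ^ 2)⁻¹ :=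
  (PowerSeries.eq_mul_inv_iff_mul_eq (by simp)).2 (labeledTreeSeries_singleton_mul hD c)

/-- The trees with a one-color boundary and those with both cilia on one vertex are subtracted from
all the trees with two cilia. -/
theorem labeledTreeSeries_empty (hD : 3 ≤ D) : labeledTreeSeries (∅ : Finset (Fin D)) =
    (D : PowerSeries ℂ) * ((D : PowerSeries ℂ) - 1) * PowerSeries.X ^ 2 * melonicT D ^ 6 *
      ((1 - (D : PowerSeries ℂ) * PowerSeries.X * melonicT D ^ 2) *
        (1 - PowerSeries.X * melonicT D ^ 2))⁻¹ := by
  rw [PowerSeries.eq_mul_inv_iff_mul_eq (by simp)]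
  have h1 := linkedTreeSeries_fin_two (Finset.univ : Finset (Fin D))
  have h2 : ∑ c : Fin D, labeledTreeSeries {c} * (1 - PowerSeries.X * melonicT D ^ 2) =
      (D : PowerSeries ℂ) * (PowerSeries.X * melonicT D ^ 4) := by
    simp [labeledTreeSeries_singleton_mul hD]
  rw [← Finset.sum_mul] at h2
  rw [linkedTreeSeries_univ hD, linkedTreeSeries_empty, Finset.card_univ, Fintype.card_fin] at h1
  linear_combination (1 - PowerSeries.X * melonicT D ^ 2) * h1 -
    (1 - (D : PowerSeries ℂ) * PowerSeries.X * melonicT D ^ 2) * h2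

/-- Both `C` and its complement have at least two elements, too many for the boundary of a tree. -/
theorem labeledTreeSeries_eq_zero {C : Finset (Fin D)} (h2 : 2 ≤ C.card) (hC : 2 * C.card ≤ D) :
    labeledTreeSeries C = 0 := by
  rw [labeledTreeSeries_eq_egf]
  have h : ∀ (E : Type) [Finite E] (rot : Perm (HalfEdge E (Fin 2))) (col : E → Fin D),
      boundaryStat C E rot col = 0 := by
    intro E _ rot col
    cases nonempty_fintype E
    refine if_neg ?_
    rintro ⟨ht, ha, hb⟩
    have h1 := ht.card_boundary_le col ha
    rcases hb with hb | hb
    · rw [hb] at h1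
      omega
    · rw [hb, Finset.card_compl, Fintype.card_fin] at h1
      omega
  ext n
  simp [MapStat.egf, MapStat.total, h]

end ClosedForms

end QuarticTensor

theorem mainTheorem6 (D : ℕ) (hD : 3 ≤ D) :
    ∃ W : ℕ → Finset (Fin D) → PowerSeries ℂ,
      (∀ N : ℕ, 2 ≤ N → ∀ w : Finset (Fin D) → PowerSeries ℂ,
        IsBubbleExpansion D N w ↔ w = W N) ∧
      (∀ C : Finset (Fin D),
        PerturbativeBigO (fun N => rescaled N C (W N C) - treeSeries C) (D - 2)) ∧
      (∀ c : Fin D,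
        treeSeries {c} =
            PowerSeries.X * melonicT D ^ 4 * (1 - PowerSeries.X * melonicT D ^ 2)⁻¹ ∧
        PerturbativeBigO
          (fun N => rescaled N {c} (W N {c}) -
            PowerSeries.X * melonicT D ^ 4 * (1 - PowerSeries.X * melonicT D ^ 2)⁻¹) (D - 2)) ∧
      (treeSeries (∅ : Finset (Fin D)) =
          (D : PowerSeries ℂ) * ((D : PowerSeries ℂ) - 1) * PowerSeries.X ^ 2 * melonicT D ^ 6 *
            ((1 - (D : PowerSeries ℂ) * PowerSeries.X * melonicT D ^ 2) *
              (1 - PowerSeries.X * melonicT D ^ 2))⁻¹ ∧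
        PerturbativeBigO
          (fun N => rescaled N (∅ : Finset (Fin D)) (W N ∅) -
            (D : PowerSeries ℂ) * ((D : PowerSeries ℂ) - 1) * PowerSeries.X ^ 2 * melonicT D ^ 6 *
              ((1 - (D : PowerSeries ℂ) * PowerSeries.X * melonicT D ^ 2) *
                (1 - PowerSeries.X * melonicT D ^ 2))⁻¹) (D - 2)) ∧
      (∀ C : Finset (Fin D), 2 ≤ C.card → 2 * C.card ≤ D →
        PerturbativeBigO (fun N => rescaled N C (W N C)) (D - 2)) := by
  have hK := fun C : Finset (Fin D) => perturbativeBigO_rescaled hD C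
  have h0 : ∀ (F : ℕ → PowerSeries ℂ), PerturbativeBigO (fun N => F N - 0) (D - 2) →
      PerturbativeBigO F (D - 2) := fun F h => by simpa only [sub_zero] using h
  refine ⟨fun N => bubbleSeries D N, fun N hN w => isBubbleExpansion_iff hN w, fun C => ?_,
    fun c => ⟨?_, ?_⟩, ⟨?_, ?_⟩, fun C h2 hC => h0 _ ?_⟩
  · rw [treeSeries_eq_labeledTreeSeries]
    exact hK C
  · rw [treeSeries_eq_labeledTreeSeries, labeledTreeSeries_singleton hD]
  · rw [← labeledTreeSeries_singleton hD]
    exact hK {c}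
  · rw [treeSeries_eq_labeledTreeSeries, labeledTreeSeries_empty hD]
  · rw [← labeledTreeSeries_empty hD]
    exact hK ∅
  · rw [← labeledTreeSeries_eq_zero h2 hC]
    exact hK C
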